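/- Let $d\ge1$, $d_1\ge 1$ be integers, $B=\{x\in\mathbb R^d:|x|\le1\}$, and let $A$ be a nonempty set. For $k=\pm1,\dots,\pm d_1$ let vectors $l_k\in B$ and, for $\alpha\in A$, real-valued functions $a^\alpha_k,b^\alpha_k,c^\alpha,f^\alpha$ on $\mathbb R^d$ be given; let $g:\mathbb R^d\to\mathbb R$ and constants $\delta,K\in(0,\infty)$ be given. Assume: (a) for all $\alpha\in A$, all $k$ and on $\mathbb R^d$: $a^\alpha_k\ge\delta$, $c^\alpha\ge\delta$, and each of $\varphi=g,a^\alpha_k,b^\alpha_k,c^\alpha,f^\alpha$ belongs to $C^{1,1}(\mathbb R^d)$ with $\|\varphi\|_{C^{1,1}(\mathbb R^d)}:=\sup|\varphi|+\sup|D\varphi|+\sup_{x\ne y}\frac{|D\varphi(x)-D\varphi(y)|}{|x-y|}\le K$; (b) $l_k=-l_{-k}$ and $a^\alpha_k=a^\alpha_{-k}$ for all $k$ and $\alpha$; (c) there is an integer $1\le d_0\le d_1$ such that, with $\Lambda=\{l_k:k=\pm1,\dots,\pm d_1\}$ and $\mathcal L=\{l_{\pm1},\dots,l_{\pm d_0}\}$,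 one has $0\in\mathcal L$ and $\mathcal L+\mathcal L\supset\Lambda\supset\{l'+l'':l',l''\in\mathcal L,\ l'\ne l''\}$; (d) the coordinates of all $l_k$ are rational and $\operatorname{Span}\Lambda=\mathbb R^d$; (e) $\psi\in C^2(\mathbb R^d)$ is such that $\Omega=\{x:\psi(x)>0\}$ is a bounded domain (nonempty and connected) and $|D\psi|\ge1$ on $\partial\Omega$. For $h>0$ and $\xi\in\mathbb R^d$ put $\delta_{h,\xi}\varphi(x)=\frac{\varphi(x+h\xi)-\varphi(x)}{h}$, $\Delta_{h,\xi}\varphi(x)=\frac{\varphi(x+h\xi)-2\varphi(x)+\varphi(x-h\xi)}{h^2}$, $\delta_{h,k}=\delta_{h,l_k}$, $\Delta_{h,k}=\Delta_{h,l_k}$. Let $\Omega_h=\{x\in\Omega:x+hB\subset\Omega\}$, $\partial_h\Omega=\mathbb R^d\setminus\Omega_h$ and $\rho(x)=\operatorname{dist}(x,\mathbb R^d\setminus\Omega)$. Then there are constants $N\in[0,\infty)$ and $h_0>0$ such that for all $h\in(0,h_0]$ the following is true. (i) There is a unique bounded Borel function $v_h$ on $\mathbb R^d$ such that $$\sup_{\alpha\in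 A}\Big[\sum_{1\le|k|\le d_1}\big(a^\alpha_k(x)\Delta_{h,k}v_h(x)+b^\alpha_k(x)\delta_{h,k}v_h(x)\big)-c^\alpha(x)v_h(x)+f^\alpha(x)\Big]=0\quad\text{for }x\in\Omega_h$$ and $v_h=g$ on $\partial_h\Omega$. (ii) For all $x,y\in\mathbb R^d$ and all $i,j\in\{\pm1,\dots,\pm d_1\}$, $$|v_h(x)-g(x)|\le N\rho(x),\qquad|\delta_{h,i}v_h(x)|\le N,\qquad(\rho(x)-6h)\,|\delta_{h,i}\delta_{h,j}v_h(x)|\le N,$$ $$|v_h(x)-v_h(y)|\le N(|x-y|+h).$$ -/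

import Mathlib

open scoped ENNReal Pointwise

noncomputable section

namespace BellmanFD

/-- The Euclidean space `ℝ^d`. -/
abbrev E (d : ℕ) : Type := EuclideanSpace ℝ (Fin d)

/-- The index set `{±1, …, ±n}`. -/
def signedIdx (n : ℕ) : Finset ℤ := (Finset.Icc (-(n : ℤ)) (n : ℤ)).erase 0

/-- The set of directions `{l_{±1}, …, l_{±n}}`. -/
def dirSet {d : ℕ} (l : ℤ → E d) (n : ℕ) : Set (E d) := {z | ∃ k ∈ signedIdx n, z = l k}

/-- The `C^{1,1}(ℝ^d)` norm `sup |φ| + sup |Dφ| + [Dφ]_{Lip}` of a differentiable function. -/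
def c11Norm {d : ℕ} (φ : E d → ℝ) : ℝ≥0∞ :=
  (⨆ x, ‖φ x‖ₑ) + (⨆ x, ‖fderiv ℝ φ x‖ₑ) +
    ⨆ (x : E d) (y : E d) (_ : x ≠ y), ‖fderiv ℝ φ x - fderiv ℝ φ y‖ₑ / edist x y

/-- `φ ∈ C^{1,1}(ℝ^d)` and `‖φ‖_{C^{1,1}(ℝ^d)} ≤ K`. -/
def C11Le {d : ℕ} (φ : E d → ℝ) (K : ℝ) : Prop :=
  Differentiable ℝ φ ∧ c11Norm φ ≤ ENNReal.ofReal K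

/-- The first-order difference `δ_{h,ξ} φ (x) = (φ(x + hξ) - φ(x)) / h`. -/
def fdiff {d : ℕ} (h : ℝ) (ξ : E d) (φ : E d → ℝ) (x : E d) : ℝ :=
  (φ (x + h • ξ) - φ x) / h

/-- The second-order difference
`Δ_{h,ξ} φ (x) = (φ(x + hξ) - 2 φ(x) + φ(x - hξ)) / h²`. -/
def sdiff {d : ℕ} (h : ℝ) (ξ : E d) (φ : E d → ℝ) (x : E d) : ℝ :=
  (φ (x + h • ξ) - 2 * φ x + φ (x - h • ξ)) / h ^ 2

/-- `Ω_h = {x ∈ Ω : x + hB ⊆ Ω}` with `B` the closed unit ball. -/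
def innerSet {d : ℕ} (Ω : Set (E d)) (h : ℝ) : Set (E d) :=
  {x | x ∈ Ω ∧ ∀ z ∈ Metric.closedBall (0 : E d) 1, x + h • z ∈ Ω}

/-- `ρ(x) = dist(x, Ωᶜ)`. -/
def rho {d : ℕ} (Ω : Set (E d)) (x : E d) : ℝ := Metric.infDist x Ωᶜ

/-- The function `v` satisfies at the point `x` the finite-difference Bellman equation
`sup_α [∑_k a_k^α Δ_{h,k} v + ∑_k b_k^α δ_{h,k} v - c^α v + f^α] = 0`, with `k = ±1, …, ±d₁`. -/
def SchemeAt {A : Type*} {d : ℕ} (d₁ : ℕ) (l : ℤ → E d) (a b : A → ℤ → E d → ℝ)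
    (c f : A → E d → ℝ) (h : ℝ) (v : E d → ℝ) (x : E d) : Prop :=
  IsLUB (Set.range fun α : A =>
    (∑ k ∈ signedIdx d₁, a α k x * sdiff h (l k) v x) +
      (∑ k ∈ signedIdx d₁, b α k x * fdiff h (l k) v x) - c α x * v x + f α x) 0

/-- `v` is a bounded Borel function on `ℝ^d` which satisfies the finite-difference Bellman
equation in `Ω_h` and the boundary condition `v = g` on `∂_hΩ = ℝ^d \ Ω_h`. -/
structure IsBddBorelSolution {A : Type*} {d : ℕ} (d₁ : ℕ) (l : ℤ → E d)
    (a b : A → ℤ → E d → ℝ) (c f : A → E d → ℝ) (g : E d → ℝ) (Ω : Set (E d)) (h : ℝ)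
    (v : E d → ℝ) : Prop where
  borel : Measurable v
  bounded : ∃ M : ℝ, ∀ x, |v x| ≤ M
  equation : ∀ x ∈ innerSet Ω h, SchemeAt d₁ l a b c f h v x
  boundary : ∀ x ∈ (innerSet Ω h)ᶜ, v x = g x

end BellmanFD

end

/-! By the symmetry in `k`, the scheme is a controlled jump operator with rates `(2a + hb)/h²`,
nonnegative for small `h`. It therefore obeys a maximum principle. Since bounded functions need not
attain their supremum, every argument is run at an approximate maximum, and a nearly optimal `α` is
chosen only there.

Existence is a contraction argument for a relaxed equation, with `c ≥ δ` supplying the contraction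
factor. Uniqueness is comparison. The boundary estimate compares `v - g` with a multiple of `ψ -
λψ²`, whose image under the operator is at most `-1` near the boundary (`exists_boundary_bound`).

The interior estimates are a discrete Bernstein method. At `x` a nearly optimal `α` almost gives
equality, while at neighbouring points the same `α` gives an inequality. Differencing thus yields
one-sided inequalities for `L δ_k v` and `L Δ_k v`, so only lower bounds of differences are directly
accessible. The maximum over directions is replaced by `∑ exp(-κ w_k)`: strong convexity of `exp`
produces the squares of all `δ_i w_k`, which absorb the terms coming from differenced coefficients
(`exists_exp_gen_lower`). An added compensator, `v²` for first differences and `∑ (N - δ_i v)²` for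
second ones, then contradicts the approximate maximum. Upper bounds follow by reversing the
direction for first differences, and from the equation together with `a ≥ δ` for second ones. Second
differences carry the weight `ψ`. Mixed differences reduce to pure ones by polarization, and this is
where the additive structure of the directions enters.

The last estimate, for points not joined by the lattice directions, needs bounds on `δ_ξ v` for
every `ξ` in the unit ball. There the awkward terms are either absorbed by the squares of second
differences or moved into the rates, changing them by `O(h)` only (`exists_translation_bound`). All
constants are uniform in `h`. -/

noncomputable section

namespace BellmanFD

variable {A : Type*} {d d₁ : ℕ}

/-! ### Jump form of the scheme. -/

/-- Pointwise form of a `C^{1,1}` bound. -/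
structure C11Bounds (φ : E d → ℝ) (K : ℝ) : Prop where
  abs_le : ∀ x, |φ x| ≤ K
  lip : ∀ x y, |φ (x + y) - φ x| ≤ K * ‖y‖
  second : ∀ x y, |φ (x + y) - 2 * φ x + φ (x - y)| ≤ K * ‖y‖ ^ 2

/-- The jump operator with rates `r k / h²` and jumps `h l_k`. -/
def gen (d₁ : ℕ) (l : ℤ → E d) (h : ℝ) (r : ℤ → ℝ) (u : E d → ℝ) (x : E d) : ℝ :=
  ∑ k ∈ signedIdx d₁, r k * (u (x + h • l k) - u x) / h ^ 2

theorem neg_mem_signedIdx {n : ℕ} {k : ℤ} (hk : k ∈ signedIdx n) : -k ∈ signedIdx n := by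
  simp only [signedIdx, Finset.mem_erase, Finset.mem_Icc] at hk ⊢
  omega

theorem sum_neg_signedIdx {n : ℕ} (F : ℤ → ℝ) :
    ∑ k ∈ signedIdx n, F (-k) = ∑ k ∈ signedIdx n, F k :=
  Finset.sum_nbij' (fun k => -k) (fun k => -k) (fun _ => neg_mem_signedIdx)
    (fun _ => neg_mem_signedIdx) (by simp) (by simp) (by simp)

/-- Reindexing by `k ↦ -k` turns the backward half of each `Δ_k` into a forward jump. This is the
source of the factor 2, and the drift enters with an extra `h`. -/
theorem sum_sdiff_add_sum_fdiff {l : ℤ → E d} (hl : ∀ k ∈ signedIdx d₁, l (-k) = -l k)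
    {p : ℤ → ℝ} (hp : ∀ k ∈ signedIdx d₁, p (-k) = p k) (q : ℤ → ℝ) {h : ℝ} (hh : 0 < h)
    (u : E d → ℝ) (x : E d) :
    (∑ k ∈ signedIdx d₁, p k * sdiff h (l k) u x) + ∑ k ∈ signedIdx d₁, q k * fdiff h (l k) u x
      = gen d₁ l h (fun k => 2 * p k + h * q k) u x := by
  have h1 : ∑ k ∈ signedIdx d₁, p k * (u (x - h • l k) - u x) / h ^ 2
      = ∑ k ∈ signedIdx d₁, p k * (u (x + h • l k) - u x) / h ^ 2 := by
    rw [← sum_neg_signedIdx (fun k => p k * (u (x + h • l k) - u x) / h ^ 2)]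
    refine Finset.sum_congr rfl fun k hk => ?_
    rw [hp k hk, hl k hk, smul_neg, ← sub_eq_add_neg]
  have h2 : ∑ k ∈ signedIdx d₁, p k * sdiff h (l k) u x
      = ∑ k ∈ signedIdx d₁, p k * (u (x + h • l k) - u x) / h ^ 2
        + ∑ k ∈ signedIdx d₁, p k * (u (x - h • l k) - u x) / h ^ 2 := by
    rw [← Finset.sum_add_distrib]
    refine Finset.sum_congr rfl fun k _ => ?_
    unfold sdiff; ring
  rw [h2, h1, gen, ← Finset.sum_add_distrib, ← Finset.sum_add_distrib]
  refine Finset.sum_congr rfl fun k _ => ?_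
  unfold fdiff; field_simp; ring

/-! ### Algebra of jump operators. -/

section Gen

variable {l : ℤ → E d} {h : ℝ} {r s : ℤ → ℝ} {u w : E d → ℝ} {x : E d}

theorem gen_add_fun : gen d₁ l h r (fun y => u y + w y) x = gen d₁ l h r u x + gen d₁ l h r w x := by
  unfold gen; rw [← Finset.sum_add_distrib]
  exact Finset.sum_congr rfl fun k _ => by ring

theorem gen_sub_fun : gen d₁ l h r (fun y => u y - w y) x = gen d₁ l h r u x - gen d₁ l h r w x := by
  unfold gen; rw [← Finset.sum_sub_distrib]
  exact Finset.sum_congr rfl fun k _ => by ring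

theorem gen_neg_fun : gen d₁ l h r (fun y => -u y) x = -gen d₁ l h r u x := by
  unfold gen; rw [← Finset.sum_neg_distrib]
  exact Finset.sum_congr rfl fun k _ => by ring

theorem gen_const_mul_fun (t : ℝ) : gen d₁ l h r (fun y => t * u y) x = t * gen d₁ l h r u x := by
  unfold gen; rw [Finset.mul_sum]
  exact Finset.sum_congr rfl fun k _ => by ring

theorem gen_sum_fun {ι : Type*} (J : Finset ι) (v : ι → E d → ℝ) :
    gen d₁ l h r (fun y => ∑ j ∈ J, v j y) x = ∑ j ∈ J, gen d₁ l h r (v j) x := by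
  unfold gen; rw [Finset.sum_comm]
  refine Finset.sum_congr rfl fun k _ => ?_
  rw [← Finset.sum_sub_distrib, Finset.mul_sum, Finset.sum_div]

theorem gen_add_rate : gen d₁ l h (fun k => r k + s k) u x = gen d₁ l h r u x + gen d₁ l h s u x := by
  unfold gen; rw [← Finset.sum_add_distrib]
  exact Finset.sum_congr rfl fun k _ => by ring

theorem gen_const_mul_rate (t : ℝ) :
    gen d₁ l h (fun k => t * r k) u x = t * gen d₁ l h r u x := by
  unfold gen; rw [Finset.mul_sum]
  exact Finset.sum_congr rfl fun k _ => by ring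

/-- Discrete Leibniz rule. For `u = w` the last sum is a positive quadratic form in the differences,
the source of all good terms below. -/
theorem gen_mul_fun (hh : h ≠ 0) : gen d₁ l h r (fun y => u y * w y) x
    = u x * gen d₁ l h r w x + w x * gen d₁ l h r u x
      + ∑ k ∈ signedIdx d₁, r k * (fdiff h (l k) u x * fdiff h (l k) w x) := by
  unfold gen fdiff
  rw [Finset.mul_sum, Finset.mul_sum, ← Finset.sum_add_distrib, ← Finset.sum_add_distrib]
  exact Finset.sum_congr rfl fun k _ => by field_simp; ring

theorem gen_le_of_le {C τ : ℝ} (hh : 0 < h) (hτ : 0 ≤ τ) (hr0 : ∀ k ∈ signedIdx d₁, 0 ≤ r k)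
    (hrC : ∀ k ∈ signedIdx d₁, r k ≤ C)
    (hu : ∀ k ∈ signedIdx d₁, u (x + h • l k) ≤ u x + h ^ 2 * τ) :
    gen d₁ l h r u x ≤ (signedIdx d₁).card * (C * τ) := by
  unfold gen
  rw [← nsmul_eq_mul]
  refine Finset.sum_le_card_nsmul _ _ _ fun k hk => ?_
  rw [div_le_iff₀ (by positivity)]
  calc r k * (u (x + h • l k) - u x) ≤ r k * (h ^ 2 * τ) :=
        mul_le_mul_of_nonneg_left (by linarith [hu k hk]) (hr0 k hk)
    _ ≤ C * (h ^ 2 * τ) := mul_le_mul_of_nonneg_right (hrC k hk) (by positivity)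
    _ = C * τ * h ^ 2 := by ring

end Gen

/-! ### Approximate maxima and standing hypotheses. -/

/-- An approximate maximum principle which does not need the maximum to be attained. -/
theorem exists_near_max {X ι : Type*} (S : Finset ι) (τ : ι → X → X) (u : X → ℝ) (D : Set X)
    {C : ℝ} (hC : ∀ x ∈ D, u x ≤ C) {x₀ : X} (hx₀ : x₀ ∈ D)
    (hout : ∀ x ∈ D, ∀ k ∈ S, τ k x ∈ D ∨ u (τ k x) ≤ u x₀) {ε : ℝ} (hε : 0 < ε) :
    ∃ x ∈ D, u x₀ ≤ u x ∧ ∀ k ∈ S, u (τ k x) ≤ u x + ε := by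
  have hbdd : BddAbove (u '' D) := ⟨C, by rintro _ ⟨x, hx, rfl⟩; exact hC x hx⟩
  obtain ⟨_, ⟨x, hx, rfl⟩, hxs⟩ :=
    exists_lt_of_lt_csSup (Set.Nonempty.image u ⟨x₀, hx₀⟩) (sub_lt_self (sSup (u '' D)) hε)
  have hle : ∀ y ∈ D, u y ≤ sSup (u '' D) := fun y hy => le_csSup hbdd ⟨y, hy, rfl⟩
  obtain ⟨z, hz, hz0, hzs⟩ : ∃ z ∈ D, u x₀ ≤ u z ∧ sSup (u '' D) - ε < u z := by
    rcases le_total (u x₀) (u x) with hc | hc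
    · exact ⟨x, hx, hc, hxs⟩
    -- If `x₀` beats the nearly maximal point, it is itself nearly maximal.
    · exact ⟨x₀, hx₀, le_rfl, by linarith⟩
  refine ⟨z, hz, hz0, fun k hk => ?_⟩
  rcases hout z hz k hk with hD | hD
  · linarith [hle _ hD]
  · linarith

/-- The standing hypotheses on the equation. -/
structure Admissible (d₁ : ℕ) (l : ℤ → E d) (a b : A → ℤ → E d → ℝ) (c f : A → E d → ℝ)
    (g : E d → ℝ) (δ K : ℝ) : Prop where
  pos : 0 < δ
  le : δ ≤ K
  norm_le : ∀ k ∈ signedIdx d₁, ‖l k‖ ≤ 1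
  neg : ∀ k ∈ signedIdx d₁, l (-k) = -l k
  a_neg : ∀ α, ∀ k ∈ signedIdx d₁, ∀ x, a α (-k) x = a α k x
  a_lower : ∀ α, ∀ k ∈ signedIdx d₁, ∀ x, δ ≤ a α k x
  c_lower : ∀ α x, δ ≤ c α x
  a_reg : ∀ α, ∀ k ∈ signedIdx d₁, C11Bounds (a α k) K
  b_reg : ∀ α, ∀ k ∈ signedIdx d₁, C11Bounds (b α k) K
  c_reg : ∀ α, C11Bounds (c α) K
  f_reg : ∀ α, C11Bounds (f α) K
  g_reg : C11Bounds g K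

/-- The mesh sizes for which the scheme is monotone with a margin. -/
structure SmallStep (δ K h : ℝ) : Prop where
  pos : 0 < h
  le_one : h ≤ 1
  mul_le : 2 * K * h ≤ δ

/-- The jump rates of the scheme, multiplied by `h²`. -/
def rate (a b : A → ℤ → E d → ℝ) (h : ℝ) (α : A) (x : E d) (k : ℤ) : ℝ :=
  2 * a α k x + h * b α k x

/-! ### Maximum principle, comparison and the uniform bound. -/

section Basic

variable {l : ℤ → E d} {a b : A → ℤ → E d → ℝ} {c f : A → E d → ℝ} {g : E d → ℝ} {δ K h : ℝ}

theorem Admissible.K_pos (H : Admissible d₁ l a b c f g δ K) : 0 < K := H.pos.trans_le H.le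

/-- The condition `2Kh ≤ δ` gives `|hb| ≤ δ/2`, so the drift cannot spoil the positivity coming from
`2a ≥ 2δ`. -/
theorem Admissible.rate_bounds (H : Admissible d₁ l a b c f g δ K) (hh : SmallStep δ K h) (α : A)
    (x : E d) {k : ℤ} (hk : k ∈ signedIdx d₁) : δ ≤ rate a b h α x k ∧ rate a b h α x k ≤ 3 * K := by
  have h1 := H.a_lower α k hk x
  have h2 := abs_le.1 ((H.a_reg α k hk).abs_le x)
  have h3 := abs_le.1 ((H.b_reg α k hk).abs_le x)
  have h4 := hh.mul_le
  have h5 := hh.pos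
  have h6 := hh.le_one
  have := H.K_pos
  unfold rate
  constructor <;> nlinarith

theorem Admissible.norm_smul_le (H : Admissible d₁ l a b c f g δ K) (hh : 0 < h) {k : ℤ}
    (hk : k ∈ signedIdx d₁) : ‖h • l k‖ ≤ h := by
  rw [norm_smul, Real.norm_of_nonneg hh.le]
  exact mul_le_of_le_one_right hh.le (H.norm_le k hk)

theorem C11Bounds.nonneg {φ : E d → ℝ} (hφ : C11Bounds φ K) : 0 ≤ K :=
  (abs_nonneg _).trans (hφ.abs_le 0)

theorem C11Bounds.abs_fdiff_le {φ : E d → ℝ} (hφ : C11Bounds φ K) (hh : 0 < h) {ξ : E d}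
    (hξ : ‖ξ‖ ≤ 1) (x : E d) : |fdiff h ξ φ x| ≤ K := by
  unfold fdiff
  rw [abs_div, abs_of_pos hh, div_le_iff₀ hh]
  refine (hφ.lip x (h • ξ)).trans ?_
  rw [norm_smul, Real.norm_of_nonneg hh.le]
  exact mul_le_mul_of_nonneg_left (mul_le_of_le_one_right hh.le hξ) hφ.nonneg

theorem C11Bounds.abs_sdiff_le {φ : E d → ℝ} (hφ : C11Bounds φ K) (hh : 0 < h) {ξ : E d}
    (hξ : ‖ξ‖ ≤ 1) (x : E d) : |sdiff h ξ φ x| ≤ K := by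
  unfold sdiff
  rw [abs_div, abs_of_pos (by positivity : 0 < h ^ 2), div_le_iff₀ (by positivity)]
  refine (hφ.second x (h • ξ)).trans ?_
  rw [norm_smul, Real.norm_of_nonneg hh.le]
  have : (h * ‖ξ‖) ^ 2 ≤ h ^ 2 :=
    pow_le_pow_left₀ (by positivity) (mul_le_of_le_one_right hh.le hξ) 2
  exact mul_le_mul_of_nonneg_left this hφ.nonneg

theorem Admissible.scheme_eq_gen (H : Admissible d₁ l a b c f g δ K) (hh : 0 < h) (α : A)
    (v : E d → ℝ) (y x : E d) :
    (∑ k ∈ signedIdx d₁, a α k y * sdiff h (l k) v x)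
      + (∑ k ∈ signedIdx d₁, b α k y * fdiff h (l k) v x) = gen d₁ l h (rate a b h α y) v x :=
  sum_sdiff_add_sum_fdiff H.neg (fun k hk => H.a_neg α k hk y) _ hh v x

/-- The operator applied to a function with bounded differences is bounded. -/
theorem Admissible.abs_gen_le (H : Admissible d₁ l a b c f g δ K) (hh : 0 < h) (α : A)
    {φ : E d → ℝ} {P : ℝ} (hφ : C11Bounds φ P) (x : E d) :
    |gen d₁ l h (rate a b h α x) φ x| ≤ (signedIdx d₁).card * (2 * K * P) := by
  rw [← H.scheme_eq_gen hh α φ x x, ← Finset.sum_add_distrib, ← nsmul_eq_mul]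
  refine (Finset.abs_sum_le_sum_abs _ _).trans (Finset.sum_le_card_nsmul _ _ _ fun k hk => ?_)
  have h1 := (H.a_reg α k hk).abs_le x
  have h2 := (H.b_reg α k hk).abs_le x
  have h3 := hφ.abs_sdiff_le hh (H.norm_le k hk) x
  have h4 := hφ.abs_fdiff_le hh (H.norm_le k hk) x
  refine (abs_add_le _ _).trans ?_
  rw [abs_mul, abs_mul]
  have := mul_le_mul h1 h3 (abs_nonneg _) H.K_pos.le
  have := mul_le_mul h2 h4 (abs_nonneg _) H.K_pos.le
  linarith

theorem IsBddBorelSolution.gen_le (H : Admissible d₁ l a b c f g δ K) (hh : 0 < h) {Ω : Set (E d)}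
    {v : E d → ℝ} (hv : IsBddBorelSolution d₁ l a b c f g Ω h v) {x : E d} (hx : x ∈ innerSet Ω h)
    (α : A) : gen d₁ l h (rate a b h α x) v x - c α x * v x + f α x ≤ 0 := by
  rw [← H.scheme_eq_gen hh α v x x]
  exact (hv.equation x hx).1 ⟨α, rfl⟩

theorem IsBddBorelSolution.exists_abs_gen_le (H : Admissible d₁ l a b c f g δ K) (hh : 0 < h)
    {Ω : Set (E d)} {v : E d → ℝ} (hv : IsBddBorelSolution d₁ l a b c f g Ω h v) {x : E d}
    (hx : x ∈ innerSet Ω h) {ε : ℝ} (hε : 0 < ε) :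
    ∃ α, |gen d₁ l h (rate a b h α x) v x - c α x * v x + f α x| ≤ ε := by
  obtain ⟨_, ⟨α, rfl⟩, hα, -⟩ :=
    (hv.equation x hx).exists_between (show (-ε : ℝ) < 0 by linarith)
  refine ⟨α, abs_le.2 ⟨?_, (hv.gen_le H hh hx α).trans hε.le⟩⟩
  rw [← H.scheme_eq_gen hh α v x x]
  exact hα.le

/-- At an approximate maximum of `u` over `D` all admissible jump operators are almost
nonpositive. -/
theorem Admissible.exists_gen_le (H : Admissible d₁ l a b c f g δ K) (hh : 0 < h) (u : E d → ℝ)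
    (D : Set (E d)) {C : ℝ} (hC : ∀ x ∈ D, u x ≤ C) {x₀ : E d} (hx₀ : x₀ ∈ D)
    (hout : ∀ x ∈ D, ∀ k ∈ signedIdx d₁, x + h • l k ∈ D ∨ u (x + h • l k) ≤ u x₀)
    {ε : ℝ} (hε : 0 < ε) :
    ∃ x ∈ D, u x₀ ≤ u x ∧ ∀ r : ℤ → ℝ, (∀ k ∈ signedIdx d₁, 0 ≤ r k ∧ r k ≤ 6 * K) →
      gen d₁ l h r u x ≤ ε := by
  have hK := H.K_pos
  set n : ℝ := ((signedIdx d₁).card : ℝ) with hn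
  have hn0 : 0 ≤ n := by positivity
  obtain ⟨x, hx, hx0, hxk⟩ := exists_near_max (signedIdx d₁) (fun k y => y + h • l k) u D hC hx₀ hout
    (ε := h ^ 2 * (ε / (n * (6 * K) + 1))) (by positivity)
  refine ⟨x, hx, hx0, fun r hr => (gen_le_of_le (C := 6 * K) hh (by positivity)
    (fun k hk => (hr k hk).1) (fun k hk => (hr k hk).2) hxk).trans ?_⟩
  rw [← hn, ← mul_assoc, ← mul_div_assoc, div_le_iff₀ (by positivity)]
  nlinarith

/-- The ceiling `6K` instead of `3K` leaves room for the perturbed rates of the translation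
estimate. -/
theorem Admissible.rate_mem (H : Admissible d₁ l a b c f g δ K) (hh : SmallStep δ K h) (α : A)
    (x : E d) : ∀ k ∈ signedIdx d₁, 0 ≤ rate a b h α x k ∧ rate a b h α x k ≤ 6 * K := fun k hk => by
  have := H.rate_bounds hh α x hk
  have := H.pos
  have := H.K_pos
  constructor <;> linarith

variable {Ω : Set (E d)} {v : E d → ℝ}

/-- At an approximate maximum of `v - w`, take `α` nearly optimal for `v`; for `w` the same `α`
gives an inequality. Subtraction yields `c (v - w) ≤ 2ε`, which is incompatible with `c ≥ δ` by the
choice of `ε`. -/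
theorem IsBddBorelSolution.le_of_isBddBorelSolution (H : Admissible d₁ l a b c f g δ K)
    (hh : SmallStep δ K h) (hv : IsBddBorelSolution d₁ l a b c f g Ω h v) {w : E d → ℝ}
    (hw : IsBddBorelSolution d₁ l a b c f g Ω h w) (x : E d) : v x ≤ w x := by
  by_contra! hlt
  have hout : ∀ y ∉ innerSet Ω h, v y = w y := fun y hy =>
    (hv.boundary y hy).trans (hw.boundary y hy).symm
  have hxD : x ∈ innerSet Ω h := by
    by_contra hc
    exact hlt.ne (hout x hc).symm
  obtain ⟨M, hM⟩ := hv.bounded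
  obtain ⟨M', hM'⟩ := hw.bounded
  set ε := δ * (v x - w x) / 4 with hεd
  have hδ := H.pos
  have hε : 0 < ε := by have : 0 < v x - w x := by linarith
                        positivity
  obtain ⟨y, hy, hyx, hyr⟩ := H.exists_gen_le hh.pos (fun y => v y - w y) (innerSet Ω h)
    (C := M + M') (fun y _ => by linarith [abs_le.1 (hM y), abs_le.1 (hM' y)]) hxD
    (fun y _ k _ => by
      by_cases hc : y + h • l k ∈ innerSet Ω h
      · exact .inl hc
      · exact .inr (by simp only [hout _ hc]; linarith)) hε
  obtain ⟨α, hα⟩ := hv.exists_abs_gen_le H hh.pos hy hε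
  have h1 := hw.gen_le H hh.pos hy α
  have h2 := hyr _ (H.rate_mem hh α y)
  rw [gen_sub_fun] at h2
  have h3 := mul_le_mul (H.c_lower α y) hyx (by linarith) (hδ.le.trans (H.c_lower α y))
  have h4 := (abs_le.1 hα).1
  nlinarith

theorem IsBddBorelSolution.abs_apply_le (H : Admissible d₁ l a b c f g δ K) (hh : SmallStep δ K h)
    [Nonempty A] (hv : IsBddBorelSolution d₁ l a b c f g Ω h v) (x : E d) : |v x| ≤ K / δ + K := by
  have hδ := H.pos
  have hK := H.K_pos
  obtain ⟨M, hM⟩ := hv.bounded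
  have key : ∀ t : ℝ, (t = 1 ∨ t = -1) → t * v x ≤ K / δ + K := by
    intro t ht
    have ht1 : |t| = 1 := by rcases ht with rfl | rfl <;> simp
    by_contra! hlt
    have hKδ : 0 < K / δ := by positivity
    have hout : ∀ y ∉ innerSet Ω h, t * v y ≤ K := fun y hy => by
      rw [hv.boundary y hy]
      refine (le_abs_self _).trans ?_
      rw [abs_mul, ht1, one_mul]
      exact H.g_reg.abs_le y
    have hxD : x ∈ innerSet Ω h := by
      by_contra hc
      linarith [hout x hc]
    obtain ⟨y, hy, hyx, hyr⟩ := H.exists_gen_le hh.pos (fun y => t * v y) (innerSet Ω h)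
      (C := M) (fun y _ => by
        refine (le_abs_self _).trans ?_
        rw [abs_mul, ht1, one_mul]; exact hM y) hxD
      (fun y _ k _ => by
        by_cases hc : y + h • l k ∈ innerSet Ω h
        · exact .inl hc
        -- The level `K/δ + K` gives `c t v ≥ K + δK`, which exceeds the bound for `f` by `δK`; the
        -- two errors use up only half of that.
        · exact .inr (by linarith [hout _ hc])) (ε := δ * K / 4) (by positivity)
    obtain ⟨α, hα⟩ := hv.exists_abs_gen_le H hh.pos hy (ε := δ * K / 4) (by positivity)
    have h2 := hyr _ (H.rate_mem hh α y)
    rw [gen_const_mul_fun] at h2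
    have h3 : δ * (K / δ + K) ≤ c α y * (t * v y) :=
      mul_le_mul (H.c_lower α y) (by linarith) (by positivity)
        (hδ.le.trans (H.c_lower α y))
    have h5 : δ * (K / δ + K) = K + δ * K := by field_simp
    have h4 := abs_le.1 hα
    have h6 := abs_le.1 ((H.f_reg α).abs_le y)
    have h7 : 0 < δ * K := by positivity
    rcases ht with rfl | rfl <;> linarith
  exact abs_le.2 ⟨by linarith [key (-1) (.inr rfl)], by linarith [key 1 (.inl rfl)]⟩

end Basic

/-! ### Identities for iterated differences. -/

section Differences

variable {l : ℤ → E d} {h : ℝ} {v : E d → ℝ} {x ξ : E d}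

theorem fdiff_neg (η : E d) : fdiff h (-η) v x = (v (x - h • η) - v x) / h := by
  rw [fdiff, smul_neg, ← sub_eq_add_neg]

theorem fdiff_comm (ξ η : E d) :
    fdiff h ξ (fdiff h η v) x = fdiff h η (fdiff h ξ v) x := by
  simp only [fdiff, add_right_comm x (h • ξ) (h • η)]
  ring

theorem sdiff_eq_neg_fdiff_fdiff (hh : h ≠ 0) :
    sdiff h ξ v x = -fdiff h (-ξ) (fdiff h ξ v) x := by
  rw [fdiff_neg]
  simp only [fdiff, sdiff, sub_add_cancel]
  field_simp
  ring

theorem sdiff_fdiff_comm (ξ η : E d) :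
    sdiff h ξ (fdiff h η v) x = fdiff h η (sdiff h ξ v) x := by
  simp only [fdiff, sdiff, add_right_comm x (h • ξ) (h • η), sub_add_eq_add_sub x (h • ξ) (h • η)]
  ring

/-- Since `h Δ_η = δ_η + δ_{-η}`, moving the base point of a second difference by `hξ` costs mixed
second differences with no factor `1/h`. -/
theorem sdiff_add_smul (hh : h ≠ 0) (ξ η : E d) :
    sdiff h η v (x + h • ξ)
      = sdiff h η v x + fdiff h η (fdiff h ξ v) x + fdiff h (-η) (fdiff h ξ v) x := by
  rw [fdiff_neg]
  simp only [fdiff, sdiff, add_right_comm x (h • η) (h • ξ), sub_add_eq_add_sub x (h • η) (h • ξ)]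
  field_simp
  ring

theorem sum_abs_neg (hl : ∀ k ∈ signedIdx d₁, l (-k) = -l k) (F : E d → ℝ) :
    ∑ k ∈ signedIdx d₁, |F (-l k)| = ∑ k ∈ signedIdx d₁, |F (l k)| := by
  rw [← sum_neg_signedIdx (fun k => |F (l k)|)]
  exact Finset.sum_congr rfl fun k hk => by rw [hl k hk]

theorem sum_abs_sdiff_add_smul_le (hl : ∀ k ∈ signedIdx d₁, l (-k) = -l k) (hh : h ≠ 0) :
    ∑ k ∈ signedIdx d₁, |sdiff h (l k) v (x + h • ξ)|
      ≤ ∑ k ∈ signedIdx d₁, |sdiff h (l k) v x|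
        + 2 * ∑ k ∈ signedIdx d₁, |fdiff h (l k) (fdiff h ξ v) x| := by
  rw [two_mul]
  nth_rewrite 2 [← sum_abs_neg hl fun η => fdiff h η (fdiff h ξ v) x]
  rw [← Finset.sum_add_distrib, ← Finset.sum_add_distrib]
  refine Finset.sum_le_sum fun k _ => ?_
  rw [sdiff_add_smul hh]
  linarith [abs_add_le (sdiff h (l k) v x + fdiff h (l k) (fdiff h ξ v) x)
    (fdiff h (-l k) (fdiff h ξ v) x),
    abs_add_le (sdiff h (l k) v x) (fdiff h (l k) (fdiff h ξ v) x)]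

theorem sum_abs_sdiff_le (hl : ∀ k ∈ signedIdx d₁, l (-k) = -l k) (hh : h ≠ 0) :
    ∑ k ∈ signedIdx d₁, |sdiff h (l k) v x|
      ≤ ∑ i ∈ signedIdx d₁, ∑ k ∈ signedIdx d₁, |fdiff h (l k) (fdiff h (l i) v) x| := by
  refine Finset.sum_le_sum fun k hk => ?_
  rw [sdiff_eq_neg_fdiff_fdiff hh, abs_neg, ← hl k hk]
  exact Finset.single_le_sum (f := fun i => |fdiff h (l i) (fdiff h (l k) v) x|)
    (fun _ _ => abs_nonneg _) (neg_mem_signedIdx hk)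

end Differences

/-! ### Differencing the Bellman equation. -/

section Equations

variable {l : ℤ → E d} {a b : A → ℤ → E d → ℝ} {c f : A → E d → ℝ} {g : E d → ℝ} {δ K h : ℝ}
  {Ω : Set (E d)} {v : E d → ℝ}

/-- An `α` that is `ε`-optimal at `x` is merely admissible at `x + hξ`, where it gives `≤ 0`.
Subtracting and dividing by `h` leaves a one-sided inequality with error `ε/h`, so `ε` will be of
order `h`. -/
theorem IsBddBorelSolution.gen_fdiff_le (H : Admissible d₁ l a b c f g δ K) (hh : 0 < h)
    (hv : IsBddBorelSolution d₁ l a b c f g Ω h v) {x ξ : E d} (hx : x + h • ξ ∈ innerSet Ω h)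
    {α : A} {ε : ℝ} (hα : -ε ≤ gen d₁ l h (rate a b h α x) v x - c α x * v x + f α x) :
    gen d₁ l h (rate a b h α x) (fdiff h ξ v) x
      ≤ -gen d₁ l h (fun k => fdiff h ξ (fun y => rate a b h α y k) x) v (x + h • ξ)
        + fdiff h ξ (fun y => c α y * v y - f α y) x + ε / h := by
  have h1 := hv.gen_le H hh hx α
  have e1 : gen d₁ l h (rate a b h α x) (fdiff h ξ v) x
      = (gen d₁ l h (rate a b h α x) v (x + h • ξ) - gen d₁ l h (rate a b h α x) v x) / h := by
    unfold gen fdiff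
    rw [← Finset.sum_sub_distrib, Finset.sum_div]
    refine Finset.sum_congr rfl fun k _ => ?_
    rw [add_right_comm x (h • ξ) (h • l k)]
    ring
  have e2 : gen d₁ l h (rate a b h α (x + h • ξ)) v (x + h • ξ)
      = gen d₁ l h (rate a b h α x) v (x + h • ξ)
        + h * gen d₁ l h (fun k => fdiff h ξ (fun y => rate a b h α y k) x) v (x + h • ξ) := by
    rw [← gen_const_mul_rate, ← gen_add_rate]
    congr 1
    funext k
    unfold fdiff
    field_simp
    ring
  have e3 : h * fdiff h ξ (fun y => c α y * v y - f α y) x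
      = (c α (x + h • ξ) * v (x + h • ξ) - f α (x + h • ξ)) - (c α x * v x - f α x) := by
    unfold fdiff; field_simp
  rw [e1, div_le_iff₀ hh, add_mul, add_mul, div_mul_cancel₀ _ hh.ne']
  linarith

/-- The mechanism is the same with the two neighbours `x ± hξ`. Only an upper bound results, because
`x` enters with the negative coefficient `-2`; the error `2ε/h²` calls for `ε = h²`. -/
theorem IsBddBorelSolution.gen_sdiff_le (H : Admissible d₁ l a b c f g δ K) (hh : 0 < h)
    (hv : IsBddBorelSolution d₁ l a b c f g Ω h v) {x ξ : E d} (hx : x + h • ξ ∈ innerSet Ω h)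
    (hx' : x - h • ξ ∈ innerSet Ω h)
    {α : A} {ε : ℝ} (hα : -ε ≤ gen d₁ l h (rate a b h α x) v x - c α x * v x + f α x) :
    gen d₁ l h (rate a b h α x) (sdiff h ξ v) x
      ≤ -(gen d₁ l h (fun k => fdiff h ξ (fun y => rate a b h α y k) x) (fdiff h ξ v) x
          + gen d₁ l h (fun k => fdiff h (-ξ) (fun y => rate a b h α y k) x) (fdiff h (-ξ) v) x
          + gen d₁ l h (fun k => sdiff h ξ (fun y => rate a b h α y k) x) v x)
        + sdiff h ξ (fun y => c α y * v y - f α y) x + 2 * ε / h ^ 2 := by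
  have h1 := hv.gen_le H hh hx α
  have h2 := hv.gen_le H hh hx' α
  have hh2 : 0 < h ^ 2 := by positivity
  have e1 : h ^ 2 * (gen d₁ l h (rate a b h α x) (sdiff h ξ v) x
      + (gen d₁ l h (fun k => fdiff h ξ (fun y => rate a b h α y k) x) (fdiff h ξ v) x
          + gen d₁ l h (fun k => fdiff h (-ξ) (fun y => rate a b h α y k) x) (fdiff h (-ξ) v) x
          + gen d₁ l h (fun k => sdiff h ξ (fun y => rate a b h α y k) x) v x))
      = gen d₁ l h (rate a b h α (x + h • ξ)) v (x + h • ξ)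
        - 2 * gen d₁ l h (rate a b h α x) v x
        + gen d₁ l h (rate a b h α (x - h • ξ)) v (x - h • ξ) := by
    unfold gen
    rw [← Finset.sum_add_distrib, ← Finset.sum_add_distrib, ← Finset.sum_add_distrib,
      Finset.mul_sum, Finset.mul_sum, ← Finset.sum_sub_distrib, ← Finset.sum_add_distrib]
    refine Finset.sum_congr rfl fun k _ => ?_
    simp only [fdiff_neg]
    simp only [fdiff, sdiff]
    rw [add_right_comm x (h • ξ) (h • l k), sub_add_eq_add_sub x (h • ξ) (h • l k)]
    field_simp
    ring
  have e3 : h ^ 2 * sdiff h ξ (fun y => c α y * v y - f α y) x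
      = (c α (x + h • ξ) * v (x + h • ξ) - f α (x + h • ξ)) - 2 * (c α x * v x - f α x)
        + (c α (x - h • ξ) * v (x - h • ξ) - f α (x - h • ξ)) := by
    unfold sdiff; field_simp
  have key : h ^ 2 * (gen d₁ l h (rate a b h α x) (sdiff h ξ v) x
      + (gen d₁ l h (fun k => fdiff h ξ (fun y => rate a b h α y k) x) (fdiff h ξ v) x
          + gen d₁ l h (fun k => fdiff h (-ξ) (fun y => rate a b h α y k) x) (fdiff h (-ξ) v) x
          + gen d₁ l h (fun k => sdiff h ξ (fun y => rate a b h α y k) x) v x))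
      ≤ h ^ 2 * (sdiff h ξ (fun y => c α y * v y - f α y) x + 2 * ε / h ^ 2) := by
    rw [e1, mul_add, e3, mul_div_cancel₀ _ hh2.ne']
    linarith
  linarith [le_of_mul_le_mul_left key hh2]

/-- The differenced rates are `2δ_ξ a + hδ_ξ b`. The first part is still even in `k` and so acts
through second differences, which avoids a loss of `1/h`. -/
theorem Admissible.abs_gen_fdiff_rate_le (H : Admissible d₁ l a b c f g δ K) (hh : 0 < h) (α : A)
    {ξ : E d} (hξ : ‖ξ‖ ≤ 1) (u : E d → ℝ) (x y : E d) :
    |gen d₁ l h (fun k => fdiff h ξ (fun z => rate a b h α z k) x) u y|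
      ≤ K * (∑ k ∈ signedIdx d₁, |sdiff h (l k) u y| + ∑ k ∈ signedIdx d₁, |fdiff h (l k) u y|) := by
  have e : gen d₁ l h (fun k => fdiff h ξ (fun z => rate a b h α z k) x) u y
      = gen d₁ l h (fun k => 2 * fdiff h ξ (a α k) x + h * fdiff h ξ (b α k) x) u y := by
    congr 1; funext k; simp only [fdiff, rate]; ring
  rw [e, ← sum_sdiff_add_sum_fdiff H.neg (fun k hk => by simp only [fdiff, H.a_neg α k hk]) _ hh,
    mul_add, Finset.mul_sum, Finset.mul_sum]
  refine (abs_add_le _ _).trans (add_le_add ?_ ?_) <;>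
  · refine (Finset.abs_sum_le_sum_abs _ _).trans (Finset.sum_le_sum fun k hk => ?_)
    rw [abs_mul]
    refine mul_le_mul_of_nonneg_right ?_ (abs_nonneg _)
    first
    | exact (H.a_reg α k hk).abs_fdiff_le hh hξ x
    | exact (H.b_reg α k hk).abs_fdiff_le hh hξ x

theorem Admissible.abs_gen_sdiff_rate_le (H : Admissible d₁ l a b c f g δ K) (hh : 0 < h) (α : A)
    {ξ : E d} (hξ : ‖ξ‖ ≤ 1) (u : E d → ℝ) (x y : E d) :
    |gen d₁ l h (fun k => sdiff h ξ (fun z => rate a b h α z k) x) u y|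
      ≤ K * (∑ k ∈ signedIdx d₁, |sdiff h (l k) u y| + ∑ k ∈ signedIdx d₁, |fdiff h (l k) u y|) := by
  have e : gen d₁ l h (fun k => sdiff h ξ (fun z => rate a b h α z k) x) u y
      = gen d₁ l h (fun k => 2 * sdiff h ξ (a α k) x + h * sdiff h ξ (b α k) x) u y := by
    congr 1; funext k; simp only [sdiff, rate]; ring
  rw [e, ← sum_sdiff_add_sum_fdiff H.neg (fun k hk => by simp only [sdiff, H.a_neg α k hk]) _ hh,
    mul_add, Finset.mul_sum, Finset.mul_sum]
  refine (abs_add_le _ _).trans (add_le_add ?_ ?_) <;>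
  · refine (Finset.abs_sum_le_sum_abs _ _).trans (Finset.sum_le_sum fun k hk => ?_)
    rw [abs_mul]
    refine mul_le_mul_of_nonneg_right ?_ (abs_nonneg _)
    first
    | exact (H.a_reg α k hk).abs_sdiff_le hh hξ x
    | exact (H.b_reg α k hk).abs_sdiff_le hh hξ x

theorem fdiff_mul_sub (c v f : E d → ℝ) (ξ x : E d) :
    fdiff h ξ (fun y => c y * v y - f y) x
      = c (x + h • ξ) * fdiff h ξ v x + v x * fdiff h ξ c x - fdiff h ξ f x := by
  simp only [fdiff]; ring

theorem sdiff_mul_sub (hh : h ≠ 0) (c v f : E d → ℝ) (ξ x : E d) :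
    sdiff h ξ (fun y => c y * v y - f y) x
      = c x * sdiff h ξ v x + v x * sdiff h ξ c x + fdiff h ξ c x * fdiff h ξ v x
        + fdiff h (-ξ) c x * fdiff h (-ξ) v x - sdiff h ξ f x := by
  rw [fdiff_neg, fdiff_neg]
  simp only [fdiff, sdiff]
  field_simp
  ring

end Equations

/-! ### Barrier and the boundary estimate. -/

section Barrier

/-- A function which defines the domain as its positivity set, is `C^{1,1}` and has nonvanishing
discrete gradient near the boundary. -/
structure Defining (d₁ : ℕ) (l : ℤ → E d) (ψ : E d → ℝ) (P ε₀ κ₀ h₁ : ℝ) : Prop where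
  reg : C11Bounds ψ P
  one_le : 1 ≤ P
  eps_pos : 0 < ε₀
  kappa_pos : 0 < κ₀
  step_pos : 0 < h₁
  nondeg : ∀ h, 0 < h → h ≤ h₁ → ∀ x, 0 < ψ x → ψ x < ε₀ →
    κ₀ ≤ ∑ k ∈ signedIdx d₁, fdiff h (l k) ψ x ^ 2

variable {l : ℤ → E d} {a b : A → ℤ → E d → ℝ} {c f : A → E d → ℝ} {g ψ : E d → ℝ}
  {δ K h P ε₀ κ₀ h₁ : ℝ} {v : E d → ℝ}

theorem C11Bounds.abs_sub_le (hψ : C11Bounds ψ P) (x y : E d) : |ψ x - ψ y| ≤ P * ‖x - y‖ := by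
  have := hψ.lip y (x - y)
  rwa [add_sub_cancel] at this

theorem C11Bounds.mem_innerSet (hψ : C11Bounds ψ P) (hh : 0 < h) {x : E d} (hx : P * h < ψ x) :
    x ∈ innerSet {x | 0 < ψ x} h := by
  have hP := hψ.nonneg
  refine ⟨(by positivity : 0 ≤ P * h).trans_lt hx, fun z hz => ?_⟩
  rw [mem_closedBall_zero_iff] at hz
  have h1 := _root_.abs_le.1 (hψ.lip x (h • z))
  have h2 : P * ‖h • z‖ ≤ P * h := by
    rw [norm_smul, Real.norm_of_nonneg hh.le]
    exact mul_le_mul_of_nonneg_left (mul_le_of_le_one_right hh.le hz) hP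
  show 0 < ψ (x + h • z)
  linarith

theorem Admissible.add_smul_mem (H : Admissible d₁ l a b c f g δ K) {Ω : Set (E d)} {x : E d}
    (hx : x ∈ innerSet Ω h) {k : ℤ} (hk : k ∈ signedIdx d₁) : x + h • l k ∈ Ω :=
  hx.2 _ (mem_closedBall_zero_iff.2 (H.norm_le k hk))

/-- In the strip `0 < ψ < ε`, applying the operator to `ψ²` produces `∑ r_k (δ_k ψ)² ≥ δκ₀`. Hence
`ζ = ψ - λψ²` satisfies `Lζ ≤ -1` there, and a large multiple of `ζ` dominates `±(v - g)`. Beyond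
the strip the uniform bound suffices. -/
theorem Admissible.exists_boundary_bound [Nonempty A] (H : Admissible d₁ l a b c f g δ K)
    (hψ : Defining d₁ l ψ P ε₀ κ₀ h₁) :
    ∃ B : ℝ, 0 ≤ B ∧ ∃ h₀ : ℝ, 0 < h₀ ∧ ∀ h, SmallStep δ K h → h ≤ h₀ → ∀ v,
      IsBddBorelSolution d₁ l a b c f g {x | 0 < ψ x} h v →
      ∀ x, |v x - g x| ≤ B * max (ψ x) 0 := by
  have hδ := H.pos
  have hK := H.K_pos
  have hP : 0 < P := one_pos.trans_le hψ.one_le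
  have hκ := hψ.kappa_pos
  set n : ℝ := ((signedIdx d₁).card : ℝ) with hn
  have hn0 : 0 ≤ n := by positivity
  set CL := n * (2 * K * P) with hCL
  have hCL0 : 0 ≤ CL := by positivity
  -- With `λψ ≤ 1/4` one gets `Lζ ≤ CL + CL/2 - λδκ₀`, which this choice makes at most `-1`.
  set lam := (2 * CL + 1) / (δ * κ₀) with hlam
  have hlam0 : 0 < lam := by positivity
  have hlamδ : lam * (δ * κ₀) = 2 * CL + 1 := by rw [hlam]; field_simp
  set ε := min ε₀ (1 / (4 * lam)) with hε
  have hε0 : 0 < ε := lt_min hψ.eps_pos (by positivity)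
  have hεlam : lam * ε ≤ 1 / 4 := by
    calc lam * ε ≤ lam * (1 / (4 * lam)) := mul_le_mul_of_nonneg_left (min_le_right _ _) hlam0.le
      _ = 1 / 4 := by field_simp
  set N₀ := K / δ + K with hN₀
  have hN₀0 : 0 < N₀ := by positivity
  -- The first summand handles points with `ψ ≥ ε`; the second outweighs `cv`, `f`, `Lg` and two
  -- unit errors at the approximate maximum.
  set B := 2 * (N₀ + K) / ε + (K * N₀ + K + 3 + n * (2 * K * K)) with hB
  have hB1 : 0 ≤ 2 * (N₀ + K) / ε := by positivity
  have hB2 : 0 ≤ K * N₀ + K + 3 + n * (2 * K * K) := by positivity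
  have hB0 : 0 ≤ B := add_nonneg hB1 hB2
  have hBε : N₀ + K ≤ B * (ε / 2) := by
    have : 2 * (N₀ + K) / ε * (ε / 2) = N₀ + K := by field_simp
    nlinarith
  -- For `h ≤ ε/P` a jump from the strip stays in `ψ < 2ε`, where `ζ ≥ ψ/2` is still valid.
  refine ⟨B, hB0, min h₁ (ε / P), lt_min hψ.step_pos (by positivity), fun h hh hh0 v hv x => ?_⟩
  have hPh : P * h ≤ ε := by
    rw [mul_comm, ← le_div_iff₀ hP]; exact hh0.trans (min_le_right _ _)
  have hvN : ∀ y, |v y| ≤ N₀ := hv.abs_apply_le H hh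
  have hvg : ∀ y, |v y - g y| ≤ N₀ + K := fun y =>
    (abs_sub _ _).trans (add_le_add (hvN y) (H.g_reg.abs_le y))
  by_cases hx : x ∉ innerSet {x | 0 < ψ x} h
  · rw [hv.boundary x hx, sub_self, abs_zero]
    exact mul_nonneg hB0 (le_max_right _ _)
  rw [not_not] at hx
  have hx0 : 0 < ψ x := hx.1
  rw [max_eq_left hx0.le]
  by_cases hxε : ε ≤ ψ x
  · refine (hvg x).trans (hBε.trans (mul_le_mul_of_nonneg_left ?_ hB0))
    linarith
  push Not at hxε
  set ζ : E d → ℝ := fun y => ψ y - lam * (ψ y * ψ y) with hζ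
  have hζ2 : ∀ y, 0 ≤ ψ y → ψ y ≤ 2 * ε → ψ y / 2 ≤ ζ y := fun y h0 h2 => by
    have : lam * ψ y ≤ 1 / 2 := by nlinarith
    have : lam * ψ y * ψ y ≤ 1 / 2 * ψ y := mul_le_mul_of_nonneg_right this h0
    simp only [hζ]
    linarith
  have key : ∀ t : ℝ, (t = 1 ∨ t = -1) → t * (v x - g x) ≤ B * ψ x := by
    intro t ht
    have ht1 : |t| = 1 := by rcases ht with rfl | rfl <;> simp
    have htv : ∀ y, t * (v y - g y) ≤ N₀ + K := fun y => by
      refine (le_abs_self _).trans ?_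
      rw [abs_mul, ht1, one_mul]; exact hvg y
    suffices hs : t * (v x - g x) - B * ζ x ≤ 0 by
      have : B * ζ x ≤ B * ψ x := mul_le_mul_of_nonneg_left (by
        simp only [hζ]
        have : 0 ≤ lam * (ψ x * ψ x) := by positivity
        linarith) hB0
      linarith
    by_contra! hpos
    obtain ⟨y, ⟨hyi, hyε⟩, hyx, hyr⟩ := H.exists_gen_le hh.pos
      (fun y => t * (v y - g y) - B * ζ y)
      {y | y ∈ innerSet {x | 0 < ψ x} h ∧ ψ y < ε} (C := N₀ + K) (x₀ := x)
      (fun y hy => by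
        have hy0 : 0 < ψ y := hy.1.1
        have := hζ2 y hy0.le (by linarith [hy.2])
        have : 0 ≤ B * ζ y := mul_nonneg hB0 (by linarith)
        linarith [htv y]) ⟨hx, hxε⟩
      (fun y hy k hk => by
        by_cases hc : y + h • l k ∈ {y | y ∈ innerSet {x | 0 < ψ x} h ∧ ψ y < ε}
        · exact .inl hc
        right
        refine le_trans ?_ hpos.le
        have hm : 0 < ψ (y + h • l k) := H.add_smul_mem hy.1 hk
        have h1 := (abs_le.1 (hψ.reg.lip y (h • l k))).2
        have h2 : P * ‖h • l k‖ ≤ P * h :=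
          mul_le_mul_of_nonneg_left (H.norm_smul_le hh.pos hk) hP.le
        have h3 := hζ2 _ hm.le (by linarith [hy.2])
        by_cases hc2 : y + h • l k ∈ innerSet {x | 0 < ψ x} h
        · have h4 : ε ≤ ψ (y + h • l k) := by
            by_contra! h5
            exact hc ⟨hc2, h5⟩
          have : B * (ε / 2) ≤ B * ζ (y + h • l k) :=
            mul_le_mul_of_nonneg_left (by linarith) hB0
          linarith [htv (y + h • l k)]
        · rw [hv.boundary _ hc2, sub_self, mul_zero, zero_sub, neg_nonpos]
          exact mul_nonneg hB0 (by linarith)) one_pos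
    obtain ⟨α, hα⟩ := hv.exists_abs_gen_le H hh.pos hyi one_pos
    have hψy : 0 < ψ y := hyi.1
    have h2 := hyr _ (H.rate_mem hh α y)
    rw [gen_sub_fun, gen_const_mul_fun, gen_const_mul_fun, gen_sub_fun] at h2
    have hLψ := abs_le.1 (H.abs_gen_le hh.pos α hψ.reg y)
    have hLg := abs_le.1 (H.abs_gen_le hh.pos α H.g_reg y)
    rw [← hn] at hLψ hLg
    rw [← hCL] at hLψ
    have hLζ : gen d₁ l h (rate a b h α y) ζ y ≤ -1 := by
      simp only [hζ]
      rw [gen_sub_fun, gen_const_mul_fun, gen_mul_fun hh.pos.ne']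
      have h3 : δ * κ₀ ≤ ∑ k ∈ signedIdx d₁,
          rate a b h α y k * (fdiff h (l k) ψ y * fdiff h (l k) ψ y) := by
        calc δ * κ₀ ≤ δ * ∑ k ∈ signedIdx d₁, fdiff h (l k) ψ y ^ 2 :=
              mul_le_mul_of_nonneg_left (hψ.nondeg h hh.pos (hh0.trans (min_le_left _ _)) y hψy
                (hyε.trans_le (min_le_left _ _))) hδ.le
          _ ≤ _ := by
              rw [Finset.mul_sum]
              refine Finset.sum_le_sum fun k hk => ?_
              rw [pow_two]
              exact mul_le_mul_of_nonneg_right (H.rate_bounds hh α y hk).1 (mul_self_nonneg _)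
      have h4 : lam * ψ y ≤ 1 / 4 :=
        (mul_le_mul_of_nonneg_left hyε.le hlam0.le).trans hεlam
      have h5 : lam * ψ y * -gen d₁ l h (rate a b h α y) ψ y ≤ 1 / 4 * CL := by
        have h6 : 0 ≤ lam * ψ y := by positivity
        calc lam * ψ y * -gen d₁ l h (rate a b h α y) ψ y ≤ lam * ψ y * CL :=
              mul_le_mul_of_nonneg_left (by linarith [hLψ.1]) h6
          _ ≤ 1 / 4 * CL := mul_le_mul_of_nonneg_right h4 hCL0
      have h7 := mul_le_mul_of_nonneg_left h3 hlam0.le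
      linarith [hLψ.2]
    have hBζ : B * gen d₁ l h (rate a b h α y) ζ y ≤ B * -1 := mul_le_mul_of_nonneg_left hLζ hB0
    have hα' := abs_le.1 hα
    have hcv : |c α y * v y| ≤ K * N₀ := by
      rw [abs_mul]
      exact mul_le_mul ((H.c_reg α).abs_le y) (hvN y) (abs_nonneg _) hK.le
    have hcv' := abs_le.1 hcv
    have hfy := abs_le.1 ((H.f_reg α).abs_le y)
    rcases ht with rfl | rfl <;> linarith [hLg.1, hLg.2]
  exact abs_le.2 ⟨by linarith [key (-1) (.inr rfl)], by linarith [key 1 (.inl rfl)]⟩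

end Barrier

/-! ### Exponential sums in the Bernstein method. -/

section Bernstein

/-- Strong convexity of `exp` on `[m, ∞)`, obtained by writing `p = exp (X/2)`, `q = exp (Y/2)` and
`p² - q² = 2q(p - q) + (p - q)²`, with `p - q` bounded by the tangent line. -/
theorem exp_sub_exp_lower {m X Y : ℝ} (hX : m ≤ X) (hY : m ≤ Y) :
    Real.exp Y * (X - Y) + Real.exp m / 4 * (X - Y) ^ 2 ≤ Real.exp X - Real.exp Y := by
  set p := Real.exp (X / 2) with hp
  set q := Real.exp (Y / 2) with hq
  set e := Real.exp (m / 2) with he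
  have hpp : Real.exp X = p ^ 2 := by rw [hp, ← Real.exp_nat_mul]; congr 1; push_cast; ring
  have hqq : Real.exp Y = q ^ 2 := by rw [hq, ← Real.exp_nat_mul]; congr 1; push_cast; ring
  have hee : Real.exp m = e ^ 2 := by rw [he, ← Real.exp_nat_mul]; congr 1; push_cast; ring
  have hp0 : 0 < p := Real.exp_pos _
  have hq0 : 0 < q := Real.exp_pos _
  have he0 : 0 < e := Real.exp_pos _
  have hep : e ≤ p := Real.exp_le_exp.2 (by linarith)
  have heq : e ≤ q := Real.exp_le_exp.2 (by linarith)
  have h1 : q * ((X - Y) / 2) ≤ p - q := by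
    have h := Real.add_one_le_exp ((X - Y) / 2)
    have e1 : q * Real.exp ((X - Y) / 2) = p := by
      rw [hq, ← Real.exp_add, hp]; congr 1; ring
    nlinarith
  have h2 : p * ((Y - X) / 2) ≤ q - p := by
    have h := Real.add_one_le_exp ((Y - X) / 2)
    have e1 : p * Real.exp ((Y - X) / 2) = q := by
      rw [hp, ← Real.exp_add, hq]; congr 1; ring
    nlinarith
  have h3 : e * |(X - Y) / 2| ≤ |p - q| := by
    rcases le_total Y X with hc | hc
    · rw [abs_of_nonneg (by linarith : 0 ≤ (X - Y) / 2)]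
      have : e * ((X - Y) / 2) ≤ q * ((X - Y) / 2) :=
        mul_le_mul_of_nonneg_right heq (by linarith)
      exact (this.trans h1).trans (le_abs_self _)
    · rw [abs_of_nonpos (by linarith : (X - Y) / 2 ≤ 0)]
      have : e * (-((X - Y) / 2)) ≤ p * ((Y - X) / 2) := by
        rw [show -((X - Y) / 2) = (Y - X) / 2 by ring]
        exact mul_le_mul_of_nonneg_right hep (by linarith)
      exact (this.trans h2).trans ((le_abs_self _).trans_eq (abs_sub_comm _ _))
  have h4 : (e * |(X - Y) / 2|) ^ 2 ≤ |p - q| ^ 2 := pow_le_pow_left₀ (by positivity) h3 2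
  rw [mul_pow, sq_abs, sq_abs] at h4
  rw [hpp, hqq, hee]
  nlinarith

theorem absorb_linear {e : ℝ} (he : 0 < e) (p X : ℝ) : p * X ≤ e * X ^ 2 + p ^ 2 / (4 * e) := by
  have h1 : 0 ≤ (2 * e * X - p) ^ 2 / (4 * e) := by positivity
  have h2 : (2 * e * X - p) ^ 2 / (4 * e) = e * X ^ 2 + p ^ 2 / (4 * e) - p * X := by
    field_simp; ring
  linarith

theorem rate_mul_lower {δ r c p D F : ℝ} (hδ : 0 ≤ δ) (hr : δ ≤ r) (hc : 0 ≤ c) (h : ℝ)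
    (hF : c * D ^ 2 - p * D ≤ F) :
    -p * (r * D / h ^ 2) + c * δ * (D / h) ^ 2 ≤ r * F / h ^ 2 := by
  have h1 := mul_le_mul_of_nonneg_left hF (hδ.trans hr)
  have h2 : δ * (c * D ^ 2) ≤ r * (c * D ^ 2) := mul_le_mul_of_nonneg_right hr (by positivity)
  have h3 : -p * (r * D / h ^ 2) + c * δ * (D / h) ^ 2 = (c * δ * D ^ 2 - p * r * D) / h ^ 2 := by
    rw [div_pow]; ring
  rw [h3]
  exact div_le_div_of_nonneg_right (by linarith) (sq_nonneg h)

theorem sq_sum_sum_abs_le {S : Finset ℤ} (F : ℤ → ℤ → ℝ) :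
    (∑ i ∈ S, ∑ k ∈ S, |F i k|) ^ 2 ≤ (S.card : ℝ) * S.card * ∑ i ∈ S, ∑ k ∈ S, F i k ^ 2 := by
  have h1 := sq_sum_le_card_mul_sum_sq (s := S ×ˢ S) (f := fun p => |F p.1 p.2|)
  rw [Finset.sum_product, Finset.sum_product, Finset.card_product] at h1
  simp only [sq_abs] at h1
  push_cast at h1
  exact h1

/-- The squares of all `δ_k w_j` supplied by convexity absorb the linear terms of the hypothesis,
even though each inequality involves the differences of every `w_i`. The lower bound `-1` limits the
first-order coefficient and the upper bound `C` keeps the convexity constant positive. The scale `s`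
will be `1` for gradients and `1/ψ` for second differences. -/
theorem exists_exp_gen_lower (d₁ : ℕ) (l : ℤ → E d) {δ κ A₁ : ℝ} (C : ℝ) (hδ : 0 < δ) (hκ : 0 < κ)
    (hA₁ : 0 ≤ A₁) :
    ∃ C₂ : ℝ, 0 ≤ C₂ ∧ ∀ h : ℝ, 0 < h → ∀ (r : ℤ → ℝ) (w : ℤ → E d → ℝ) (x : E d) (s : ℝ), 0 ≤ s →
      (∀ k ∈ signedIdx d₁, δ ≤ r k) → (∀ j ∈ signedIdx d₁, -1 ≤ w j x) →
      (∀ j ∈ signedIdx d₁, w j x ≤ C) →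
      (∀ j ∈ signedIdx d₁, ∀ k ∈ signedIdx d₁, w j (x + h • l k) ≤ C) →
      (∀ j ∈ signedIdx d₁, gen d₁ l h r (w j) x ≤
        A₁ * s * (∑ i ∈ signedIdx d₁, ∑ k ∈ signedIdx d₁, |fdiff h (l k) (w i) x| + s)) →
      -(C₂ * s ^ 2) ≤ gen d₁ l h r (fun y => ∑ j ∈ signedIdx d₁, Real.exp (-(κ * w j y))) x := by
  set n : ℝ := ((signedIdx d₁).card : ℝ) with hn
  have hn0 : 0 ≤ n := by positivity
  set B := n * (κ * Real.exp κ * A₁) with hB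
  have hB0 : 0 ≤ B := by positivity
  set c := κ ^ 2 * Real.exp (-(κ * C)) / 4 with hc
  have hc0 : 0 < c := by positivity
  clear_value B c n
  refine ⟨B ^ 2 * (n * n + 1) / (4 * (c * δ)) + B, by positivity,
    fun h hh r w x s hs hr hw1 hwC hwC' hL => ?_⟩
  set G := ∑ i ∈ signedIdx d₁, ∑ k ∈ signedIdx d₁, |fdiff h (l k) (w i) x| with hG
  set Q := ∑ i ∈ signedIdx d₁, ∑ k ∈ signedIdx d₁, fdiff h (l k) (w i) x ^ 2 with hQ
  have hG0 : 0 ≤ G := Finset.sum_nonneg fun _ _ => Finset.sum_nonneg fun _ _ => abs_nonneg _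
  have hGQ : G ^ 2 ≤ n * n * Q := hn ▸ sq_sum_sum_abs_le _
  have step : ∀ j ∈ signedIdx d₁,
      -(κ * Real.exp κ * A₁) * (s * (G + s)) + c * δ * ∑ k ∈ signedIdx d₁, fdiff h (l k) (w j) x ^ 2
        ≤ gen d₁ l h r (fun y => Real.exp (-(κ * w j y))) x := by
    intro j hj
    have h1 : -(κ * Real.exp (-(κ * w j x))) * gen d₁ l h r (w j) x
        + c * δ * ∑ k ∈ signedIdx d₁, fdiff h (l k) (w j) x ^ 2
        ≤ gen d₁ l h r (fun y => Real.exp (-(κ * w j y))) x := by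
      unfold gen
      rw [Finset.mul_sum, Finset.mul_sum, ← Finset.sum_add_distrib]
      refine Finset.sum_le_sum fun k hk => ?_
      have h2 := exp_sub_exp_lower (m := -(κ * C)) (X := -(κ * w j (x + h • l k)))
        (Y := -(κ * w j x)) (by nlinarith [hwC' j hj k hk]) (by nlinarith [hwC j hj])
      have hrk := hr k hk
      have h3 : c * (w j (x + h • l k) - w j x) ^ 2 - κ * Real.exp (-(κ * w j x))
          * (w j (x + h • l k) - w j x)
          ≤ Real.exp (-(κ * w j (x + h • l k))) - Real.exp (-(κ * w j x)) := by
        refine le_trans (le_of_eq ?_) h2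
        rw [hc]; ring
      exact rate_mul_lower hδ.le hrk hc0.le h h3
    refine le_trans ?_ h1
    have h6 : Real.exp (-(κ * w j x)) ≤ Real.exp κ := by
      rw [Real.exp_le_exp]
      nlinarith [hw1 j hj]
    have h7 : 0 ≤ A₁ * s * (G + s) := by positivity
    have h8 : κ * Real.exp (-(κ * w j x)) * gen d₁ l h r (w j) x
        ≤ κ * Real.exp κ * (A₁ * s * (G + s)) := by
      calc _ ≤ κ * Real.exp (-(κ * w j x)) * (A₁ * s * (G + s)) :=
            mul_le_mul_of_nonneg_left (hL j hj) (by positivity)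
        _ ≤ _ := mul_le_mul_of_nonneg_right (mul_le_mul_of_nonneg_left h6 hκ.le) h7
    linarith
  rw [gen_sum_fun]
  refine le_trans ?_ (Finset.sum_le_sum step)
  rw [Finset.sum_add_distrib, Finset.sum_const, nsmul_eq_mul, ← Finset.mul_sum, ← hn, ← hQ]
  have hq : G ^ 2 / (n * n + 1) ≤ Q := by
    rw [div_le_iff₀ (by positivity)]
    have : 0 ≤ Q := Finset.sum_nonneg fun _ _ => Finset.sum_nonneg fun _ _ => sq_nonneg _
    linarith
  have hq' := mul_le_mul_of_nonneg_left hq (by positivity : 0 ≤ c * δ)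
  have hsq := absorb_linear (show 0 < c * δ / (n * n + 1) by positivity) (B * s) G
  have e1 : (B * s) ^ 2 / (4 * (c * δ / (n * n + 1)))
      = B ^ 2 * (n * n + 1) / (4 * (c * δ)) * s ^ 2 := by
    rw [mul_pow, ← mul_div_assoc, div_div_eq_mul_div]; ring
  have e2 : c * δ / (n * n + 1) * G ^ 2 = c * δ * (G ^ 2 / (n * n + 1)) := by ring
  rw [e1, e2] at hsq
  have hB' : n * (-(κ * Real.exp κ * A₁) * (s * (G + s))) = -(B * s * G) - B * s ^ 2 := by
    rw [hB]; ring
  rw [hB']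
  linarith

variable {l : ℤ → E d} {a b : A → ℤ → E d → ℝ} {c f : A → E d → ℝ} {g : E d → ℝ} {δ K h : ℝ}

/-- The point `x₀` makes the sum at least `exp (3κ/4)`. Where all `w_j ≥ -1/2` the whole function is
at most `n exp (κ/2) + 1`, which is smaller by the choice of `κ`. So an approximate maximum lies in
`D` and has some `w_j ≤ -1/2`; adding `z ∈ [0,1]` does not disturb this. -/
theorem Admissible.exists_exp_near_max (H : Admissible d₁ l a b c f g δ K) (hh : 0 < h) {κ : ℝ}
    (hκ : 0 < κ) (hκn : (signedIdx d₁).card + 1 < Real.exp (κ / 4)) (w : ℤ → E d → ℝ) (z : E d → ℝ)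
    (D : Set (E d)) (hz0 : ∀ y, 0 ≤ z y) (hz1 : ∀ y, z y ≤ 1)
    (hw : ∀ y ∈ D, ∀ j ∈ signedIdx d₁, -1 ≤ w j y) {x₀ : E d} (hx₀ : x₀ ∈ D) {j₀ : ℤ}
    (hj₀ : j₀ ∈ signedIdx d₁) (hwx₀ : w j₀ x₀ ≤ -(3 / 4))
    (hout : ∀ x ∈ D, ∀ k ∈ signedIdx d₁,
      x + h • l k ∈ D ∨ ∀ j ∈ signedIdx d₁, -(1 / 2) ≤ w j (x + h • l k)) :
    ∃ x ∈ D, (∃ j ∈ signedIdx d₁, w j x ≤ -(1 / 2)) ∧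
      ∀ r : ℤ → ℝ, (∀ k ∈ signedIdx d₁, 0 ≤ r k ∧ r k ≤ 6 * K) →
        gen d₁ l h r (fun y => ∑ j ∈ signedIdx d₁, Real.exp (-(κ * w j y)) + z y) x ≤ 1 := by
  have hsum : ∀ (t : ℝ) (y : E d), (∀ j ∈ signedIdx d₁, -t ≤ w j y) →
      ∑ j ∈ signedIdx d₁, Real.exp (-(κ * w j y)) + z y
        ≤ (signedIdx d₁).card * Real.exp (κ * t) + 1 := by
    intro t y hy
    refine add_le_add ?_ (hz1 y)
    rw [← nsmul_eq_mul]
    refine Finset.sum_le_card_nsmul _ _ _ fun j hj => ?_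
    rw [Real.exp_le_exp]
    nlinarith [hy j hj]
  have hx₀' : Real.exp (κ * (3 / 4))
      ≤ ∑ j ∈ signedIdx d₁, Real.exp (-(κ * w j x₀)) + z x₀ := by
    have h1 := Finset.single_le_sum (f := fun j => Real.exp (-(κ * w j x₀)))
      (fun j _ => (Real.exp_pos _).le) hj₀
    have h2 : Real.exp (κ * (3 / 4)) ≤ Real.exp (-(κ * w j₀ x₀)) := by
      rw [Real.exp_le_exp]; nlinarith
    linarith [hz0 x₀]
  have hlt : (signedIdx d₁).card * Real.exp (κ * (1 / 2)) + 1 < Real.exp (κ * (3 / 4)) := by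
    have h1 : Real.exp (κ * (3 / 4)) = Real.exp (κ / 4) * Real.exp (κ * (1 / 2)) := by
      rw [← Real.exp_add]; congr 1; ring
    have h2 : 1 ≤ Real.exp (κ * (1 / 2)) := Real.one_le_exp (by positivity)
    rw [h1]
    nlinarith
  obtain ⟨x, hx, hxx, hxr⟩ := H.exists_gen_le hh
    (fun y => ∑ j ∈ signedIdx d₁, Real.exp (-(κ * w j y)) + z y) D
    (fun y hy => hsum 1 y (hw y hy)) hx₀
    (fun y hy k hk => (hout y hy k hk).imp id fun hc => (hsum _ _ hc).trans (hlt.le.trans hx₀'))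
    one_pos
  refine ⟨x, hx, ?_, hxr⟩
  by_contra! hc
  have := hsum (1 / 2) x fun j hj => (hc j hj).le
  linarith

end Bernstein

/-- After division by `M = 4/3 F x₀`, a family with `F = -w` satisfies `w ≥ -1` everywhere and `w =
-3/4` at `x₀`, the normalization required by the exponential sum. -/
theorem exists_near_sup {X : Type*} (F : X → ℝ) {C : ℝ} (hC : ∀ x, F x ≤ C) {N : ℝ} (hN : 0 ≤ N)
    {x₁ : X} (hx₁ : N < F x₁) : ∃ x₀, N < F x₀ ∧ ∀ y, F y ≤ 4 / 3 * F x₀ := by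
  have hbdd : BddAbove (Set.range F) := ⟨C, by rintro _ ⟨x, rfl⟩; exact hC x⟩
  have hle : ∀ y, F y ≤ sSup (Set.range F) := fun y => le_csSup hbdd ⟨y, rfl⟩
  have hs : 0 < sSup (Set.range F) := (hN.trans_lt hx₁).trans_le (hle x₁)
  obtain ⟨_, ⟨x₂, rfl⟩, hx₂⟩ := exists_lt_of_lt_csSup (⟨_, x₁, rfl⟩ : (Set.range F).Nonempty)
    (show 3 / 4 * sSup (Set.range F) < sSup (Set.range F) by linarith)
  by_cases hc : N < F x₂
  · exact ⟨x₂, hc, fun y => by linarith [hle y]⟩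
  · exact ⟨x₁, hx₁, fun y => by linarith [hle y]⟩

/-! ### Bound for first differences along the given directions. -/

section Gradient

variable {l : ℤ → E d} {a b : A → ℤ → E d → ℝ} {c f : A → E d → ℝ} {g ψ : E d → ℝ}
  {δ K h P ε₀ κ₀ h₁ : ℝ} {v : E d → ℝ}

/-- Within `O(h)` of the boundary, or outside, `v - g = O(h)` at both points of the difference, so
dividing by `h` costs nothing. -/
theorem abs_fdiff_le_of_boundary (hg : C11Bounds g K) (hψ : C11Bounds ψ P) (hh : 0 < h) {B R : ℝ}
    (hB : 0 ≤ B) (hR : 0 ≤ R) (hvB : ∀ x, |v x - g x| ≤ B * max (ψ x) 0) {x ξ : E d}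
    (hx : ψ x ≤ R * h) (hξ : ‖ξ‖ ≤ 1) : |fdiff h ξ v x| ≤ K + B * (2 * R + P) := by
  have hP := hψ.nonneg
  have h1 : ψ (x + h • ξ) ≤ R * h + P * h := by
    have h2 := (abs_le.1 (hψ.lip x (h • ξ))).2
    have h3 : P * ‖h • ξ‖ ≤ P * h := by
      rw [norm_smul, Real.norm_of_nonneg hh.le]
      exact mul_le_mul_of_nonneg_left (mul_le_of_le_one_right hh.le hξ) hP
    linarith
  have h4 : B * max (ψ x) 0 ≤ B * (R * h) :=
    mul_le_mul_of_nonneg_left (max_le hx (by positivity)) hB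
  have h5 : B * max (ψ (x + h • ξ)) 0 ≤ B * (R * h + P * h) :=
    mul_le_mul_of_nonneg_left (max_le h1 (by positivity)) hB
  have h6 := hg.abs_fdiff_le hh hξ x
  rw [fdiff, abs_div, abs_of_pos hh, div_le_iff₀ hh] at h6 ⊢
  have h7 := abs_le.1 h6
  have h8 := abs_le.1 (hvB x)
  have h9 := abs_le.1 (hvB (x + h • ξ))
  exact abs_le.2 ⟨by linarith, by linarith⟩

theorem Admissible.abs_gen_solution_le (H : Admissible d₁ l a b c f g δ K) {N₀ : ℝ}
    (hv : ∀ y, |v y| ≤ N₀) {α : A} {x : E d} {ε : ℝ}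
    (hα : |gen d₁ l h (rate a b h α x) v x - c α x * v x + f α x| ≤ ε) :
    |gen d₁ l h (rate a b h α x) v x| ≤ K * N₀ + K + ε := by
  have h1 : |c α x * v x| ≤ K * N₀ := by
    rw [abs_mul]
    exact mul_le_mul ((H.c_reg α).abs_le x) (hv x) (abs_nonneg _) H.K_pos.le
  have h2 := abs_le.1 h1
  have h3 := abs_le.1 ((H.f_reg α).abs_le x)
  have h4 := abs_le.1 hα
  exact abs_le.2 ⟨by linarith, by linarith⟩

theorem Admissible.abs_fdiff_mul_sub_le (H : Admissible d₁ l a b c f g δ K) (hh : 0 < h) {N₀ M : ℝ}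
    (hv : ∀ y, |v y| ≤ N₀) {ξ x : E d} (hξ : ‖ξ‖ ≤ 1) (hM : |fdiff h ξ v x| ≤ M) (α : A) :
    |fdiff h ξ (fun y => c α y * v y - f α y) x| ≤ K * M + K * N₀ + K := by
  rw [fdiff_mul_sub]
  have hK := H.K_pos.le
  have h1 : |c α (x + h • ξ) * fdiff h ξ v x| ≤ K * M := by
    rw [abs_mul]
    exact mul_le_mul ((H.c_reg α).abs_le _) hM (abs_nonneg _) hK
  have h2 : |v x * fdiff h ξ (c α) x| ≤ K * N₀ := by
    rw [abs_mul, mul_comm]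
    exact mul_le_mul ((H.c_reg α).abs_fdiff_le hh hξ x) (hv x) (abs_nonneg _) hK
  have h3 := (H.f_reg α).abs_fdiff_le hh hξ x
  refine (abs_sub _ _).trans (add_le_add ((abs_add_le _ _).trans (add_le_add h1 h2)) h3)

/-- The differenced equation, in the form needed for gradient estimates. -/
theorem IsBddBorelSolution.gen_fdiff_le_of_bound (H : Admissible d₁ l a b c f g δ K) (hh : 0 < h)
    {Ω : Set (E d)} (hv : IsBddBorelSolution d₁ l a b c f g Ω h v) {N₀ M : ℝ}
    (hvN : ∀ y, |v y| ≤ N₀) (hvM : ∀ k ∈ signedIdx d₁, ∀ y, |fdiff h (l k) v y| ≤ M)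
    {x : E d} {j : ℤ} (hj : j ∈ signedIdx d₁) (hx : x + h • l j ∈ innerSet Ω h)
    {α : A} (hα : |gen d₁ l h (rate a b h α x) v x - c α x * v x + f α x| ≤ h) :
    gen d₁ l h (rate a b h α x) (fdiff h (l j) v) x
      ≤ 3 * K * (∑ i ∈ signedIdx d₁, ∑ k ∈ signedIdx d₁, |fdiff h (l k) (fdiff h (l i) v) x|)
        + (((signedIdx d₁).card + 1) * (K * M) + K * N₀ + K + 1) := by
  have hK := H.K_pos.le
  have h1 := hv.gen_fdiff_le H hh hx (abs_le.1 hα).1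
  have h2 := (abs_le.1 (H.abs_gen_fdiff_rate_le hh α (H.norm_le j hj) v x (x + h • l j))).1
  have h3 := (abs_le.1 (H.abs_fdiff_mul_sub_le hh hvN (H.norm_le j hj) (hvM j hj x) α)).2
  have h4 := sum_abs_sdiff_add_smul_le (x := x) (ξ := l j) (v := v) H.neg hh.ne'
  have h5 := sum_abs_sdiff_le (x := x) (v := v) H.neg hh.ne'
  have h6 := Finset.single_le_sum
    (f := fun i => ∑ k ∈ signedIdx d₁, |fdiff h (l k) (fdiff h (l i) v) x|)
    (fun i _ => Finset.sum_nonneg fun _ _ => abs_nonneg _) hj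
  have h7 : ∑ k ∈ signedIdx d₁, |fdiff h (l k) v (x + h • l j)| ≤ (signedIdx d₁).card * M := by
    rw [← nsmul_eq_mul]
    exact Finset.sum_le_card_nsmul _ _ _ fun k hk => hvM k hk _
  have h8 : ∑ k ∈ signedIdx d₁, |sdiff h (l k) v (x + h • l j)|
      ≤ 3 * ∑ i ∈ signedIdx d₁, ∑ k ∈ signedIdx d₁, |fdiff h (l k) (fdiff h (l i) v) x| := by
    linarith
  have h9 := mul_le_mul_of_nonneg_left (add_le_add h8 h7) hK
  rw [div_self hh.ne'] at h1
  linarith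

-- If some `-δ_k v` is large, normalize by `M` and study `∑ exp(-κ δ_k v / M) + μ v² / M²`. At its
-- approximate maximum some `-δ_j v ≥ M/2`, so the operator on `v²` yields `δM²/4`, up to `2v Lv`,
-- which the equation bounds. This beats the loss `C₂` of the exponential sum.
set_option maxHeartbeats 1000000 in
theorem Admissible.exists_gradient_bound [Nonempty A] (H : Admissible d₁ l a b c f g δ K)
    (hψ : C11Bounds ψ P) {B h₀ : ℝ} (hB : 0 ≤ B)
    (hbd : ∀ h, SmallStep δ K h → h ≤ h₀ → ∀ v,
      IsBddBorelSolution d₁ l a b c f g {x | 0 < ψ x} h v → ∀ x, |v x - g x| ≤ B * max (ψ x) 0) :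
    ∃ N : ℝ, 0 ≤ N ∧ ∀ h, SmallStep δ K h → h ≤ h₀ → ∀ v,
      IsBddBorelSolution d₁ l a b c f g {x | 0 < ψ x} h v →
      ∀ k ∈ signedIdx d₁, ∀ x, |fdiff h (l k) v x| ≤ N := by
  have hδ := H.pos
  have hK := H.K_pos
  have hP := hψ.nonneg
  set n : ℝ := ((signedIdx d₁).card : ℝ) with hn
  have hn0 : 0 ≤ n := by positivity
  set N₀ := K / δ + K with hN₀
  have hN₀0 : 0 < N₀ := by positivity
  set κ := 4 * Real.log (n + 2) with hκ
  have hκ0 : 0 < κ := mul_pos (by norm_num) (Real.log_pos (by linarith))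
  have hκn : n + 1 < Real.exp (κ / 4) := by
    rw [hκ, mul_div_cancel_left₀ _ (by norm_num : (4 : ℝ) ≠ 0), Real.exp_log (by positivity)]
    linarith
  set A₁ := 3 * K + ((n + 1) * K + K * N₀ + K + 1) with hA₁
  have hA₁0 : 0 ≤ A₁ := by positivity
  obtain ⟨C₂, hC₂, hexp⟩ := exists_exp_gen_lower d₁ l 1 hδ hκ0 hA₁0
  -- Then the compensator contributes at least `C₂ + 2`, and the total is at least `2`, against the
  -- upper bound `1`.
  set μ := 4 * (C₂ + 3) / δ with hμ
  have hμ0 : 0 < μ := by positivity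
  set CV := 2 * (N₀ * (K * N₀ + K + 1)) with hCV
  have hCV0 : 0 ≤ CV := by positivity
  -- If `ψ > Rh`, then the point and all its neighbours belong to `Ω_h`, where the equation holds.
  set R := 2 * P + 1 with hR
  have hR0 : 0 ≤ R := by positivity
  set Nb := K + B * (2 * R + P) with hNb
  have hNb0 : 0 ≤ Nb := by positivity
  set N := 1 + μ * (CV + N₀ * N₀) + 2 * Nb with hN
  have hN0 : 0 ≤ N := by positivity
  clear_value N Nb R CV μ A₁ κ N₀ n
  refine ⟨N, hN0, fun h hh hh0 v hv => ?_⟩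
  have hh' := hh.pos
  have hvN : ∀ y, |v y| ≤ N₀ := hN₀ ▸ hv.abs_apply_le H hh
  have hvB := hbd h hh hh0 v hv
  -- Reversing a direction changes the sign, so one-sided bounds over all `k` and `x` are enough.
  have hswap : ∀ k ∈ signedIdx d₁, ∀ x, fdiff h (l k) v x = -fdiff h (l (-k)) v (x + h • l k) := by
    intro k hk x
    rw [H.neg k hk, fdiff_neg, add_sub_cancel_right, fdiff]; ring
  suffices hs : ∀ p : E d × {k // k ∈ signedIdx d₁}, -fdiff h (l p.2) v p.1 ≤ N by
    intro k hk x
    refine abs_le.2 ⟨by linarith [hs (x, ⟨k, hk⟩)], ?_⟩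
    rw [hswap k hk]
    exact hs (x + h • l k, ⟨-k, neg_mem_signedIdx hk⟩)
  by_contra! hcon
  obtain ⟨p₁, hp₁⟩ := hcon
  obtain ⟨⟨x₀, j₀, hj₀⟩, hx₀N, hsup⟩ := exists_near_sup
    (fun p : E d × {k // k ∈ signedIdx d₁} => -fdiff h (l p.2) v p.1) (C := 2 * N₀ / h)
    (fun p => by
      rw [fdiff, ← neg_div]
      refine div_le_div_of_nonneg_right ?_ hh'.le
      linarith [abs_le.1 (hvN p.1), abs_le.1 (hvN (p.1 + h • l p.2))]) hN0 hp₁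
  simp only at hx₀N hsup
  set M := 4 / 3 * -fdiff h (l j₀) v x₀ with hM
  have hMN : N ≤ M := by linarith
  have hM1 : 1 ≤ M := by
    have : 0 ≤ μ * (CV + N₀ * N₀) := by positivity
    linarith
  have hM0 : 0 < M := by linarith
  have hvM : ∀ k ∈ signedIdx d₁, ∀ y, |fdiff h (l k) v y| ≤ M := by
    intro k hk y
    refine abs_le.2 ⟨by linarith [hsup (y, ⟨k, hk⟩)], ?_⟩
    rw [hswap k hk]
    exact hsup (y + h • l k, ⟨-k, neg_mem_signedIdx hk⟩)
  have hMμ : μ * CV ≤ M ^ 2 ∧ μ * (N₀ * N₀) ≤ M ^ 2 := by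
    have h1 : μ * CV + μ * (N₀ * N₀) ≤ M := by linarith
    have h2 : 0 ≤ μ * CV := by positivity
    have h3 : 0 ≤ μ * (N₀ * N₀) := by positivity
    have h4 : M ≤ M ^ 2 := by nlinarith
    constructor <;> linarith
  have hoff : ∀ y, ψ y ≤ R * h → ∀ k ∈ signedIdx d₁, |fdiff h (l k) v y| ≤ Nb := fun y hy k hk => hNb ▸
    abs_fdiff_le_of_boundary H.g_reg hψ hh' hB hR0 hvB hy (H.norm_le k hk)
  have hMNb : Nb ≤ M / 2 := by
    have : 0 ≤ μ * (CV + N₀ * N₀) := by positivity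
    linarith
  set w : ℤ → E d → ℝ := fun k y => M⁻¹ * fdiff h (l k) v y with hw
  have hwabs : ∀ k ∈ signedIdx d₁, ∀ y, |w k y| ≤ 1 := fun k hk y => by
    rw [hw]
    simp only
    rw [abs_mul, abs_of_pos (inv_pos.2 hM0), inv_mul_le_iff₀ hM0, mul_one]
    exact hvM k hk y
  obtain ⟨x, hxD, ⟨j, hj, hwj⟩, hxr⟩ := H.exists_exp_near_max hh' hκ0 (hn ▸ hκn) w
    (fun y => μ / M ^ 2 * (v y * v y)) {y | R * h < ψ y}
    (fun y => mul_nonneg (by positivity) (mul_self_nonneg _))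
    (fun y => by
      rw [div_mul_eq_mul_div, div_le_one (by positivity)]
      refine le_trans (mul_le_mul_of_nonneg_left ?_ hμ0.le) hMμ.2
      rw [← abs_mul_abs_self]
      exact mul_self_le_mul_self (abs_nonneg _) (hvN y))
    (fun y _ k hk => (abs_le.1 (hwabs k hk y)).1) (x₀ := x₀) (j₀ := j₀)
    (by
      by_contra hc
      have := abs_le.1 (hoff x₀ (not_lt.1 hc) j₀ hj₀)
      linarith) hj₀
    (by
      simp only [hw]
      rw [inv_mul_le_iff₀ hM0]
      linarith)
    (fun y _ k _ => by
      by_cases hc : R * h < ψ (y + h • l k)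
      · exact .inl hc
      · right
        intro i hi
        have := (abs_le.1 (hoff _ (not_lt.1 hc) i hi)).1
        simp only [hw]
        rw [le_inv_mul_iff₀ hM0]
        linarith)
  have hxψ : R * h < ψ x := hxD
  have hxi : x ∈ innerSet {x | 0 < ψ x} h := hψ.mem_innerSet hh' (by nlinarith)
  have hxk : ∀ k ∈ signedIdx d₁, x + h • l k ∈ innerSet {x | 0 < ψ x} h := fun k hk => by
    refine hψ.mem_innerSet hh' ?_
    have h1 := (abs_le.1 (hψ.lip x (h • l k))).1
    have h2 := mul_le_mul_of_nonneg_left (H.norm_smul_le hh' hk) hP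
    nlinarith
  obtain ⟨α, hα⟩ := hv.exists_abs_gen_le H hh' hxi hh'
  have hr := H.rate_mem hh α x
  have h1 := hxr _ hr
  rw [gen_add_fun, gen_const_mul_fun, gen_mul_fun hh'.ne'] at h1
  have hGw : ∑ i ∈ signedIdx d₁, ∑ k ∈ signedIdx d₁, |fdiff h (l k) (w i) x|
      = M⁻¹ * ∑ i ∈ signedIdx d₁, ∑ k ∈ signedIdx d₁, |fdiff h (l k) (fdiff h (l i) v) x| := by
    simp only [Finset.mul_sum]
    refine Finset.sum_congr rfl fun i _ => Finset.sum_congr rfl fun k _ => ?_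
    have e : |M⁻¹| = M⁻¹ := abs_of_pos (inv_pos.2 hM0)
    conv_rhs => rw [← e, ← abs_mul]
    congr 1
    simp only [hw, fdiff]
    ring
  have h2 := hexp h hh' (rate a b h α x) w x 1 zero_le_one
    (fun k hk => (H.rate_bounds hh α x hk).1) (fun k hk => (abs_le.1 (hwabs k hk _)).1)
    (fun k hk => (abs_le.1 (hwabs k hk _)).2) (fun k hk i _ => (abs_le.1 (hwabs k hk _)).2)
    (fun i hi => by
      have h3 := hv.gen_fdiff_le_of_bound H hh' hvN hvM hi (hxk i hi) hα
      rw [hGw]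
      simp only [hw]
      rw [gen_const_mul_fun, inv_mul_le_iff₀ hM0]
      refine h3.trans ?_
      rw [← hn]
      set G := ∑ i ∈ signedIdx d₁, ∑ k ∈ signedIdx d₁, |fdiff h (l k) (fdiff h (l i) v) x|
      have hG0 : 0 ≤ G := Finset.sum_nonneg fun _ _ => Finset.sum_nonneg fun _ _ => abs_nonneg _
      have e1 : M * (A₁ * 1 * (M⁻¹ * G + 1)) = A₁ * G + A₁ * M := by field_simp
      rw [e1]
      have h4 : 3 * K * G ≤ A₁ * G :=
        mul_le_mul_of_nonneg_right (by
          have : 0 ≤ (n + 1) * K + K * N₀ + K + 1 := by positivity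
          linarith) hG0
      have h5 : K * N₀ + K + 1 ≤ (K * N₀ + K + 1) * M := le_mul_of_one_le_right (by positivity) hM1
      have h6 : 0 ≤ 3 * K * M := by positivity
      have h7 : A₁ * M = 3 * K * M + ((n + 1) * (K * M) + (K * N₀ + K + 1) * M) := by
        rw [hA₁]; ring
      linarith)
  have h3 : -(N₀ * (K * N₀ + K + 1)) ≤ v x * gen d₁ l h (rate a b h α x) v x := by
    have h4 := H.abs_gen_solution_le hvN hα
    have h5 : |v x * gen d₁ l h (rate a b h α x) v x| ≤ N₀ * (K * N₀ + K + 1) := by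
      rw [abs_mul]
      exact mul_le_mul (hvN x) (h4.trans (by linarith [hh.le_one])) (abs_nonneg _) hN₀0.le
    exact (abs_le.1 h5).1
  have h4 : δ * (M ^ 2 / 4)
      ≤ ∑ k ∈ signedIdx d₁, rate a b h α x k * (fdiff h (l k) v x * fdiff h (l k) v x) := by
    have h5 := Finset.single_le_sum
      (f := fun k => rate a b h α x k * (fdiff h (l k) v x * fdiff h (l k) v x))
      (fun k hk => mul_nonneg (hr k hk).1 (mul_self_nonneg _)) hj
    refine le_trans ?_ h5
    simp only [hw] at hwj
    rw [inv_mul_le_iff₀ hM0] at hwj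
    exact mul_le_mul (H.rate_bounds hh α x hj).1 (by nlinarith) (by positivity) (hr j hj).1
  have h5 : μ / M ^ 2 * (δ * (M ^ 2 / 4) - CV) ≤ μ / M ^ 2 *
      (v x * gen d₁ l h (rate a b h α x) v x + v x * gen d₁ l h (rate a b h α x) v x
        + ∑ k ∈ signedIdx d₁, rate a b h α x k * (fdiff h (l k) v x * fdiff h (l k) v x)) :=
    mul_le_mul_of_nonneg_left (by linarith) (by positivity)
  have h6 : μ / M ^ 2 * (δ * (M ^ 2 / 4) - CV) = (C₂ + 3) - μ * CV / M ^ 2 := by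
    rw [hμ]; field_simp
  have h7 : μ * CV / M ^ 2 ≤ 1 := (div_le_one (by positivity)).2 hMμ.1
  linarith

end Gradient

/-! ### Differences in arbitrary directions of the unit ball. -/

section Translation

variable {l : ℤ → E d} {a b : A → ℤ → E d → ℝ} {c f : A → E d → ℝ} {g ψ : E d → ℝ}
  {δ K h P : ℝ} {v : E d → ℝ}

/-- The quantity `∑_i (N - δ_i v)²`. -/
def gradSq (d₁ : ℕ) (l : ℤ → E d) (h N : ℝ) (v : E d → ℝ) (y : E d) : ℝ :=
  ∑ i ∈ signedIdx d₁, (N - fdiff h (l i) v y) * (N - fdiff h (l i) v y)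

theorem gradSq_nonneg (N : ℝ) (y : E d) : 0 ≤ gradSq d₁ l h N v y :=
  Finset.sum_nonneg fun _ _ => mul_self_nonneg _

theorem gradSq_le {N : ℝ} {y : E d} (hN : ∀ k ∈ signedIdx d₁, |fdiff h (l k) v y| ≤ N) :
    gradSq d₁ l h N v y ≤ (signedIdx d₁).card * (4 * N ^ 2) := by
  rw [← nsmul_eq_mul]
  refine Finset.sum_le_card_nsmul _ _ _ fun k hk => ?_
  have := abs_le.1 (hN k hk)
  nlinarith

/-- The sum of the absolute values of all mixed second differences. -/
def hessAbs (d₁ : ℕ) (l : ℤ → E d) (h : ℝ) (v : E d → ℝ) (x : E d) : ℝ :=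
  ∑ i ∈ signedIdx d₁, ∑ k ∈ signedIdx d₁, |fdiff h (l k) (fdiff h (l i) v) x|

/-- The sum of the squares of all mixed second differences. -/
def hessSq (d₁ : ℕ) (l : ℤ → E d) (h : ℝ) (v : E d → ℝ) (x : E d) : ℝ :=
  ∑ i ∈ signedIdx d₁, ∑ k ∈ signedIdx d₁, fdiff h (l k) (fdiff h (l i) v) x ^ 2

theorem hessAbs_nonneg (x : E d) : 0 ≤ hessAbs d₁ l h v x :=
  Finset.sum_nonneg fun _ _ => Finset.sum_nonneg fun _ _ => abs_nonneg _

theorem hessSq_nonneg (x : E d) : 0 ≤ hessSq d₁ l h v x :=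
  Finset.sum_nonneg fun _ _ => Finset.sum_nonneg fun _ _ => sq_nonneg _

theorem mul_hessAbs_le {δ : ℝ} (hδ : 0 < δ) (p : ℝ) (x : E d) :
    p * hessAbs d₁ l h v x
      ≤ δ * hessSq d₁ l h v x + p ^ 2 * ((signedIdx d₁).card ^ 2 + 1) / (4 * δ) := by
  set n : ℝ := ((signedIdx d₁).card : ℝ) with hn
  have h1 : hessAbs d₁ l h v x ^ 2 ≤ n * n * hessSq d₁ l h v x := by
    rw [hn]; exact sq_sum_sum_abs_le _
  have h2 := absorb_linear (show 0 < δ / (n ^ 2 + 1) by positivity) p (hessAbs d₁ l h v x)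
  have h3 : δ / (n ^ 2 + 1) * hessAbs d₁ l h v x ^ 2 ≤ δ * hessSq d₁ l h v x := by
    rw [div_mul_eq_mul_div, div_le_iff₀ (by positivity), mul_assoc]
    refine mul_le_mul_of_nonneg_left ?_ hδ.le
    have := hessSq_nonneg (d₁ := d₁) (l := l) (h := h) (v := v) x
    linarith
  have h4 : p ^ 2 / (4 * (δ / (n ^ 2 + 1))) = p ^ 2 * (n ^ 2 + 1) / (4 * δ) := by
    field_simp
  linarith

/-- Only upper bounds for `L δ_i v` are available. Because `N - δ_i v ≥ 0`, they become lower bounds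
for `L (N - δ_i v)²`, which the square `(δ_i v)²` would not allow. The quadratic term yields all
mixed second differences, half of which absorbs the linear ones. -/
theorem Admissible.exists_gradSq_lower (H : Admissible d₁ l a b c f g δ K) {N₀ N : ℝ}
    (hN₀ : 0 ≤ N₀) (hN : 0 ≤ N) :
    ∃ C : ℝ, 0 ≤ C ∧ ∀ h, SmallStep δ K h → ∀ (Ω : Set (E d)) (v : E d → ℝ),
      IsBddBorelSolution d₁ l a b c f g Ω h v → (∀ y, |v y| ≤ N₀) →
      (∀ k ∈ signedIdx d₁, ∀ y, |fdiff h (l k) v y| ≤ N) →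
      ∀ x, (∀ k ∈ signedIdx d₁, x + h • l k ∈ innerSet Ω h) →
      ∀ α, |gen d₁ l h (rate a b h α x) v x - c α x * v x + f α x| ≤ h →
        δ / 2 * hessSq d₁ l h v x - C
          ≤ gen d₁ l h (rate a b h α x) (gradSq d₁ l h N v) x := by
  have hδ := H.pos
  have hK := H.K_pos
  set n : ℝ := ((signedIdx d₁).card : ℝ) with hn
  have hn0 : 0 ≤ n := by positivity
  set C₁ := (n + 1) * (K * N) + K * N₀ + K + 1 with hC₁
  have hC₁0 : 0 ≤ C₁ := by positivity
  set p := n * (4 * N * (3 * K)) with hp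
  refine ⟨n * (4 * N * C₁) + p ^ 2 * (n ^ 2 + 1) / (4 * (δ / 2)), by positivity,
    fun h hh Ω v hv hvN hvM x hx α hα => ?_⟩
  have hh' := hh.pos
  set G := hessAbs d₁ l h v x with hG
  have hG0 : 0 ≤ G := hessAbs_nonneg x
  have step : ∀ i ∈ signedIdx d₁, δ * ∑ k ∈ signedIdx d₁, fdiff h (l k) (fdiff h (l i) v) x ^ 2
      - 4 * N * (3 * K * G + C₁) ≤ gen d₁ l h (rate a b h α x)
        (fun y => (N - fdiff h (l i) v y) * (N - fdiff h (l i) v y)) x := by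
    intro i hi
    have h1 := hv.gen_fdiff_le_of_bound H hh' hvN hvM hi (hx i hi) hα
    have h2 := abs_le.1 (hvM i hi x)
    have e1 : gen d₁ l h (rate a b h α x) (fun y => N - fdiff h (l i) v y) x
        = -gen d₁ l h (rate a b h α x) (fdiff h (l i) v) x := by
      rw [gen_sub_fun (u := fun _ => N)]
      simp [gen]
    have e2 : ∀ k, fdiff h (l k) (fun y => N - fdiff h (l i) v y) x
        = -fdiff h (l k) (fdiff h (l i) v) x := fun k => by
      simp only [fdiff]; ring
    rw [gen_mul_fun hh'.ne', e1]
    simp only [e2, neg_mul_neg]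
    have h3 : δ * ∑ k ∈ signedIdx d₁, fdiff h (l k) (fdiff h (l i) v) x ^ 2
        ≤ ∑ k ∈ signedIdx d₁, rate a b h α x k
          * (fdiff h (l k) (fdiff h (l i) v) x * fdiff h (l k) (fdiff h (l i) v) x) := by
      rw [Finset.mul_sum]
      refine Finset.sum_le_sum fun k hk => ?_
      rw [pow_two]
      exact mul_le_mul_of_nonneg_right (H.rate_bounds hh α x hk).1 (mul_self_nonneg _)
    have h4 : (N - fdiff h (l i) v x) * gen d₁ l h (rate a b h α x) (fdiff h (l i) v) x
        ≤ 2 * N * (3 * K * G + C₁) := by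
      calc _ ≤ (N - fdiff h (l i) v x) * (3 * K * G + C₁) :=
            mul_le_mul_of_nonneg_left h1 (by linarith)
        _ ≤ _ := mul_le_mul_of_nonneg_right (by linarith) (by positivity)
    linarith
  have hz : gen d₁ l h (rate a b h α x) (gradSq d₁ l h N v) x
      = ∑ i ∈ signedIdx d₁, gen d₁ l h (rate a b h α x)
        (fun y => (N - fdiff h (l i) v y) * (N - fdiff h (l i) v y)) x := by
    unfold gradSq
    exact gen_sum_fun _ _
  rw [hz]
  refine le_trans ?_ (Finset.sum_le_sum step)
  rw [Finset.sum_sub_distrib, Finset.sum_const, nsmul_eq_mul, ← Finset.mul_sum, ← hn]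
  have h5 := mul_hessAbs_le (d₁ := d₁) (l := l) (h := h) (v := v) (half_pos hδ) p x
  rw [← hn, ← hG] at h5
  have h6 : n * (4 * N * (3 * K * G + C₁)) = p * G + n * (4 * N * C₁) := by rw [hp]; ring
  rw [h6]
  change _ ≤ δ * hessSq d₁ l h v x - _
  linarith

theorem abs_fdiff_gradSq_le {N : ℝ} (hvM : ∀ k ∈ signedIdx d₁, ∀ y, |fdiff h (l k) v y| ≤ N)
    (η x : E d) : |fdiff h η (gradSq d₁ l h N v) x|
      ≤ 4 * N * ∑ i ∈ signedIdx d₁, |fdiff h η (fdiff h (l i) v) x| := by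
  have e : fdiff h η (gradSq d₁ l h N v) x = ∑ i ∈ signedIdx d₁,
      fdiff h η (fdiff h (l i) v) x
        * (fdiff h (l i) v (x + h • η) + fdiff h (l i) v x - 2 * N) := by
    rw [fdiff, gradSq, gradSq, ← Finset.sum_sub_distrib, Finset.sum_div]
    refine Finset.sum_congr rfl fun i _ => ?_
    rw [fdiff.eq_1 h η (fdiff h (l i) v)]
    ring
  rw [e, Finset.mul_sum]
  refine (Finset.abs_sum_le_sum_abs _ _).trans (Finset.sum_le_sum fun i hi => ?_)
  rw [abs_mul, mul_comm]
  refine mul_le_mul_of_nonneg_right ?_ (abs_nonneg _)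
  have h1 := abs_le.1 (hvM i hi x)
  have h2 := abs_le.1 (hvM i hi (x + h • η))
  exact abs_le.2 ⟨by linarith, by linarith⟩

/-- Shifting `Δ_k v` from `x + hξ` back to `x` leaves `h Δ_k δ_ξ v`. For a general `ξ` this is not
controlled by the lattice second differences, so it is kept as a jump operator on `δ_ξ v` with rates
`2hδ_ξ a`, to be merged with the main one. -/
theorem Admissible.gen_fdiff_rate_eq (H : Admissible d₁ l a b c f g δ K) (hh : 0 < h) (α : A)
    (ξ x : E d) : gen d₁ l h (fun k => fdiff h ξ (fun z => rate a b h α z k) x) v (x + h • ξ)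
      = ∑ k ∈ signedIdx d₁, fdiff h ξ (a α k) x * sdiff h (l k) v x
        + gen d₁ l h (fun k => 2 * h * fdiff h ξ (a α k) x) (fdiff h ξ v) x
        + ∑ k ∈ signedIdx d₁, fdiff h ξ (b α k) x * fdiff h (l k) v (x + h • ξ) := by
  have e : gen d₁ l h (fun k => fdiff h ξ (fun z => rate a b h α z k) x) v (x + h • ξ)
      = gen d₁ l h (fun k => 2 * fdiff h ξ (a α k) x + h * fdiff h ξ (b α k) x) v (x + h • ξ) := by
    congr 1; funext k; simp only [fdiff, rate]; ring
  have hs : ∀ k ∈ signedIdx d₁, fdiff h ξ (a α (-k)) x = fdiff h ξ (a α k) x := fun k hk => by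
    simp only [fdiff, H.a_neg α k hk]
  have e2 : gen d₁ l h (fun k => 2 * h * fdiff h ξ (a α k) x) (fdiff h ξ v) x
      = ∑ k ∈ signedIdx d₁, fdiff h ξ (a α k) x * (h * sdiff h (l k) (fdiff h ξ v) x) := by
    have h1 := sum_sdiff_add_sum_fdiff H.neg (p := fun k => h * fdiff h ξ (a α k) x)
      (fun k hk => by simp only [hs k hk]) (fun _ => 0) hh (fdiff h ξ v) x
    simp only [zero_mul, Finset.sum_const_zero, add_zero, mul_zero] at h1
    rw [show (fun k => 2 * h * fdiff h ξ (a α k) x) = fun k => 2 * (h * fdiff h ξ (a α k) x) from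
      funext fun k => mul_assoc _ _ _, ← h1]
    exact Finset.sum_congr rfl fun k _ => by ring
  have e3 : ∑ k ∈ signedIdx d₁, fdiff h ξ (a α k) x * sdiff h (l k) v (x + h • ξ)
      = ∑ k ∈ signedIdx d₁, fdiff h ξ (a α k) x * sdiff h (l k) v x
        + ∑ k ∈ signedIdx d₁, fdiff h ξ (a α k) x * (h * sdiff h (l k) (fdiff h ξ v) x) := by
    rw [← Finset.sum_add_distrib]
    refine Finset.sum_congr rfl fun k _ => ?_
    rw [sdiff_fdiff_comm, ← mul_add]
    congr 1
    simp only [fdiff]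
    field_simp
    ring
  rw [e, ← sum_sdiff_add_sum_fdiff H.neg hs _ hh, e2, e3]

-- At an approximate maximum of `-δ_ξ v + gradSq`, the terms `Δ_k v` with differenced coefficients
-- are absorbed by the squares that `gradSq` provides, and the uncontrolled part goes into the
-- rates. What remains is `c(x + hξ) (-δ_ξ v) ≤ C₃`, and `c ≥ δ` concludes. No exponential is
-- needed, as no bad term involves differences of `δ_ξ v`.
set_option maxHeartbeats 1000000 in
theorem Admissible.exists_translation_bound [Nonempty A] (H : Admissible d₁ l a b c f g δ K)
    (hψ : C11Bounds ψ P) {B N h₀ : ℝ} (hB : 0 ≤ B) (hN : 0 ≤ N)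
    (hbd : ∀ h, SmallStep δ K h → h ≤ h₀ → ∀ v,
      IsBddBorelSolution d₁ l a b c f g {x | 0 < ψ x} h v → ∀ x, |v x - g x| ≤ B * max (ψ x) 0)
    (hgr : ∀ h, SmallStep δ K h → h ≤ h₀ → ∀ v,
      IsBddBorelSolution d₁ l a b c f g {x | 0 < ψ x} h v →
      ∀ k ∈ signedIdx d₁, ∀ x, |fdiff h (l k) v x| ≤ N) :
    ∃ N' : ℝ, 0 ≤ N' ∧ ∀ h, SmallStep δ K h → h ≤ h₀ → ∀ v,
      IsBddBorelSolution d₁ l a b c f g {x | 0 < ψ x} h v →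
      ∀ ξ : E d, ‖ξ‖ ≤ 1 → ∀ x, |fdiff h ξ v x| ≤ N' := by
  have hδ := H.pos
  have hK := H.K_pos
  have hP := hψ.nonneg
  set n : ℝ := ((signedIdx d₁).card : ℝ) with hn
  have hn0 : 0 ≤ n := by positivity
  set N₀ := K / δ + K with hN₀
  have hN₀0 : 0 < N₀ := by positivity
  obtain ⟨C, hC, hgs⟩ := H.exists_gradSq_lower hN₀0.le hN
  set R := 2 * P + 1 with hR
  have hR0 : 0 ≤ R := by positivity
  set Nb := K + B * (2 * R + P) with hNb
  have hNb0 : 0 ≤ Nb := by positivity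
  set Z := n * (4 * N ^ 2) with hZ
  have hZ0 : 0 ≤ Z := by positivity
  -- `K` comes from `δ_ξ a` acting on `Δ_k v`, and `2K · 4N` from the added rates acting on
  -- `gradSq`.
  set p := K + 2 * K * (4 * N) with hp
  set C₃ := n * (K * N) + K * N₀ + K + 2 + C + p ^ 2 * (n ^ 2 + 1) / (4 * (δ / 2)) with hC₃
  have hC₃0 : 0 ≤ C₃ := by positivity
  set N' := Nb + Z + C₃ / δ with hN'
  have hCδ : 0 ≤ C₃ / δ := by positivity
  have hN'0 : 0 ≤ N' := by positivity
  clear_value N' C₃ Z Nb R N₀ n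
  refine ⟨N', hN'0, fun h hh hh0 v hv => ?_⟩
  have hh' := hh.pos
  have hvN : ∀ y, |v y| ≤ N₀ := hN₀ ▸ hv.abs_apply_le H hh
  have hvB := hbd h hh hh0 v hv
  have hvM := hgr h hh hh0 v hv
  suffices hs : ∀ ξ : E d, ‖ξ‖ ≤ 1 → ∀ x, -fdiff h ξ v x ≤ N' by
    intro ξ hξ x
    refine abs_le.2 ⟨by linarith [hs ξ hξ x], ?_⟩
    have h1 := hs (-ξ) (by rwa [norm_neg]) (x + h • ξ)
    rw [fdiff_neg, add_sub_cancel_right] at h1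
    rw [fdiff]
    linarith [neg_div h (v x - v (x + h • ξ)), neg_sub (v x) (v (x + h • ξ)),
      congrArg (· / h) (neg_sub (v x) (v (x + h • ξ)))]
  intro ξ hξ x₀
  by_contra! hx₀
  have hzle : ∀ y, gradSq d₁ l h N v y ≤ Z := fun y => by
    rw [hZ, hn]; exact gradSq_le fun k hk => hvM k hk y
  have hoff : ∀ y, ψ y ≤ R * h → -fdiff h ξ v y ≤ Nb := fun y hy => by
    have h1 := abs_fdiff_le_of_boundary H.g_reg hψ hh' hB hR0 hvB hy hξ
    rw [hNb]
    linarith [(abs_le.1 h1).1]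
  obtain ⟨x, hxD, hxx, hxr⟩ := H.exists_gen_le hh'
    (fun y => -fdiff h ξ v y + gradSq d₁ l h N v y) {y | R * h < ψ y} (C := 2 * N₀ / h + Z) (x₀ := x₀)
    (fun y _ => by
      refine add_le_add ?_ (hzle y)
      rw [fdiff, ← neg_div]
      refine div_le_div_of_nonneg_right ?_ hh'.le
      linarith [abs_le.1 (hvN y), abs_le.1 (hvN (y + h • ξ))])
    (by
      by_contra hc
      linarith [hoff x₀ (not_lt.1 hc)])
    (fun y _ k _ => by
      by_cases hc : R * h < ψ (y + h • l k)
      · exact .inl hc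
      · right
        linarith [hoff _ (not_lt.1 hc), hzle (y + h • l k),
          gradSq_nonneg (d₁ := d₁) (l := l) (h := h) (v := v) N x₀]) one_pos
  have hxψ : R * h < ψ x := hxD
  have hin : ∀ η : E d, ‖η‖ ≤ 1 → x + h • η ∈ innerSet {x | 0 < ψ x} h := fun η hη => by
    refine hψ.mem_innerSet hh' ?_
    have h1 := (abs_le.1 (hψ.lip x (h • η))).1
    have h2 : P * ‖h • η‖ ≤ P * h := by
      rw [norm_smul, Real.norm_of_nonneg hh'.le]
      exact mul_le_mul_of_nonneg_left (mul_le_of_le_one_right hh'.le hη) hP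
    rw [hR] at hxψ
    linarith
  have hxi : x ∈ innerSet {x | 0 < ψ x} h := by simpa using hin 0 (by simp)
  obtain ⟨α, hα⟩ := hv.exists_abs_gen_le H hh' hxi hh'
  have hβ : ∀ k ∈ signedIdx d₁, |fdiff h ξ (a α k) x| ≤ K := fun k hk =>
    (H.a_reg α k hk).abs_fdiff_le hh' hξ x
  -- The extra rates are at most `2Kh ≤ δ` in absolute value, so the sum stays nonnegative.
  have h1 := hxr (fun k => rate a b h α x k + 2 * h * fdiff h ξ (a α k) x) (fun k hk => by
    have h2 := H.rate_bounds hh α x hk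
    have h3 := abs_le.1 (hβ k hk)
    have h4 := hh.mul_le
    have h5 := mul_le_mul_of_nonneg_left h3.1 hh'.le
    have h6 := mul_le_mul_of_nonneg_left h3.2 hh'.le
    have h7 := H.le
    constructor <;> linarith)
  rw [gen_add_fun, gen_neg_fun, gen_add_rate, gen_add_rate] at h1
  have h2 := hv.gen_fdiff_le H hh' (hin ξ hξ) (abs_le.1 hα).1
  rw [H.gen_fdiff_rate_eq hh', div_self hh'.ne', fdiff_mul_sub] at h2
  have h3 := hgs h hh _ v hv hvN hvM x (fun k hk => hin _ (H.norm_le k hk)) α hα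
  set G := hessAbs d₁ l h v x with hG
  have h4 : |∑ k ∈ signedIdx d₁, fdiff h ξ (a α k) x * sdiff h (l k) v x| ≤ K * G := by
    refine (Finset.abs_sum_le_sum_abs _ _).trans ?_
    refine le_trans ?_ (mul_le_mul_of_nonneg_left (sum_abs_sdiff_le H.neg hh'.ne') hK.le)
    rw [Finset.mul_sum]
    refine Finset.sum_le_sum fun k hk => ?_
    rw [abs_mul]
    exact mul_le_mul_of_nonneg_right (hβ k hk) (abs_nonneg _)
  have h5 : |∑ k ∈ signedIdx d₁, fdiff h ξ (b α k) x * fdiff h (l k) v (x + h • ξ)|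
      ≤ n * (K * N) := by
    refine (Finset.abs_sum_le_sum_abs _ _).trans ?_
    rw [hn, ← nsmul_eq_mul]
    refine Finset.sum_le_card_nsmul _ _ _ fun k hk => ?_
    rw [abs_mul]
    exact mul_le_mul ((H.b_reg α k hk).abs_fdiff_le hh' hξ x) (hvM k hk _) (abs_nonneg _) hK.le
  have h6 : |gen d₁ l h (fun k => 2 * h * fdiff h ξ (a α k) x) (gradSq d₁ l h N v) x|
      ≤ 2 * K * (4 * N) * G := by
    have e : gen d₁ l h (fun k => 2 * h * fdiff h ξ (a α k) x) (gradSq d₁ l h N v) x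
        = ∑ k ∈ signedIdx d₁, 2 * fdiff h ξ (a α k) x * fdiff h (l k) (gradSq d₁ l h N v) x := by
      unfold gen
      refine Finset.sum_congr rfl fun k _ => ?_
      rw [fdiff.eq_1 h (l k)]
      field_simp
    rw [e, hG, hessAbs, Finset.sum_comm, Finset.mul_sum]
    refine (Finset.abs_sum_le_sum_abs _ _).trans (Finset.sum_le_sum fun k hk => ?_)
    rw [abs_mul, abs_mul, abs_two, mul_assoc (2 * K)]
    exact mul_le_mul (by linarith [hβ k hk]) (abs_fdiff_gradSq_le hvM _ _) (abs_nonneg _)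
      (by positivity)
  have h7 : |v x * fdiff h ξ (c α) x| ≤ K * N₀ := by
    rw [abs_mul, mul_comm]
    exact mul_le_mul ((H.c_reg α).abs_fdiff_le hh' hξ x) (hvN x) (abs_nonneg _) hK.le
  have h8 := abs_le.1 ((H.f_reg α).abs_fdiff_le hh' hξ x)
  have h9 := mul_hessAbs_le (d₁ := d₁) (l := l) (h := h) (v := v) (half_pos hδ) p x
  rw [← hn, ← hG] at h9
  have hux : Nb + C₃ / δ < -fdiff h ξ v x := by
    linarith [hzle x, gradSq_nonneg (d₁ := d₁) (l := l) (h := h) (v := v) N x₀]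
  have h10 : C₃ < c α (x + h • ξ) * -fdiff h ξ v x := by
    calc C₃ = δ * (C₃ / δ) := by field_simp
      _ < δ * -fdiff h ξ v x := mul_lt_mul_of_pos_left (by linarith) hδ
      _ ≤ _ := mul_le_mul_of_nonneg_right (H.c_lower α _) (by linarith)
  have h4' := abs_le.1 h4
  have h5' := abs_le.1 h5
  have h6' := abs_le.1 h6
  have h7' := abs_le.1 h7
  have h11 : p * G = K * G + 2 * K * (4 * N) * G := by rw [hp]; ring
  linarith

/-- Join the points by `⌈‖x - y‖/h⌉` equal steps of length at most `h`; rounding up accounts for the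
additional `h`. -/
theorem abs_sub_le_of_abs_fdiff_le (hh : 0 < h) {N : ℝ} (hN : 0 ≤ N)
    (hv : ∀ ξ : E d, ‖ξ‖ ≤ 1 → ∀ x, |fdiff h ξ v x| ≤ N) (x y : E d) :
    |v x - v y| ≤ N * (‖x - y‖ + h) := by
  set m : ℕ := ⌈‖x - y‖ / h⌉₊ with hm
  rcases Nat.eq_zero_or_pos m with h0 | h0
  · have h1 : ‖x - y‖ / h ≤ 0 := by
      rw [hm, Nat.ceil_eq_zero] at h0; exact h0
    have h2 : ‖x - y‖ ≤ 0 := by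
      rw [div_le_iff₀ hh, zero_mul] at h1; exact h1
    have h3 : x = y := sub_eq_zero.1 (norm_le_zero_iff.1 h2)
    rw [h3]
    simp only [sub_self, abs_zero, norm_zero, zero_add]
    positivity
  have hm0 : (0 : ℝ) < m := Nat.cast_pos.2 h0
  set ξ : E d := ((m * h)⁻¹ : ℝ) • (y - x) with hξ
  have hle : ‖x - y‖ / h ≤ m := Nat.le_ceil _
  have hlt : (m : ℝ) < ‖x - y‖ / h + 1 := Nat.ceil_lt_add_one (by positivity)
  have hξ1 : ‖ξ‖ ≤ 1 := by
    rw [hξ, norm_smul, Real.norm_of_nonneg (by positivity), inv_mul_le_iff₀ (by positivity), mul_one,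
      norm_sub_rev]
    rwa [div_le_iff₀ hh] at hle
  have key : ∀ i : ℕ, |v (x + (i * h) • ξ) - v x| ≤ i * (N * h) := by
    intro i
    induction i with
    | zero => simp
    | succ i ih =>
      have h1 := hv ξ hξ1 (x + (i * h) • ξ)
      rw [fdiff, abs_div, abs_of_pos hh, div_le_iff₀ hh, add_assoc, ← add_smul] at h1
      push_cast
      rw [add_one_mul (i : ℝ) h, add_one_mul]
      exact (abs_sub_le _ (v (x + (i * h) • ξ)) _).trans (by linarith)
  have h1 := key m
  rw [hξ, smul_smul, mul_inv_cancel₀ (by positivity), one_smul, add_sub_cancel, abs_sub_comm] at h1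
  refine h1.trans ?_
  have h2 : (m : ℝ) * h ≤ ‖x - y‖ + h := by
    calc (m : ℝ) * h ≤ (‖x - y‖ / h + 1) * h := mul_le_mul_of_nonneg_right hlt.le hh.le
      _ = ‖x - y‖ + h := by field_simp
  nlinarith

end Translation

/-! ### Mixed differences from pure ones. -/

section Polarization

variable {l : ℤ → E d} {h : ℝ} {v : E d → ℝ}

/-- The relation between the directions of the scheme and a subset generating them by sums. -/
structure SumClosed (d₁ d₀ : ℕ) (l : ℤ → E d) : Prop where
  le : d₀ ≤ d₁
  decompose : ∀ k ∈ signedIdx d₁, ∃ i ∈ signedIdx d₀, ∃ j ∈ signedIdx d₀, l k = l i + l j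
  add_mem : ∀ i ∈ signedIdx d₀, ∀ j ∈ signedIdx d₀, l i ≠ l j → ∃ k ∈ signedIdx d₁, l i + l j = l k

theorem signedIdx_mono {m n : ℕ} (hmn : m ≤ n) : signedIdx m ⊆ signedIdx n := by
  intro k hk
  simp only [signedIdx, Finset.mem_erase, Finset.mem_Icc] at hk ⊢
  omega

theorem fdiff_add_dir (ξ η : E d) (x : E d) :
    fdiff h (ξ + η) v x = fdiff h ξ v (x + h • η) + fdiff h η v x := by
  simp only [fdiff, smul_add, add_right_comm x (h • η) (h • ξ), add_assoc]
  ring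

theorem fdiff_fdiff_self (hh : h ≠ 0) (ξ x : E d) :
    fdiff h ξ (fdiff h ξ v) x = sdiff h ξ v (x + h • ξ) := by
  simp only [fdiff, sdiff, add_sub_cancel_right]
  field_simp
  ring

/-- Polarization of the second difference in direction `ξ + η`, with base points shifted so that the
identity is exact. -/
theorem two_mul_fdiff_fdiff (hh : h ≠ 0) (ξ η x : E d) :
    2 * fdiff h ξ (fdiff h η v) x = sdiff h (ξ + η) v x - 2 * sdiff h ξ v x
      + sdiff h ξ v (x + h • η) - sdiff h η v (x - h • ξ) := by
  simp only [fdiff, sdiff, smul_add, ← add_assoc, ← sub_sub, add_right_comm x (h • η) (h • ξ),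
    sub_add_eq_add_sub x (h • ξ) (h • η)]
  field_simp
  ring

/-- Mixed second differences are controlled by pure second differences at nearby points. -/
theorem SumClosed.abs_fdiff_fdiff_le {d₀ : ℕ} (hΛ : SumClosed d₁ d₀ l) (hh : 0 < h)
    (hl : ∀ k ∈ signedIdx d₁, ‖l k‖ ≤ 1) {x : E d} {U : ℝ}
    (hU : ∀ k ∈ signedIdx d₁, ∀ y, ‖y - x‖ ≤ 4 * h → |sdiff h (l k) v y| ≤ U)
    {i j : ℤ} (hi : i ∈ signedIdx d₁) (hj : j ∈ signedIdx d₁) :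
    |fdiff h (l i) (fdiff h (l j) v) x| ≤ 10 * U := by
  have hn : ∀ k ∈ signedIdx d₀, ‖h • l k‖ ≤ h := fun k hk => by
    rw [norm_smul, Real.norm_of_nonneg hh.le]
    exact mul_le_of_le_one_right hh.le (hl k (signedIdx_mono hΛ.le hk))
  have hadd : ∀ (y z : E d) (t : ℝ), ‖y - x‖ ≤ t → ‖z‖ ≤ h → ‖y + z - x‖ ≤ t + h :=
    fun y z t hy hz => by
      rw [add_sub_right_comm]; exact (norm_add_le _ _).trans (add_le_add hy hz)
  -- Distinct directions have their sum among the `l k`, so polarization gives `(1 + 2 + 1 + 1)/2 ·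
  -- U`; equal ones give a shifted pure difference.
  have base : ∀ p ∈ signedIdx d₀, ∀ q ∈ signedIdx d₀, ∀ y, ‖y - x‖ ≤ 2 * h →
      |fdiff h (l p) (fdiff h (l q) v) y| ≤ 5 / 2 * U := by
    intro p hp q hq y hy
    have hp' := signedIdx_mono hΛ.le hp
    have hq' := signedIdx_mono hΛ.le hq
    have hyp : ‖y - h • l p - x‖ ≤ 4 * h := by
      have h1 := hadd y (-(h • l p)) (2 * h) hy (by rw [norm_neg]; exact hn p hp)
      rw [← sub_eq_add_neg] at h1
      exact h1.trans (by linarith only [hh])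
    have hyq : ‖y + h • l q - x‖ ≤ 4 * h :=
      (hadd y (h • l q) (2 * h) hy (hn q hq)).trans (by linarith only [hh])
    by_cases hpq : l p = l q
    · rw [hpq, fdiff_fdiff_self hh.ne']
      have h1 := hU q hq' _ hyq
      have h2 := abs_nonneg (sdiff h (l q) v (y + h • l q))
      linarith only [h1, h2]
    · obtain ⟨k, hk, hkl⟩ := hΛ.add_mem p hp q hq hpq
      have h1 := two_mul_fdiff_fdiff (v := v) hh.ne' (l p) (l q) y
      rw [hkl] at h1
      have hy4 : ‖y - x‖ ≤ 4 * h := hy.trans (by linarith only [hh])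
      obtain ⟨h2, h2'⟩ := abs_le.1 (hU k hk y hy4)
      obtain ⟨h3, h3'⟩ := abs_le.1 (hU p hp' y hy4)
      obtain ⟨h4, h4'⟩ := abs_le.1 (hU p hp' _ hyq)
      obtain ⟨h5, h5'⟩ := abs_le.1 (hU q hq' _ hyp)
      exact abs_le.2 ⟨by linarith only [h1, h2, h3', h4, h5'], by linarith only [h1, h2', h3, h4', h5]⟩
  -- Splitting both directions gives four basic mixed differences, whence `4 · 5/2 = 10`.
  obtain ⟨i₁, hi₁, i₂, hi₂, hi⟩ := hΛ.decompose i hi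
  obtain ⟨j₁, hj₁, j₂, hj₂, hj⟩ := hΛ.decompose j hj
  have mid : ∀ p ∈ signedIdx d₀, ∀ y, ‖y - x‖ ≤ h → |fdiff h (l p) (fdiff h (l j) v) y| ≤ 5 * U := by
    intro p hp y hy
    rw [fdiff_comm, hj, fdiff_add_dir]
    have h1 := base j₁ hj₁ p hp (y + h • l j₂)
      ((hadd y (h • l j₂) h hy (hn j₂ hj₂)).trans (by linarith only))
    have h2 := base j₂ hj₂ p hp y (hy.trans (by linarith only [hh]))
    exact (abs_add_le _ _).trans (by linarith only [h1, h2])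
  rw [hi, fdiff_add_dir]
  have h1 := mid i₁ hi₁ (x + h • l i₂) (by rw [add_sub_cancel_left]; exact hn i₂ hi₂)
  have h2 := mid i₂ hi₂ x (by rw [sub_self, norm_zero]; exact hh.le)
  exact (abs_add_le _ _).trans (by linarith only [h1, h2])

end Polarization

/-! ### Weighted bound for second differences. -/

section Hessian

variable {l : ℤ → E d} {a b : A → ℤ → E d → ℝ} {c f : A → E d → ℝ} {g ψ : E d → ℝ}
  {δ K h P : ℝ} {v : E d → ℝ}

theorem abs_sdiff_le_of_abs_fdiff_le (hh : 0 < h) {N : ℝ} {ξ : E d}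
    (hN : ∀ y, |fdiff h ξ v y| ≤ N) (x : E d) : |sdiff h ξ v x| ≤ 2 * N / h := by
  have e : sdiff h ξ v x = (fdiff h ξ v x - fdiff h ξ v (x - h • ξ)) / h := by
    simp only [fdiff, sdiff, sub_add_cancel]
    field_simp
    ring
  rw [e, abs_div, abs_of_pos hh]
  refine div_le_div_of_nonneg_right ?_ hh.le
  linarith [abs_sub (fdiff h ξ v x) (fdiff h ξ v (x - h • ξ)), hN x, hN (x - h • ξ)]

/-- By the equation, a lower bound for all second differences at a point implies an upper bound. -/
theorem IsBddBorelSolution.mul_abs_sdiff_le (H : Admissible d₁ l a b c f g δ K) (hh : 0 < h)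
    [Nonempty A] {Ω : Set (E d)} (hv : IsBddBorelSolution d₁ l a b c f g Ω h v) {N₀ N m t Q : ℝ}
    (hvN : ∀ y, |v y| ≤ N₀) (hvM : ∀ k ∈ signedIdx d₁, ∀ y, |fdiff h (l k) v y| ≤ N) {x : E d}
    (hx : x ∈ innerSet Ω h) (ht0 : 0 ≤ t) (htP : t ≤ Q) (hm : 1 ≤ m)
    (hlow : ∀ k ∈ signedIdx d₁, -(t * sdiff h (l k) v x) ≤ m) {k : ℤ} (hk : k ∈ signedIdx d₁) :
    t * |sdiff h (l k) v x|
      ≤ (1 + (Q * (K * N₀ + K + (signedIdx d₁).card * (K * N)) + (signedIdx d₁).card * K) / δ) * m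
    := by
  have hδ := H.pos
  have hK := H.K_pos
  have hN₀ : 0 ≤ N₀ := (abs_nonneg _).trans (hvN x)
  have hN : 0 ≤ N := (abs_nonneg _).trans (hvM k hk x)
  have hQ : 0 ≤ Q := ht0.trans htP
  obtain ⟨α⟩ := ‹Nonempty A›
  set n : ℝ := ((signedIdx d₁).card : ℝ) with hn
  have hn0 : 0 ≤ n := by positivity
  set D := (Q * (K * N₀ + K + n * (K * N)) + n * K) / δ with hD
  have hD0 : 0 ≤ D := by positivity
  rcases le_total (sdiff h (l k) v x) 0 with hc | hc
  · rw [abs_of_nonpos hc]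
    have h1 := hlow k hk
    have : 0 ≤ D * m := by positivity
    linarith
  rw [abs_of_nonneg hc]
  have h1 := hv.gen_le H hh hx α
  rw [← H.scheme_eq_gen hh] at h1
  have h2 : |∑ k ∈ signedIdx d₁, b α k x * fdiff h (l k) v x| ≤ n * (K * N) := by
    refine (Finset.abs_sum_le_sum_abs _ _).trans ?_
    rw [hn, ← nsmul_eq_mul]
    refine Finset.sum_le_card_nsmul _ _ _ fun i hi => ?_
    rw [abs_mul]
    exact mul_le_mul ((H.b_reg α i hi).abs_le x) (hvM i hi x) (abs_nonneg _) hK.le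
  have h3 : |c α x * v x| ≤ K * N₀ := by
    rw [abs_mul]
    exact mul_le_mul ((H.c_reg α).abs_le x) (hvN x) (abs_nonneg _) hK.le
  have h4 := abs_le.1 ((H.f_reg α).abs_le x)
  have h2' := abs_le.1 h2
  have h3' := abs_le.1 h3
  have h5 : ∑ i ∈ signedIdx d₁, a α i x * sdiff h (l i) v x ≤ K * N₀ + K + n * (K * N) := by
    linarith
  have h6 : t * ∑ i ∈ signedIdx d₁, a α i x * sdiff h (l i) v x
      ≤ Q * (K * N₀ + K + n * (K * N)) :=
    (mul_le_mul_of_nonneg_left h5 ht0).trans (mul_le_mul_of_nonneg_right htP (by positivity))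
  -- Adding `Km` makes every summand nonnegative, so a single one is bounded by the total.
  have h7 : a α k x * (t * sdiff h (l k) v x) + K * m
      ≤ ∑ i ∈ signedIdx d₁, (a α i x * (t * sdiff h (l i) v x) + K * m) := by
    refine Finset.single_le_sum (f := fun i => a α i x * (t * sdiff h (l i) v x) + K * m)
      (fun i hi => ?_) hk
    have h8 := hlow i hi
    have h9 := abs_le.1 ((H.a_reg α i hi).abs_le x)
    have h10 := H.a_lower α i hi x
    nlinarith
  rw [Finset.sum_add_distrib, Finset.sum_const, nsmul_eq_mul, ← hn] at h7
  have h8 : ∑ i ∈ signedIdx d₁, a α i x * (t * sdiff h (l i) v x)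
      = t * ∑ i ∈ signedIdx d₁, a α i x * sdiff h (l i) v x := by
    rw [Finset.mul_sum]
    exact Finset.sum_congr rfl fun i _ => by ring
  rw [h8] at h7
  have h9 : δ * (t * sdiff h (l k) v x) ≤ a α k x * (t * sdiff h (l k) v x) :=
    mul_le_mul_of_nonneg_right (H.a_lower α k hk x) (by positivity)
  have h10 : δ * (D * m) = Q * (K * N₀ + K + n * (K * N)) * m + n * K * m := by
    rw [hD]; field_simp
  have h11 : Q * (K * N₀ + K + n * (K * N)) ≤ Q * (K * N₀ + K + n * (K * N)) * m :=
    le_mul_of_one_le_right (by positivity) hm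
  have h12 : δ * (t * sdiff h (l k) v x) ≤ δ * (D * m) := by nlinarith
  have h13 := le_of_mul_le_mul_left h12 hδ
  linarith

/-- The twice differenced equation. -/
theorem IsBddBorelSolution.gen_sdiff_le_of_bound (H : Admissible d₁ l a b c f g δ K)
    (hh : SmallStep δ K h) {Ω : Set (E d)} (hv : IsBddBorelSolution d₁ l a b c f g Ω h v)
    {N₀ N U : ℝ} (hvN : ∀ y, |v y| ≤ N₀) (hvM : ∀ k ∈ signedIdx d₁, ∀ y, |fdiff h (l k) v y| ≤ N)
    {x : E d} (hU : ∀ k ∈ signedIdx d₁, |sdiff h (l k) v x| ≤ U)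
    (hUU : ∀ i ∈ signedIdx d₁, ∀ k ∈ signedIdx d₁, |fdiff h (l i) (fdiff h (l k) v) x| ≤ 10 * U)
    {j : ℤ} (hj : j ∈ signedIdx d₁) (hx : x + h • l j ∈ innerSet Ω h)
    (hx' : x - h • l j ∈ innerSet Ω h) {α : A}
    (hα : |gen d₁ l h (rate a b h α x) v x - c α x * v x + f α x| ≤ h ^ 2) :
    gen d₁ l h (rate a b h α x) (sdiff h (l j) v) x
      ≤ 2 * K * (∑ i ∈ signedIdx d₁, ∑ k ∈ signedIdx d₁, |fdiff h (l k) (sdiff h (l i) v) x|)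
        + (21 * (signedIdx d₁).card * K + K) * U
        + ((signedIdx d₁).card * (K * N) + K * N₀ + 2 * (K * N) + K + 2) := by
  have hh' := hh.pos
  have hK := H.K_pos.le
  have hj' := neg_mem_signedIdx hj
  have h1 := hv.gen_sdiff_le H hh' hx hx' (abs_le.1 hα).1
  rw [mul_div_assoc, div_self (by positivity : h ^ 2 ≠ 0), mul_one, sdiff_mul_sub hh'.ne',
    ← H.neg j hj] at h1
  set n : ℝ := ((signedIdx d₁).card : ℝ) with hn
  set G := ∑ i ∈ signedIdx d₁, ∑ k ∈ signedIdx d₁, |fdiff h (l k) (sdiff h (l i) v) x| with hG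
  have hT : ∀ p ∈ signedIdx d₁,
      |gen d₁ l h (fun k => fdiff h (l p) (fun y => rate a b h α y k) x) (fdiff h (l p) v) x|
        ≤ K * (G + n * (10 * U)) := by
    intro p hp
    refine (H.abs_gen_fdiff_rate_le hh' α (H.norm_le p hp) _ x x).trans
      (mul_le_mul_of_nonneg_left (add_le_add ?_ ?_) hK)
    · refine Finset.sum_le_sum fun k _ => ?_
      rw [sdiff_fdiff_comm]
      exact Finset.single_le_sum (f := fun i => |fdiff h (l i) (sdiff h (l k) v) x|)
        (fun _ _ => abs_nonneg _) hp
    · rw [hn, ← nsmul_eq_mul]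
      exact Finset.sum_le_card_nsmul _ _ _ fun k hk => hUU k hk p hp
  have h2 := abs_le.1 (hT j hj)
  have h3 := abs_le.1 (hT (-j) hj')
  have h4 : |gen d₁ l h (fun k => sdiff h (l j) (fun y => rate a b h α y k) x) v x|
      ≤ K * (n * U + n * N) := by
    refine (H.abs_gen_sdiff_rate_le hh' α (H.norm_le j hj) _ x x).trans
      (mul_le_mul_of_nonneg_left (add_le_add ?_ ?_) hK) <;>
    · rw [hn, ← nsmul_eq_mul]
      refine Finset.sum_le_card_nsmul _ _ _ fun k hk => ?_
      first
      | exact hU k hk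
      | exact hvM k hk x
  have h5 : |c α x * sdiff h (l j) v x| ≤ K * U := by
    rw [abs_mul]
    exact mul_le_mul ((H.c_reg α).abs_le x) (hU j hj) (abs_nonneg _) hK
  have h6 : |v x * sdiff h (l j) (c α) x| ≤ K * N₀ := by
    rw [abs_mul, mul_comm]
    exact mul_le_mul ((H.c_reg α).abs_sdiff_le hh' (H.norm_le j hj) x) (hvN x) (abs_nonneg _) hK
  have h7 : ∀ p ∈ signedIdx d₁, |fdiff h (l p) (c α) x * fdiff h (l p) v x| ≤ K * N := fun p hp => by
    rw [abs_mul]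
    exact mul_le_mul ((H.c_reg α).abs_fdiff_le hh' (H.norm_le p hp) x) (hvM p hp x) (abs_nonneg _) hK
  have h8 := abs_le.1 ((H.f_reg α).abs_sdiff_le hh' (H.norm_le j hj) x)
  have h4' := abs_le.1 h4
  have h5' := abs_le.1 h5
  have h6' := abs_le.1 h6
  have h7' := abs_le.1 (h7 j hj)
  have h7'' := abs_le.1 (h7 _ hj')
  linarith

/-- Multiplication of a differenced equation by a weight. -/
theorem Admissible.gen_weight_le (H : Admissible d₁ l a b c f g δ K) (hh : SmallStep δ K h)
    (hψ : C11Bounds ψ P) (hP : 0 ≤ P) {u : ℤ → E d → ℝ} {x : E d} {U c₁ c₂ : ℝ} (hx : 0 < ψ x)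
    (hc₁ : 0 ≤ c₁) (hc₂ : 0 ≤ c₂)
    (hU : ∀ k ∈ signedIdx d₁, |u k x| ≤ U)
    (hU' : ∀ i ∈ signedIdx d₁, ∀ k ∈ signedIdx d₁, |u i (x + h • l k)| ≤ U) (α : A) {j : ℤ}
    (hj : j ∈ signedIdx d₁)
    (hu : gen d₁ l h (rate a b h α x) (u j) x
      ≤ 2 * K * (∑ i ∈ signedIdx d₁, ∑ k ∈ signedIdx d₁, |fdiff h (l k) (u i) x|) + c₁ * U + c₂) :
    gen d₁ l h (rate a b h α x) (fun y => ψ y * u j y) x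
      ≤ 5 * K * P * ((ψ x)⁻¹ * (∑ i ∈ signedIdx d₁, ∑ k ∈ signedIdx d₁,
          |fdiff h (l k) (fun y => ψ y * u i y) x| + (signedIdx d₁).card ^ 2 * (U * P)))
        + (P * c₁ + (signedIdx d₁).card * (2 * K * P)) * U + P * c₂ := by
  have hh' := hh.pos
  have hK := H.K_pos.le
  have hU0 : 0 ≤ U := (abs_nonneg _).trans (hU j hj)
  set n : ℝ := ((signedIdx d₁).card : ℝ) with hn
  set G := ∑ i ∈ signedIdx d₁, ∑ k ∈ signedIdx d₁, |fdiff h (l k) (u i) x| with hG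
  set W := ∑ i ∈ signedIdx d₁, ∑ k ∈ signedIdx d₁, |fdiff h (l k) (fun y => ψ y * u i y) x| with hW
  have hG0 : 0 ≤ G := Finset.sum_nonneg fun _ _ => Finset.sum_nonneg fun _ _ => abs_nonneg _
  -- Recovering differences of `u` from those of `ψu` costs the factor `1/ψ`, which becomes the
  -- scale `s`.
  have hGW : G ≤ (ψ x)⁻¹ * (W + n ^ 2 * (U * P)) := by
    have h1 : ∀ i ∈ signedIdx d₁, ∀ k ∈ signedIdx d₁, ψ x * |fdiff h (l k) (u i) x|
        ≤ |fdiff h (l k) (fun y => ψ y * u i y) x| + U * P := by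
      intro i hi k hk
      have e : ψ x * fdiff h (l k) (u i) x
          = fdiff h (l k) (fun y => ψ y * u i y) x - u i (x + h • l k) * fdiff h (l k) ψ x := by
        simp only [fdiff]; ring
      have h2 : |u i (x + h • l k) * fdiff h (l k) ψ x| ≤ U * P := by
        rw [abs_mul]
        exact mul_le_mul (hU' i hi k hk) (hψ.abs_fdiff_le hh' (H.norm_le k hk) x) (abs_nonneg _) hU0
      have e' : ψ x * |fdiff h (l k) (u i) x| = |ψ x * fdiff h (l k) (u i) x| := by
        rw [abs_mul, abs_of_pos hx]
      rw [e', e]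
      exact (abs_sub _ _).trans (by linarith only [h2])
    rw [le_inv_mul_iff₀ hx, hG, Finset.mul_sum]
    calc ∑ i ∈ signedIdx d₁, ψ x * ∑ k ∈ signedIdx d₁, |fdiff h (l k) (u i) x|
        ≤ ∑ i ∈ signedIdx d₁, ∑ k ∈ signedIdx d₁,
          (|fdiff h (l k) (fun y => ψ y * u i y) x| + U * P) := by
          refine Finset.sum_le_sum fun i hi => ?_
          rw [Finset.mul_sum]
          exact Finset.sum_le_sum fun k hk => h1 i hi k hk
      _ = W + n ^ 2 * (U * P) := by
          simp only [Finset.sum_add_distrib, Finset.sum_const, nsmul_eq_mul, ← hn, ← hW]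
          ring
  rw [gen_mul_fun hh'.ne']
  have hψP : ψ x ≤ P := (le_abs_self _).trans (hψ.abs_le x)
  have h2 : ψ x * gen d₁ l h (rate a b h α x) (u j) x ≤ P * (2 * K * G + c₁ * U + c₂) :=
    (mul_le_mul_of_nonneg_left hu hx.le).trans (mul_le_mul_of_nonneg_right hψP (by positivity))
  have h3 : u j x * gen d₁ l h (rate a b h α x) ψ x ≤ U * (n * (2 * K * P)) := by
    refine (le_abs_self _).trans ?_
    rw [abs_mul]
    exact mul_le_mul (hU j hj) (H.abs_gen_le hh' α hψ x) (abs_nonneg _) hU0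
  have h4 : ∑ k ∈ signedIdx d₁, rate a b h α x k * (fdiff h (l k) ψ x * fdiff h (l k) (u j) x)
      ≤ 3 * K * P * G := by
    have h5 := Finset.single_le_sum (f := fun i => ∑ k ∈ signedIdx d₁, |fdiff h (l k) (u i) x|)
      (fun i _ => Finset.sum_nonneg fun _ _ => abs_nonneg _) hj
    refine le_trans ?_ (mul_le_mul_of_nonneg_left h5 (by positivity))
    rw [Finset.mul_sum]
    refine Finset.sum_le_sum fun k hk => ?_
    refine (le_abs_self _).trans ?_
    have h6 := H.rate_bounds hh α x hk
    have h7 := H.pos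
    rw [abs_mul, abs_mul, abs_of_nonneg (by linarith : 0 ≤ rate a b h α x k), ← mul_assoc]
    refine mul_le_mul_of_nonneg_right ?_ (abs_nonneg _)
    exact mul_le_mul h6.2 (hψ.abs_fdiff_le hh' (H.norm_le k hk) x) (abs_nonneg _) (by positivity)
  have h8 := mul_le_mul_of_nonneg_left hGW (by positivity : 0 ≤ 5 * K * P)
  linarith

-- The exponential sum is applied to `ψ Δ_k v / m` with compensator `gradSq`. Its squares of second
-- differences are at least `(m/2ψ)²` and match the loss `C₂/ψ²`. Twice differencing creates mixed
-- differences, which polarization bounds by pure ones within `4h`; at those points upper bounds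
-- follow from the lower ones through the equation.
set_option maxHeartbeats 1000000 in
theorem Admissible.exists_hessian_bound [Nonempty A] (H : Admissible d₁ l a b c f g δ K)
    (hψ : C11Bounds ψ P) (hP1 : 1 ≤ P) {d₀ : ℕ} (hΛ : SumClosed d₁ d₀ l) {N h₀ : ℝ} (hN : 0 ≤ N)
    (hgr : ∀ h, SmallStep δ K h → h ≤ h₀ → ∀ v,
      IsBddBorelSolution d₁ l a b c f g {x | 0 < ψ x} h v →
      ∀ k ∈ signedIdx d₁, ∀ x, |fdiff h (l k) v x| ≤ N) :
    ∃ N' : ℝ, 0 ≤ N' ∧ ∀ h, SmallStep δ K h → h ≤ h₀ → ∀ v,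
      IsBddBorelSolution d₁ l a b c f g {x | 0 < ψ x} h v →
      ∀ k ∈ signedIdx d₁, ∀ x, 0 < ψ x → ψ x * |sdiff h (l k) v x| ≤ N' := by
  have hδ := H.pos
  have hK := H.K_pos
  have hP : 0 < P := one_pos.trans_le hP1
  set n : ℝ := ((signedIdx d₁).card : ℝ) with hn
  have hn0 : 0 ≤ n := by positivity
  set N₀ := K / δ + K with hN₀
  have hN₀0 : 0 < N₀ := by positivity
  obtain ⟨C, hC, hgs⟩ := H.exists_gradSq_lower hN₀0.le hN
  set κ := 4 * Real.log (n + 2) with hκ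
  have hκ0 : 0 < κ := mul_pos (by norm_num) (Real.log_pos (by linarith))
  have hκn : n + 1 < Real.exp (κ / 4) := by
    rw [hκ, mul_div_cancel_left₀ _ (by norm_num : (4 : ℝ) ≠ 0), Real.exp_log (by positivity)]
    linarith
  -- If `ψ(x) > 10Ph`, then within `4h` of `x` one has `ψ ≥ ψ(x)/2` and remains in `Ω_h`.
  set R := 10 * P with hR
  have hR0 : 0 ≤ R := by positivity
  -- The first term serves the strip `ψ ≤ Rh`, where `|Δ_k v| ≤ 2N/h`; the second is the constant
  -- given by the equation.
  set Cu := 2 * R * N + (1 + (P * (K * N₀ + K + n * (K * N)) + n * K) / δ) with hCu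
  have hCu0 : 0 ≤ Cu := by positivity
  set c₁ := 21 * n * K + K with hc₁
  have hc₁0 : 0 ≤ c₁ := by positivity
  set c₂ := n * (K * N) + K * N₀ + 2 * (K * N) + K + 2 with hc₂
  have hc₂0 : 0 ≤ c₂ := by positivity
  set A₂ := 5 * K * P * (n ^ 2 * (2 * Cu * P)) + (P * c₁ + n * (2 * K * P)) * (2 * Cu) * P
    + P * c₂ * P ^ 2 with hA₂
  have hA₂0 : 0 ≤ A₂ := by positivity
  set A₁ := 5 * K * P + A₂ with hA₁
  have hA₁0 : 0 ≤ A₁ := by positivity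
  obtain ⟨C₂, hC₂, hexp⟩ := exists_exp_gen_lower d₁ l Cu hδ hκ0 hA₁0
  set μ := 8 * (C₂ + 3 * P ^ 2) / δ with hμ
  have hμ0 : 0 < μ := by positivity
  set Z := n * (4 * N ^ 2) with hZ
  have hZ0 : 0 ≤ Z := by positivity
  set M := 1 + μ * (C + Z) + 4 * R * N with hM
  have hM1 : 1 ≤ M := by
    have h1 : 0 ≤ μ * (C + Z) := by positivity
    have h2 : 0 ≤ 4 * R * N := by positivity
    linarith
  clear_value M Z μ A₁ A₂ c₁ c₂ Cu R κ N₀ n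
  refine ⟨Cu * M, by positivity, fun h hh hh0 v hv => ?_⟩
  have hh' := hh.pos
  have hvN : ∀ y, |v y| ≤ N₀ := hN₀ ▸ hv.abs_apply_le H hh
  have hvM := hgr h hh hh0 v hv
  have hoff : ∀ y, 0 < ψ y → ψ y ≤ R * h → ∀ k ∈ signedIdx d₁,
      |ψ y * sdiff h (l k) v y| ≤ 2 * R * N := by
    intro y hy0 hy k hk
    rw [abs_mul, abs_of_pos hy0]
    calc ψ y * |sdiff h (l k) v y| ≤ R * h * (2 * N / h) :=
          mul_le_mul hy (abs_sdiff_le_of_abs_fdiff_le hh' (hvM k hk) y) (abs_nonneg _) (by positivity)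
      _ = 2 * R * N := by field_simp
  have hupper : ∀ m, 1 ≤ m →
      (∀ y, 0 < ψ y → ∀ k ∈ signedIdx d₁, -(ψ y * sdiff h (l k) v y) ≤ m) →
      ∀ y, 0 < ψ y → ∀ k ∈ signedIdx d₁, ψ y * |sdiff h (l k) v y| ≤ Cu * m := by
    intro m hm hlow y hy k hk
    have hm0 : 0 ≤ m := by linarith
    have hf : 0 ≤ (1 + (P * (K * N₀ + K + n * (K * N)) + n * K) / δ) * m := by positivity
    have hf' : 0 ≤ 2 * R * N * m := by positivity
    by_cases hc : ψ y ≤ R * h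
    · have h1 := hoff y hy hc k hk
      rw [abs_mul, abs_of_pos hy] at h1
      have h2 : 2 * R * N ≤ 2 * R * N * m := le_mul_of_one_le_right (by positivity) hm
      rw [hCu, add_mul]
      linarith
    · have hyi : y ∈ innerSet {x | 0 < ψ x} h := hψ.mem_innerSet hh' (by
        rw [hR] at hc
        have : 0 < P * h := by positivity
        linarith)
      have h1 := hv.mul_abs_sdiff_le H hh' hvN hvM hyi hy.le
        ((le_abs_self _).trans (hψ.abs_le y)) hm (hlow y hy) hk
      rw [← hn] at h1
      rw [hCu, add_mul]
      linarith
  suffices hs : ∀ p : {x // 0 < ψ x} × {k // k ∈ signedIdx d₁},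
      -(ψ p.1 * sdiff h (l p.2) v p.1) ≤ M from
    fun k hk x hx => hupper M hM1 (fun y hy i hi => hs (⟨y, hy⟩, ⟨i, hi⟩)) x hx k hk
  by_contra! hcon
  obtain ⟨p₁, hp₁⟩ := hcon
  obtain ⟨⟨⟨x₀, hx₀⟩, j₀, hj₀⟩, hx₀M, hsup⟩ := exists_near_sup
    (fun p : {x // 0 < ψ x} × {k // k ∈ signedIdx d₁} => -(ψ p.1 * sdiff h (l p.2) v p.1))
    (C := P * (2 * N / h)) (fun p => by
      refine (neg_le_abs _).trans ?_
      rw [abs_mul]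
      exact mul_le_mul (hψ.abs_le _) (abs_sdiff_le_of_abs_fdiff_le hh' (hvM _ p.2.2) _)
        (abs_nonneg _) hP.le) (by linarith) hp₁
  simp only at hx₀M hsup
  set m := 4 / 3 * -(ψ x₀ * sdiff h (l j₀) v x₀) with hm
  have hMm : M ≤ m := by linarith
  have hm1 : 1 ≤ m := hM1.trans hMm
  have hm0 : 0 < m := by linarith
  have hlow : ∀ y, 0 < ψ y → ∀ k ∈ signedIdx d₁, -(ψ y * sdiff h (l k) v y) ≤ m :=
    fun y hy k hk => hsup (⟨y, hy⟩, ⟨k, hk⟩)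
  have hup := hupper m hm1 hlow
  have hmμ : μ * C ≤ m ^ 2 ∧ μ * Z ≤ m ^ 2 ∧ 2 * R * N ≤ m / 2 := by
    have h1 : 0 ≤ μ * C := by positivity
    have h2 : 0 ≤ μ * Z := by positivity
    have h3 : 0 ≤ 4 * R * N := by positivity
    have h4 : m ≤ m ^ 2 := by nlinarith
    refine ⟨?_, ?_, ?_⟩ <;> linarith
  clear_value m
  set w : ℤ → E d → ℝ := fun k y => m⁻¹ * (ψ y * sdiff h (l k) v y) with hw
  have hw1 : ∀ y, 0 < ψ y → ∀ k ∈ signedIdx d₁, -1 ≤ w k y := fun y hy k hk => by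
    simp only [hw]
    rw [le_inv_mul_iff₀ hm0]
    linarith [hlow y hy k hk]
  have hwC : ∀ y, 0 < ψ y → ∀ k ∈ signedIdx d₁, w k y ≤ Cu := fun y hy k hk => by
    simp only [hw]
    rw [inv_mul_le_iff₀ hm0]
    have h1 := mul_le_mul_of_nonneg_left (le_abs_self (sdiff h (l k) v y)) hy.le
    linarith [hup y hy k hk]
  have hPh : ∀ x η : E d, ‖η‖ ≤ 4 * h → R * h < ψ x → ψ x / 2 ≤ ψ (x + η) ∧ P * h < ψ (x + η) :=
    fun x η hη hx => by
      have h1 := (abs_le.1 (hψ.lip x η)).1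
      have h2 := mul_le_mul_of_nonneg_left hη hP.le
      have h3 : 0 < P * h := by positivity
      rw [hR] at hx
      constructor <;> linarith
  obtain ⟨x, hxD, ⟨j, hj, hwj⟩, hxr⟩ := H.exists_exp_near_max hh' hκ0 (hn ▸ hκn) w
    (fun y => μ / m ^ 2 * gradSq d₁ l h N v y) {y | R * h < ψ y}
    (fun y => mul_nonneg (by positivity) (gradSq_nonneg _ _))
    (fun y => by
      rw [div_mul_eq_mul_div, div_le_one (by positivity)]
      refine le_trans (mul_le_mul_of_nonneg_left ?_ hμ0.le) hmμ.2.1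
      rw [hZ, hn]
      exact gradSq_le fun k hk => hvM k hk y)
    (fun y hy k hk => hw1 y ((by positivity : 0 ≤ R * h).trans_lt hy) k hk) (x₀ := x₀) (j₀ := j₀)
    (by
      by_contra hc
      have := abs_le.1 (hoff x₀ hx₀ (not_lt.1 hc) j₀ hj₀)
      linarith) hj₀
    (by
      simp only [hw]
      rw [inv_mul_le_iff₀ hm0]
      linarith)
    (fun y hy k hk => by
      by_cases hc : R * h < ψ (y + h • l k)
      · exact .inl hc
      · right
        intro i hi
        have h1 := hPh y (h • l k) ((H.norm_smul_le hh' hk).trans (by linarith)) hy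
        have h2 := (abs_le.1 (hoff _ (by linarith [h1.2, mul_pos hP hh']) (not_lt.1 hc) i hi)).1
        simp only [hw]
        rw [le_inv_mul_iff₀ hm0]
        linarith)
  have hxR : R * h < ψ x := hxD
  have hx0 : 0 < ψ x := (by positivity : 0 ≤ R * h).trans_lt hxR
  have hin : ∀ η : E d, ‖η‖ ≤ 4 * h → x + η ∈ innerSet {x | 0 < ψ x} h := fun η hη =>
    hψ.mem_innerSet hh' (hPh x η hη hxR).2
  have hlk : ∀ k ∈ signedIdx d₁, ‖h • l k‖ ≤ 4 * h := fun k hk =>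
    (H.norm_smul_le hh' hk).trans (by linarith)
  have hxi : x ∈ innerSet {x | 0 < ψ x} h := by
    simpa using hin 0 (by rw [norm_zero]; linarith)
  obtain ⟨α, hα⟩ := hv.exists_abs_gen_le H hh' hxi (pow_pos hh' 2)
  have hα' : |gen d₁ l h (rate a b h α x) v x - c α x * v x + f α x| ≤ h :=
    hα.trans (by have := hh.le_one; nlinarith)
  set s := (ψ x)⁻¹ with hs
  have hs0 : 0 < s := inv_pos.2 hx0
  -- This turns constants into multiples of `s²`, so that every term has the same homogeneity.
  have hsP : 1 ≤ P * s := by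
    rw [hs, ← div_eq_mul_inv, one_le_div hx0]
    exact (le_abs_self _).trans (hψ.abs_le x)
  set U := 2 * Cu * m * s with hU
  have hUb : ∀ k ∈ signedIdx d₁, ∀ η : E d, ‖η‖ ≤ 4 * h → |sdiff h (l k) v (x + η)| ≤ U := by
    intro k hk η hη
    have h1 := hPh x η hη hxR
    have h2 := hup (x + η) (by linarith) k hk
    have h3 := mul_le_mul_of_nonneg_right h1.1 (abs_nonneg (sdiff h (l k) v (x + η)))
    rw [hU, hs, ← div_eq_mul_inv, le_div_iff₀ hx0]
    linarith
  have hUx : ∀ k ∈ signedIdx d₁, |sdiff h (l k) v x| ≤ U := fun k hk => by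
    simpa using hUb k hk 0 (by rw [norm_zero]; linarith)
  have hUU : ∀ i ∈ signedIdx d₁, ∀ k ∈ signedIdx d₁,
      |fdiff h (l i) (fdiff h (l k) v) x| ≤ 10 * U := fun i hi k hk =>
    hΛ.abs_fdiff_fdiff_le hh' H.norm_le (fun p hp y hy => by
      have := hUb p hp (y - x) hy
      rwa [add_sub_cancel] at this) hi hk
  have hr := H.rate_mem hh α x
  have h1 := hxr _ hr
  rw [gen_add_fun, gen_const_mul_fun] at h1
  set W := ∑ i ∈ signedIdx d₁, ∑ k ∈ signedIdx d₁,
    |fdiff h (l k) (fun y => ψ y * sdiff h (l i) v y) x| with hW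
  have hWw : ∑ i ∈ signedIdx d₁, ∑ k ∈ signedIdx d₁, |fdiff h (l k) (w i) x| = m⁻¹ * W := by
    rw [hW]
    simp only [Finset.mul_sum]
    refine Finset.sum_congr rfl fun i _ => Finset.sum_congr rfl fun k _ => ?_
    have e : |m⁻¹| = m⁻¹ := abs_of_pos (inv_pos.2 hm0)
    conv_rhs => rw [← e, ← abs_mul]
    congr 1
    simp only [hw, fdiff]
    ring
  have hW0 : 0 ≤ W := Finset.sum_nonneg fun _ _ => Finset.sum_nonneg fun _ _ => abs_nonneg _
  have h2 := hexp h hh' (rate a b h α x) w x s hs0.le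
    (fun k hk => (H.rate_bounds hh α x hk).1) (hw1 x hx0) (hwC x hx0)
    (fun i hi k hk => hwC _ (by
      have := hPh x (h • l k) (hlk k hk) hxR
      linarith) i hi)
    (fun i hi => by
      have h3 := hv.gen_sdiff_le_of_bound H hh hvN hvM hUx hUU hi (hin _ (hlk i hi))
        (by rw [sub_eq_add_neg]; exact hin _ (by rw [norm_neg]; exact hlk i hi)) hα
      rw [← hn, ← hc₁, ← hc₂] at h3
      have h4 := H.gen_weight_le hh hψ hP.le (u := fun k => sdiff h (l k) v) hx0 hc₁0 hc₂0 hUx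
        (fun p hp k hk => hUb p hp _ (hlk k hk)) α hi h3
      rw [← hn, ← hs, ← hW] at h4
      rw [hWw]
      simp only [hw]
      rw [gen_const_mul_fun, inv_mul_le_iff₀ hm0]
      refine h4.trans ?_
      have e1 : m * (A₁ * s * (m⁻¹ * W + s)) = A₁ * s * W + A₁ * (s ^ 2 * m) := by
        field_simp
      have e2 : 5 * K * P * (s * (W + n ^ 2 * (U * P)))
          = 5 * K * P * s * W + 5 * K * P * (n ^ 2 * (2 * Cu * P)) * (s ^ 2 * m) := by
        rw [hU]; ring
      have e3 : (P * c₁ + n * (2 * K * P)) * U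
          ≤ (P * c₁ + n * (2 * K * P)) * (2 * Cu) * P * (s ^ 2 * m) := by
        calc _ = (P * c₁ + n * (2 * K * P)) * (2 * Cu) * (m * s) * 1 := by rw [hU]; ring
          _ ≤ (P * c₁ + n * (2 * K * P)) * (2 * Cu) * (m * s) * (P * s) :=
              mul_le_mul_of_nonneg_left hsP (by positivity)
          _ = _ := by ring
      have e4 : P * c₂ ≤ P * c₂ * P ^ 2 * (s ^ 2 * m) := by
        have h5 : 1 ≤ (P * s) ^ 2 * m :=
          one_le_mul_of_one_le_of_one_le (one_le_pow₀ hsP) hm1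
        calc P * c₂ = P * c₂ * 1 := (mul_one _).symm
          _ ≤ P * c₂ * ((P * s) ^ 2 * m) := mul_le_mul_of_nonneg_left h5 (by positivity)
          _ = _ := by ring
      have e5 : A₂ * (s ^ 2 * m) = 5 * K * P * (n ^ 2 * (2 * Cu * P)) * (s ^ 2 * m)
          + (P * c₁ + n * (2 * K * P)) * (2 * Cu) * P * (s ^ 2 * m)
          + P * c₂ * P ^ 2 * (s ^ 2 * m) := by rw [hA₂]; ring
      have e6 : 5 * K * P * s * W ≤ A₁ * s * W := by
        have : 5 * K * P ≤ A₁ := by rw [hA₁]; exact le_add_of_nonneg_right hA₂0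
        exact mul_le_mul_of_nonneg_right (mul_le_mul_of_nonneg_right this hs0.le) hW0
      have e7 : A₂ * (s ^ 2 * m) ≤ A₁ * (s ^ 2 * m) := by
        have h5 : A₂ ≤ A₁ := by
          rw [hA₁]
          exact le_add_of_nonneg_left (by positivity)
        exact mul_le_mul_of_nonneg_right h5 (by positivity)
      rw [e1, e2]
      linarith only [e3, e4, e5, e6, e7])
  have h3 := hgs h hh _ v hv hvN hvM x (fun k hk => hin _ (hlk k hk)) α hα'
  have h4 : m ^ 2 * s ^ 2 / 4 ≤ hessSq d₁ l h v x := by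
    have h5 : sdiff h (l j) v x ^ 2 ≤ hessSq d₁ l h v x := by
      rw [sdiff_eq_neg_fdiff_fdiff hh'.ne', neg_sq, ← H.neg j hj]
      refine le_trans ?_ (Finset.single_le_sum
        (f := fun i => ∑ k ∈ signedIdx d₁, fdiff h (l k) (fdiff h (l i) v) x ^ 2)
        (fun i _ => Finset.sum_nonneg fun _ _ => sq_nonneg _) hj)
      exact Finset.single_le_sum (f := fun k => fdiff h (l k) (fdiff h (l j) v) x ^ 2)
        (fun _ _ => sq_nonneg _) (neg_mem_signedIdx hj)
    refine le_trans ?_ h5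
    simp only [hw] at hwj
    rw [inv_mul_le_iff₀ hm0] at hwj
    have h6 : m * s / 2 ≤ -sdiff h (l j) v x := by
      rw [hs, ← div_eq_mul_inv, div_div, div_le_iff₀ (by positivity)]
      linarith
    have h7 : (m * s / 2) ^ 2 ≤ (-sdiff h (l j) v x) ^ 2 := pow_le_pow_left₀ (by positivity) h6 2
    rw [neg_sq] at h7
    linarith
  have h5 : μ / m ^ 2 * (δ / 2 * (m ^ 2 * s ^ 2 / 4) - C)
      ≤ μ / m ^ 2 * gen d₁ l h (rate a b h α x) (gradSq d₁ l h N v) x := by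
    refine mul_le_mul_of_nonneg_left ?_ (by positivity)
    have := mul_le_mul_of_nonneg_left h4 (half_pos hδ).le
    linarith
  have h6 : μ / m ^ 2 * (δ / 2 * (m ^ 2 * s ^ 2 / 4) - C)
      = (C₂ + 3 * P ^ 2) * s ^ 2 - μ * C / m ^ 2 := by
    rw [hμ]; field_simp; ring
  have h7 : μ * C / m ^ 2 ≤ 1 := (div_le_one (by positivity)).2 hmμ.1
  have h8 : 1 ≤ (P * s) ^ 2 := one_le_pow₀ hsP
  have h9 : (C₂ + 3 * P ^ 2) * s ^ 2 = C₂ * s ^ 2 + 3 * (P * s) ^ 2 := by ring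
  linarith only [h1, h2, h5, h6, h7, h8, h9]

end Hessian

/-! ### Existence of a Borel solution. -/

section Existence

variable {l : ℤ → E d} {a b : A → ℤ → E d → ℝ} {c f : A → E d → ℝ} {g : E d → ℝ} {δ K h : ℝ}
  {Ω : Set (E d)} {u v : E d → ℝ}

theorem C11Bounds.continuous {φ : E d → ℝ} {P : ℝ} (hφ : C11Bounds φ P) : Continuous φ := by
  refine (LipschitzWith.of_dist_le_mul (K := P.toNNReal) fun x y => ?_).continuous
  rw [Real.coe_toNNReal _ hφ.nonneg, Real.dist_eq, dist_eq_norm]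
  exact hφ.abs_sub_le x y

/-- `Ω_h` is the complement of the closed `h`-thickening of `Ωᶜ`, a union of closed balls because
distances to a closed set are attained. -/
theorem isOpen_innerSet (hΩ : IsOpen Ω) (hh : 0 < h) : IsOpen (innerSet Ω h) := by
  have e : innerSet Ω h = (Metric.cthickening h Ωᶜ)ᶜ := by
    ext x
    rw [hΩ.isClosed_compl.cthickening_eq_biUnion_closedBall hh.le]
    simp only [innerSet, Set.mem_ofPred_eq, Set.mem_compl_iff, Set.mem_iUnion, not_exists,
      Metric.mem_closedBall, dist_eq_norm]
    constructor
    · rintro ⟨-, hx⟩ y hy hxy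
      refine hy ?_
      have h1 := hx (h⁻¹ • (y - x)) (by
        rw [sub_zero, norm_smul, Real.norm_of_nonneg (inv_pos.2 hh).le, inv_mul_le_iff₀ hh, mul_one,
          norm_sub_rev]
        exact hxy)
      rwa [smul_smul, mul_inv_cancel₀ hh.ne', one_smul, add_sub_cancel] at h1
    · intro hx
      have key : ∀ z : E d, ‖z‖ ≤ 1 → x + h • z ∈ Ω := fun z hz => by
        by_contra hc
        refine hx _ hc ?_
        rw [sub_add_cancel_left, norm_neg, norm_smul, Real.norm_of_nonneg hh.le]
        exact mul_le_of_le_one_right hh.le hz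
      refine ⟨by simpa using key 0 (by simp), fun z hz => key z (by simpa using hz)⟩
  rw [e]
  exact Metric.isClosed_cthickening.isOpen_compl

/-- The relaxed operator, whose supremum over `α` is the fixed point map. -/
def relaxed (d₁ : ℕ) (l : ℤ → E d) (a b : A → ℤ → E d → ℝ) (c f : A → E d → ℝ) (h Q : ℝ) (α : A)
    (u : E d → ℝ) (x : E d) : ℝ :=
  gen d₁ l h (rate a b h α x) u x - c α x * u x + f α x + Q * u x

/-- A relaxation parameter making the relaxed operator monotone. -/
def relaxParam (d₁ : ℕ) (K h : ℝ) : ℝ := (signedIdx d₁).card * (3 * K) / h ^ 2 + K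

theorem Admissible.relaxParam_ge (H : Admissible d₁ l a b c f g δ K) (h : ℝ) :
    K ≤ relaxParam d₁ K h := by
  have := H.K_pos
  exact le_add_of_nonneg_left (by positivity)

/-- The relaxation parameter makes all coefficients nonnegative, and they add up to `Q - c ≤ Q - δ`.
-/
theorem Admissible.abs_relaxed_sub_le (H : Admissible d₁ l a b c f g δ K) (hh : SmallStep δ K h)
    {M : ℝ} (hM : ∀ y, |u y - v y| ≤ M) (α : A) (x : E d) :
    |relaxed d₁ l a b c f h (relaxParam d₁ K h) α u x
      - relaxed d₁ l a b c f h (relaxParam d₁ K h) α v x| ≤ (relaxParam d₁ K h - δ) * M := by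
  have hh' := hh.pos
  have hM0 : 0 ≤ M := (abs_nonneg _).trans (hM x)
  set Q := relaxParam d₁ K h with hQ
  set ρ := ∑ k ∈ signedIdx d₁, rate a b h α x k / h ^ 2 with hρ
  have e : relaxed d₁ l a b c f h Q α u x - relaxed d₁ l a b c f h Q α v x
      = ∑ k ∈ signedIdx d₁, rate a b h α x k / h ^ 2 * (u (x + h • l k) - v (x + h • l k))
        + (Q - ρ - c α x) * (u x - v x) := by
    have e1 : ∀ w : E d → ℝ, gen d₁ l h (rate a b h α x) w x
        = ∑ k ∈ signedIdx d₁, rate a b h α x k / h ^ 2 * w (x + h • l k) - ρ * w x := fun w => by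
      rw [hρ, Finset.sum_mul, ← Finset.sum_sub_distrib, gen]
      exact Finset.sum_congr rfl fun k _ => by ring
    simp only [relaxed, e1, mul_sub, Finset.sum_sub_distrib]
    ring
  have hρQ : ρ ≤ Q - K := by
    rw [hQ, relaxParam, add_sub_cancel_right, mul_div_assoc, ← nsmul_eq_mul]
    refine Finset.sum_le_card_nsmul _ _ _ fun k hk => ?_
    exact div_le_div_of_nonneg_right (H.rate_bounds hh α x hk).2 (by positivity)
  have hc := (abs_le.1 ((H.c_reg α).abs_le x)).2
  have h1 : |∑ k ∈ signedIdx d₁, rate a b h α x k / h ^ 2 * (u (x + h • l k) - v (x + h • l k))|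
      ≤ ρ * M := by
    rw [hρ, Finset.sum_mul]
    refine (Finset.abs_sum_le_sum_abs _ _).trans (Finset.sum_le_sum fun k hk => ?_)
    have h2 : 0 ≤ rate a b h α x k / h ^ 2 :=
      div_nonneg (H.rate_mem hh α x k hk).1 (by positivity)
    rw [abs_mul, abs_of_nonneg h2]
    exact mul_le_mul_of_nonneg_left (hM _) h2
  have h2 : |(Q - ρ - c α x) * (u x - v x)| ≤ (Q - ρ - c α x) * M := by
    rw [abs_mul, abs_of_nonneg (by linarith : 0 ≤ Q - ρ - c α x)]
    exact mul_le_mul_of_nonneg_left (hM x) (by linarith)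
  rw [e]
  refine (abs_add_le _ _).trans ((add_le_add h1 h2).trans ?_)
  have h3 := mul_le_mul_of_nonneg_right (H.c_lower α x) hM0
  linarith

theorem Admissible.abs_relaxed_le (H : Admissible d₁ l a b c f g δ K) (hh : SmallStep δ K h)
    {M : ℝ} (hM : ∀ y, |u y| ≤ M) (α : A) (x : E d) :
    |relaxed d₁ l a b c f h (relaxParam d₁ K h) α u x| ≤ (relaxParam d₁ K h - δ) * M + K := by
  have h1 := H.abs_relaxed_sub_le hh (u := u) (v := fun _ => 0) (by simpa using hM) α x
  have e : relaxed d₁ l a b c f h (relaxParam d₁ K h) α (fun _ => 0) x = f α x := by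
    simp [relaxed, gen]
  rw [e] at h1
  have h2 := (H.f_reg α).abs_le x
  calc _ = |(relaxed d₁ l a b c f h (relaxParam d₁ K h) α u x - f α x) + f α x| := by
        rw [sub_add_cancel]
    _ ≤ _ := (abs_add_le _ _).trans (add_le_add h1 h2)

theorem Admissible.bddAbove_relaxed (H : Admissible d₁ l a b c f g δ K) (hh : SmallStep δ K h)
    {M : ℝ} (hM : ∀ y, |u y| ≤ M) (x : E d) :
    BddAbove (Set.range fun α => relaxed d₁ l a b c f h (relaxParam d₁ K h) α u x) :=
  ⟨_, by rintro _ ⟨α, rfl⟩; exact (abs_le.1 (H.abs_relaxed_le hh hM α x)).2⟩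

open Classical in
/-- The fixed point map of the scheme. -/
def schemeMap (d₁ : ℕ) (l : ℤ → E d) (a b : A → ℤ → E d → ℝ) (c f : A → E d → ℝ) (g : E d → ℝ)
    (Ω : Set (E d)) (K h : ℝ) (u : E d → ℝ) (x : E d) : ℝ :=
  if x ∈ innerSet Ω h then
    (⨆ α, relaxed d₁ l a b c f h (relaxParam d₁ K h) α u x) / relaxParam d₁ K h
  else g x

/-- The set of controls may be uncountable. The supremum is therefore written as a lower
semicontinuous function of the point and the values of `u` at it and its neighbours, composed with a
Borel map. -/
theorem Admissible.measurable_iSup_relaxed (H : Admissible d₁ l a b c f g δ K)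
    (hh : SmallStep δ K h) [Nonempty A] (hu : Measurable u) :
    Measurable fun x => ⨆ α, relaxed d₁ l a b c f h (relaxParam d₁ K h) α u x := by
  set Q := relaxParam d₁ K h with hQ
  have hK := H.K_pos
  have hQ0 : 0 < Q := hK.trans_le (H.relaxParam_ge h)
  set Φ : A → E d × (ℤ → ℝ) × ℝ → ℝ := fun α p =>
    ∑ k ∈ signedIdx d₁, rate a b h α p.1 k * (p.2.1 k - p.2.2) / h ^ 2 - c α p.1 * p.2.2 + f α p.1
      + Q * p.2.2 with hΦ
  have hΦc : ∀ α, Continuous (Φ α) := fun α => by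
    have h1 : ∀ k ∈ signedIdx d₁, Continuous fun p : E d × (ℤ → ℝ) × ℝ =>
        rate a b h α p.1 k * (p.2.1 k - p.2.2) / h ^ 2 := fun k hk => by
      have := (H.a_reg α k hk).continuous
      have := (H.b_reg α k hk).continuous
      simp only [rate]
      fun_prop
    have h2 := (H.c_reg α).continuous
    have h3 := (H.f_reg α).continuous
    have h4 := continuous_finsetSum (signedIdx d₁) h1
    simp only [hΦ]
    fun_prop
  have hbdd : ∀ p, BddAbove (Set.range fun α => Φ α p) := fun p => by
    refine ⟨∑ k ∈ signedIdx d₁, 3 * K * |p.2.1 k - p.2.2| / h ^ 2 + K * |p.2.2| + K + Q * |p.2.2|, ?_⟩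
    rintro _ ⟨α, rfl⟩
    simp only [hΦ]
    have h1 : ∑ k ∈ signedIdx d₁, rate a b h α p.1 k * (p.2.1 k - p.2.2) / h ^ 2
        ≤ ∑ k ∈ signedIdx d₁, 3 * K * |p.2.1 k - p.2.2| / h ^ 2 := by
      refine Finset.sum_le_sum fun k hk => div_le_div_of_nonneg_right ?_ (by positivity)
      calc _ ≤ rate a b h α p.1 k * |p.2.1 k - p.2.2| :=
            mul_le_mul_of_nonneg_left (le_abs_self _) (H.rate_mem hh α _ k hk).1
        _ ≤ _ := mul_le_mul_of_nonneg_right (H.rate_bounds hh α _ hk).2 (abs_nonneg _)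
    have h2 : |c α p.1 * p.2.2| ≤ K * |p.2.2| := by
      rw [abs_mul]
      exact mul_le_mul_of_nonneg_right ((H.c_reg α).abs_le _) (abs_nonneg _)
    have h3 := (abs_le.1 h2).1
    have h4 := (abs_le.1 ((H.f_reg α).abs_le p.1)).2
    have h5 := mul_le_mul_of_nonneg_left (le_abs_self p.2.2) hQ0.le
    linarith
  have hlsc : LowerSemicontinuous fun p => ⨆ α, Φ α p :=
    lowerSemicontinuous_ciSup hbdd fun α => (hΦc α).lowerSemicontinuous
  have hp : Measurable fun x : E d => (x, (fun k : ℤ => u (x + h • l k)), u x) := by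
    refine measurable_id.prodMk (Measurable.prodMk ?_ hu)
    exact measurable_pi_lambda _ fun k => hu.comp (measurable_add_const _)
  have e : (fun x => ⨆ α, relaxed d₁ l a b c f h Q α u x)
      = (fun p => ⨆ α, Φ α p) ∘ fun x : E d => (x, (fun k : ℤ => u (x + h • l k)), u x) := by
    funext x
    simp only [Function.comp_apply, hΦ, relaxed, gen]
  rw [e]
  have hm : Measurable fun p => ⨆ α, Φ α p := hlsc.measurable
  exact hm.comp hp

/-- Iterating the contraction from `g` gives geometric uniform convergence, so the limit is bounded,
Borel and a fixed point. Being fixed means that the supremum of the relaxed operators equals `Qv`,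
which is the Bellman equation. -/
theorem Admissible.exists_solution (H : Admissible d₁ l a b c f g δ K) (hh : SmallStep δ K h)
    [Nonempty A] (hΩ : IsOpen Ω) : ∃ v, IsBddBorelSolution d₁ l a b c f g Ω h v := by
  classical
  have hδ := H.pos
  have hK := H.K_pos
  set Q := relaxParam d₁ K h with hQ
  have hQK : K ≤ Q := H.relaxParam_ge h
  have hQ0 : 0 < Q := hK.trans_le hQK
  set θ := (Q - δ) / Q with hθ
  have hθ0 : 0 ≤ θ := div_nonneg (by linarith [H.le]) hQ0.le
  have hθ1 : θ < 1 := (div_lt_one hQ0).2 (by linarith)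
  set T := schemeMap d₁ l a b c f g Ω K h with hT
  have hTin : ∀ u x, x ∈ innerSet Ω h →
      T u x = (⨆ α, relaxed d₁ l a b c f h Q α u x) / Q := fun u x hx => if_pos hx
  have hTout : ∀ u x, x ∉ innerSet Ω h → T u x = g x := fun u x hx => if_neg hx
  have hTc : ∀ u w : E d → ℝ, ∀ M M' : ℝ, (∀ y, |u y| ≤ M') → (∀ y, |w y| ≤ M') →
      (∀ y, |u y - w y| ≤ M) → ∀ x, |T u x - T w x| ≤ θ * M := by
    intro u w M M' hu hw hM x
    have hM0 : 0 ≤ M := (abs_nonneg _).trans (hM x)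
    by_cases hx : x ∈ innerSet Ω h
    · rw [hTin _ _ hx, hTin _ _ hx, ← sub_div, abs_div, abs_of_pos hQ0, hθ, div_mul_eq_mul_div]
      refine div_le_div_of_nonneg_right ?_ hQ0.le
      have key : ∀ u w : E d → ℝ, (∀ y, |w y| ≤ M') → (∀ y, |u y - w y| ≤ M) →
          (⨆ α, relaxed d₁ l a b c f h Q α u x) ≤ (⨆ α, relaxed d₁ l a b c f h Q α w x)
            + (Q - δ) * M := by
        intro u w hw hM
        refine ciSup_le fun α => ?_
        have h1 := (abs_le.1 (H.abs_relaxed_sub_le hh hM α x)).2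
        have h2 := le_ciSup (H.bddAbove_relaxed hh hw x) α
        linarith
      have h1 := key u w hw hM
      have h2 := key w u hu fun y => by rw [abs_sub_comm]; exact hM y
      exact abs_le.2 ⟨by linarith, by linarith⟩
    · rw [hTout _ _ hx, hTout _ _ hx, sub_self, abs_zero]
      positivity
  have hTb : ∀ u : E d → ℝ, ∀ M : ℝ, (∀ y, |u y| ≤ M) → ∀ x, |T u x| ≤ M + K / Q + K := by
    intro u M hu x
    have hM0 : 0 ≤ M := (abs_nonneg _).trans (hu x)
    have hKQ : 0 ≤ K / Q := by positivity
    by_cases hx : x ∈ innerSet Ω h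
    · rw [hTin _ _ hx, abs_div, abs_of_pos hQ0, div_le_iff₀ hQ0]
      have h1 : ∀ α, |relaxed d₁ l a b c f h Q α u x| ≤ (Q - δ) * M + K :=
        fun α => H.abs_relaxed_le hh hu α x
      have h2 : |⨆ α, relaxed d₁ l a b c f h Q α u x| ≤ (Q - δ) * M + K := by
        refine abs_le.2 ⟨?_, ciSup_le fun α => (abs_le.1 (h1 α)).2⟩
        exact (abs_le.1 (h1 (Classical.arbitrary A))).1.trans
          (le_ciSup (H.bddAbove_relaxed hh hu x) _)
      refine h2.trans ?_
      have e : (M + K / Q + K) * Q = Q * M + K + K * Q := by field_simp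
      rw [e]
      have : 0 ≤ δ * M := by positivity
      have : 0 ≤ K * Q := by positivity
      linarith
    · rw [hTout _ _ hx]
      linarith [H.g_reg.abs_le x]
  have hTm : ∀ u, Measurable u → Measurable (T u) := fun u hu => by
    have h1 : Measurable fun x => (⨆ α, relaxed d₁ l a b c f h Q α u x) / Q :=
      (H.measurable_iSup_relaxed hh hu).div_const Q
    exact Measurable.ite (isOpen_innerSet hΩ hh.pos).measurableSet h1 H.g_reg.continuous.measurable
  set V : ℕ → E d → ℝ := fun i => T^[i] g with hV
  have hVs : ∀ i, V (i + 1) = T (V i) := fun i => Function.iterate_succ_apply' T i g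
  have hVb : ∀ i, ∃ M, ∀ y, |V i y| ≤ M := by
    intro i
    induction i with
    | zero => exact ⟨K, H.g_reg.abs_le⟩
    | succ i ih =>
      obtain ⟨M, hM⟩ := ih
      exact ⟨_, by rw [hVs]; exact hTb _ M hM⟩
  have hVm : ∀ i, Measurable (V i) := by
    intro i
    induction i with
    | zero => exact H.g_reg.continuous.measurable
    | succ i ih => rw [hVs]; exact hTm _ ih
  have hTc' : ∀ u w : E d → ℝ, ∀ M : ℝ, (∃ M, ∀ y, |u y| ≤ M) → (∃ M, ∀ y, |w y| ≤ M) →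
      (∀ y, |u y - w y| ≤ M) → ∀ x, |T u x - T w x| ≤ θ * M := by
    rintro u w M ⟨M₁, h₁⟩ ⟨M₂, h₂⟩ hM
    exact hTc u w M (max M₁ M₂) (fun y => (h₁ y).trans (le_max_left _ _))
      (fun y => (h₂ y).trans (le_max_right _ _)) hM
  set D := K + K / Q + K + K with hD
  have hVd : ∀ i x, |V i x - V (i + 1) x| ≤ D * θ ^ i := by
    intro i
    induction i with
    | zero =>
      intro x
      have h1 := hTb g K H.g_reg.abs_le x
      rw [pow_zero, mul_one, hVs]
      refine (abs_sub _ _).trans ?_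
      have h2 := H.g_reg.abs_le x
      change |g x| + |T g x| ≤ D
      linarith
    | succ i ih =>
      intro x
      rw [hVs i, hVs (i + 1), pow_succ, ← mul_assoc, mul_comm (D * θ ^ i)]
      exact hTc' _ _ _ (hVb i) (hVb (i + 1)) ih x
  have hdist : ∀ x i, dist (V i x) (V (i + 1) x) ≤ D * θ ^ i := fun x i => by
    rw [Real.dist_eq]; exact hVd i x
  choose v hv using fun x => cauchySeq_tendsto_of_complete
    (cauchySeq_of_le_geometric θ D hθ1 (hdist x))
  have hVv : ∀ i x, |V i x - v x| ≤ D * θ ^ i / (1 - θ) := fun i x => by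
    rw [← Real.dist_eq]
    exact dist_le_of_le_geometric_of_tendsto θ D hθ1 (hdist x) (hv x) i
  have hvm : Measurable v := measurable_of_tendsto_metrizable hVm (tendsto_pi_nhds.2 hv)
  have hvb : ∃ M, ∀ x, |v x| ≤ M := by
    refine ⟨K + D * θ ^ 0 / (1 - θ), fun x => ?_⟩
    have h1 := hVv 0 x
    have h2 := H.g_reg.abs_le x
    have h3 : |V 0 x| ≤ K := h2
    have h4 := abs_sub_abs_le_abs_sub (v x) (V 0 x)
    rw [abs_sub_comm] at h4
    linarith
  have hfix : ∀ x, T v x = v x := by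
    intro x
    have h1 : Filter.Tendsto (fun i => θ * (D * θ ^ i / (1 - θ))) Filter.atTop (nhds 0) := by
      have h2 := (tendsto_pow_atTop_nhds_zero_of_lt_one hθ0 hθ1).const_mul (θ * D / (1 - θ))
      rw [mul_zero] at h2
      exact h2.congr fun i => by ring
    have h3 : Filter.Tendsto (fun i => V (i + 1) x) Filter.atTop (nhds (T v x)) := by
      rw [tendsto_iff_dist_tendsto_zero]
      refine squeeze_zero (fun _ => dist_nonneg) (fun i => ?_) h1
      rw [Real.dist_eq, hVs]
      exact hTc' _ _ _ (hVb i) hvb (hVv i) x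
    exact tendsto_nhds_unique h3 ((Filter.tendsto_add_atTop_iff_nat 1).2 (hv x))
  obtain ⟨M, hM⟩ := hvb
  refine ⟨v, hvm, ⟨M, hM⟩, fun x hx => ?_, fun x hx => ?_⟩
  · have h1 := hfix x
    rw [hTin _ _ hx, div_eq_iff hQ0.ne'] at h1
    have hb := H.bddAbove_relaxed hh hM x
    unfold SchemeAt
    simp only [H.scheme_eq_gen hh.pos]
    constructor
    · rintro _ ⟨α, rfl⟩
      have h2 := le_ciSup hb α
      rw [← hQ, h1] at h2
      simp only [relaxed] at h2 ⊢
      linarith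
    · intro t ht
      have h2 : (⨆ α, relaxed d₁ l a b c f h Q α v x) ≤ t + Q * v x := by
        refine ciSup_le fun α => ?_
        have h3 := ht ⟨α, rfl⟩
        simp only [relaxed] at h3 ⊢
        linarith
      rw [h1] at h2
      linarith
  · rw [← hfix x]
    exact hTout v x hx

end Existence

/-! ### The defining function and the distance to the boundary. -/

section Geometry

/-- For the second difference, apply the mean value inequality to `z ↦ φ(z + y) - φ(z)` between `x -
y` and `x`. -/
theorem C11Bounds.of_fderiv {φ : E d → ℝ} {K : ℝ} (hφ : Differentiable ℝ φ) (h0 : ∀ x, |φ x| ≤ K)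
    (h1 : ∀ x, ‖fderiv ℝ φ x‖ ≤ K) (h2 : ∀ x y, ‖fderiv ℝ φ x - fderiv ℝ φ y‖ ≤ K * ‖x - y‖) :
    C11Bounds φ K := by
  refine ⟨h0, fun x y => ?_, fun x y => ?_⟩
  · have h3 := convex_univ.norm_image_sub_le_of_norm_fderiv_le (𝕜 := ℝ) (f := φ)
      (fun z _ => hφ z) (fun z _ => h1 z) (Set.mem_univ x) (Set.mem_univ (x + y))
    rwa [add_sub_cancel_left, Real.norm_eq_abs] at h3
  · have hd : ∀ z, HasFDerivAt (fun z => φ (z + y) - φ z)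
        (fderiv ℝ φ (z + y) - fderiv ℝ φ z) z := fun z => by
      have h4 : HasFDerivAt (fun z => φ (z + y)) (fderiv ℝ φ (z + y)) z :=
        (hasFDerivAt_comp_add_right y).2 (hφ (z + y)).hasFDerivAt
      exact h4.sub (hφ z).hasFDerivAt
    have h3 := convex_univ.norm_image_sub_le_of_norm_hasFDerivWithin_le (𝕜 := ℝ)
      (f := fun z => φ (z + y) - φ z) (fun z _ => (hd z).hasFDerivWithinAt) (C := K * ‖y‖)
      (fun z _ => by simpa using h2 (z + y) z) (Set.mem_univ (x - y)) (Set.mem_univ x)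
    rw [sub_sub_cancel, Real.norm_eq_abs, sub_add_cancel] at h3
    refine le_trans (le_of_eq ?_) (h3.trans_eq (by ring))
    congr 1
    ring

theorem C11Le.bounds {φ : E d → ℝ} {K : ℝ} (hK : 0 ≤ K) (hφ : C11Le φ K) : C11Bounds φ K := by
  obtain ⟨hd, hn⟩ := hφ
  unfold c11Norm at hn
  have hof : ∀ {F : Type} [NormedAddCommGroup F] (z : F), ‖z‖ₑ ≤ ENNReal.ofReal K → ‖z‖ ≤ K :=
    fun z hz => by
      rw [← ofReal_norm] at hz
      exact (ENNReal.ofReal_le_ofReal_iff hK).1 hz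
  refine C11Bounds.of_fderiv hd (fun x => ?_) (fun x => ?_) (fun x y => ?_)
  · exact hof _ (((le_iSup (fun x => ‖φ x‖ₑ) x).trans (le_self_add.trans le_self_add)).trans hn)
  · exact hof _ (((le_iSup (fun x => ‖fderiv ℝ φ x‖ₑ) x).trans (le_add_self.trans le_self_add)).trans hn)
  · by_cases hxy : x = y
    · simp [hxy]
    · have h1 : ‖fderiv ℝ φ x - fderiv ℝ φ y‖ₑ / edist x y ≤ ENNReal.ofReal K := by
        refine le_trans ?_ (le_add_self.trans hn)
        exact le_iSup₂_of_le (f := fun (x y : E d) => ⨆ (_ : x ≠ y),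
          ‖fderiv ℝ φ x - fderiv ℝ φ y‖ₑ / edist x y) x y (le_iSup_of_le hxy le_rfl)
      rw [ENNReal.div_le_iff (by simpa [edist_eq_zero] using hxy) (edist_ne_top x y), edist_dist,
        ← ENNReal.ofReal_mul hK, ← ofReal_norm,
        ENNReal.ofReal_le_ofReal_iff (by positivity), dist_eq_norm] at h1
      exact h1

theorem abs_taylor_le {φ : E d → ℝ} {K : ℝ} (hφ : Differentiable ℝ φ)
    (h2 : ∀ x y, ‖fderiv ℝ φ x - fderiv ℝ φ y‖ ≤ K * ‖x - y‖) (hK : 0 ≤ K) (x η : E d) :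
    |φ (x + η) - φ x - fderiv ℝ φ x η| ≤ K * ‖η‖ ^ 2 := by
  have h3 := (convex_closedBall x ‖η‖).norm_image_sub_le_of_norm_fderiv_le' (𝕜 := ℝ) (f := φ)
    (φ := fderiv ℝ φ x) (C := K * ‖η‖) (fun z _ => hφ z) (fun z hz => (h2 z x).trans
      (mul_le_mul_of_nonneg_left (mem_closedBall_iff_norm.1 hz) hK))
    (Metric.mem_closedBall_self (norm_nonneg η)) (y := x + η) (by simp)
  rw [add_sub_cancel_left, Real.norm_eq_abs] at h3
  exact h3.trans_eq (by ring)

/-- A linear functional is controlled by its values on a spanning family. -/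
theorem exists_norm_sq_le_sum {l : ℤ → E d} (hl : Submodule.span ℝ (dirSet l d₁) = ⊤) :
    ∃ C : ℝ, 0 < C ∧ ∀ T : E d →L[ℝ] ℝ, ‖T‖ ^ 2 ≤ C ^ 2 * ∑ k ∈ signedIdx d₁, T (l k) ^ 2 := by
  let F : (E d →L[ℝ] ℝ) →ₗ[ℝ] ({k // k ∈ signedIdx d₁} → ℝ) :=
    { toFun := fun T k => T (l k)
      map_add' := fun _ _ => rfl
      map_smul' := fun _ _ => rfl }
  have hF : LinearMap.ker F = ⊥ := by
    rw [LinearMap.ker_eq_bot']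
    intro T hT
    have h1 : (T : E d →ₗ[ℝ] ℝ) = 0 := by
      refine LinearMap.ext_on hl ?_
      rintro z ⟨k, hk, rfl⟩
      exact congrFun hT ⟨k, hk⟩
    ext1 z
    exact congrArg (fun S : E d →ₗ[ℝ] ℝ => S z) h1
  obtain ⟨C, hC, hanti⟩ := F.exists_antilipschitzWith hF
  refine ⟨C, hC, fun T => ?_⟩
  have h1 : ‖T‖ ≤ C * ‖F T‖ := by
    have := hanti.le_mul_dist T 0
    rwa [map_zero, dist_zero_right, dist_zero_right] at this
  have h2 : ‖F T‖ ≤ √(∑ k ∈ signedIdx d₁, T (l k) ^ 2) := by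
    refine (pi_norm_le_iff_of_nonneg (Real.sqrt_nonneg _)).2 fun k => ?_
    rw [Real.norm_eq_abs]
    refine Real.abs_le_sqrt ?_
    exact Finset.single_le_sum (f := fun k => T (l k) ^ 2) (fun _ _ => sq_nonneg _) k.2
  have h3 : 0 ≤ ∑ k ∈ signedIdx d₁, T (l k) ^ 2 := Finset.sum_nonneg fun _ _ => sq_nonneg _
  calc ‖T‖ ^ 2 ≤ (C * √(∑ k ∈ signedIdx d₁, T (l k) ^ 2)) ^ 2 :=
        pow_le_pow_left₀ (norm_nonneg _) (h1.trans (mul_le_mul_of_nonneg_left h2 C.2)) 2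
    _ = _ := by rw [mul_pow, Real.sq_sqrt h3]

/-- A function with compact support of class `C²` has `C^{1,1}` bounds. -/
theorem exists_fderiv_bounds {φ : E d → ℝ} (hφ : ContDiff ℝ 2 φ) (hs : HasCompactSupport φ) :
    ∃ P : ℝ, 1 ≤ P ∧ (∀ x, |φ x| ≤ P) ∧ (∀ x, ‖fderiv ℝ φ x‖ ≤ P) ∧
      ∀ x y, ‖fderiv ℝ φ x - fderiv ℝ φ y‖ ≤ P * ‖x - y‖ := by
  have hs' : HasCompactSupport (fderiv ℝ φ) := hs.fderiv ℝ
  have hφ' : ContDiff ℝ 1 (fderiv ℝ φ) := hφ.fderiv_right (by norm_num)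
  obtain ⟨C₀, h0⟩ := hs.exists_bound_of_continuous hφ.continuous
  obtain ⟨C₁, h1⟩ := hs'.exists_bound_of_continuous hφ'.continuous
  obtain ⟨C₂, h2⟩ := hφ'.lipschitzWith_of_hasCompactSupport hs' one_ne_zero
  refine ⟨1 + |C₀| + |C₁| + C₂, ?_, fun x => ?_, fun x => ?_, fun x y => ?_⟩
  · linarith [abs_nonneg C₀, abs_nonneg C₁, C₂.2]
  · have := h0 x
    rw [Real.norm_eq_abs] at this
    linarith [le_abs_self C₀, abs_nonneg C₁, C₂.2]
  · linarith [h1 x, le_abs_self C₁, abs_nonneg C₀, C₂.2]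
  · have := h2.dist_le_mul x y
    rw [dist_eq_norm, dist_eq_norm] at this
    refine this.trans (mul_le_mul_of_nonneg_right ?_ (norm_nonneg _))
    linarith [abs_nonneg C₀, abs_nonneg C₁]

/-- The gradient does not vanish in a neighbourhood of the boundary. -/
theorem exists_half_lt_norm_fderiv {φ : E d → ℝ} (hφ : ContDiff ℝ 2 φ)
    (hb : Bornology.IsBounded {x | 0 < φ x})
    (hD : ∀ x ∈ frontier {x | 0 < φ x}, 1 ≤ ‖fderiv ℝ φ x‖) :
    ∃ ε : ℝ, 0 < ε ∧ ∀ x, 0 < φ x → φ x < ε → 1 / 2 < ‖fderiv ℝ φ x‖ := by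
  have hφ' : Continuous (fderiv ℝ φ) := hφ.continuous_fderiv two_ne_zero
  have hopen : IsOpen {x | 0 < φ x} := isOpen_lt continuous_const hφ.continuous
  -- This compact set misses the boundary, so `φ` has a positive minimum on it if it is nonempty.
  set S := closure {x | 0 < φ x} ∩ {x | ‖fderiv ℝ φ x‖ ≤ 1 / 2} with hS
  have hSc : IsCompact S :=
    hb.isCompact_closure.inter_right (isClosed_le hφ'.norm continuous_const)
  have hpos : ∀ x ∈ S, 0 < φ x := by
    rintro x ⟨hx, hx'⟩
    by_contra hc
    have h1 : x ∈ frontier {x | 0 < φ x} := by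
      rw [hopen.frontier_eq]
      exact ⟨hx, hc⟩
    have h2 := hD x h1
    have h3 : ‖fderiv ℝ φ x‖ ≤ 1 / 2 := hx'
    linarith
  rcases S.eq_empty_or_nonempty with he | hne
  · refine ⟨1, one_pos, fun x hx _ => ?_⟩
    by_contra! hc
    have : x ∈ S := ⟨subset_closure hx, hc⟩
    rw [he] at this
    exact this
  · obtain ⟨z, hz, hmin⟩ := hSc.exists_isMinOn hne hφ.continuous.continuousOn
    refine ⟨φ z, hpos z hz, fun x hx hxz => ?_⟩
    by_contra! hc
    have : φ z ≤ φ x := hmin (show x ∈ S from ⟨subset_closure hx, hc⟩)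
    linarith

theorem exists_notMem_of_isBounded (hd : 1 ≤ d) {Ω : Set (E d)} (hΩ : Bornology.IsBounded Ω) :
    ∃ p, p ∉ Ω := by
  obtain ⟨R, hR, hsub⟩ := hΩ.subset_ball_lt 0 0
  refine ⟨EuclideanSpace.single (⟨0, hd⟩ : Fin d) R, fun hc => ?_⟩
  have := hsub hc
  rw [mem_ball_zero_iff, PiLp.norm_single, Real.norm_of_nonneg hR.le] at this
  exact lt_irrefl _ this

/-- A truncation of a defining function which does not change the domain. -/
theorem exists_truncation {ψ : E d → ℝ} (hψ : ContDiff ℝ 2 ψ)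
    (hb : Bornology.IsBounded {x | 0 < ψ x})
    (hD : ∀ x ∈ frontier {x | 0 < ψ x}, 1 ≤ ‖fderiv ℝ ψ x‖) :
    ∃ φ : E d → ℝ, ContDiff ℝ 2 φ ∧ HasCompactSupport φ ∧ {x | 0 < φ x} = {x | 0 < ψ x} ∧
      ∀ x ∈ frontier {x | 0 < φ x}, 1 ≤ ‖fderiv ℝ φ x‖ := by
  obtain ⟨R, hR, hsub⟩ := hb.subset_ball_lt 0 0
  -- The cutoff is `1` near the closure of the domain, so boundary gradients are unchanged while
  -- global derivative bounds become available.
  let χ : ContDiffBump (0 : E d) := ⟨R + 1, R + 2, by linarith, by linarith⟩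
  have hset : {x | 0 < χ x * ψ x} = {x | 0 < ψ x} := by
    ext x
    constructor
    · intro hx
      exact not_le.1 fun hc => (mul_nonpos_of_nonneg_of_nonpos χ.nonneg hc).not_gt hx
    · intro hx
      have h1 : x ∈ Metric.closedBall (0 : E d) (R + 1) :=
        Metric.ball_subset_closedBall (Metric.ball_subset_ball (by linarith) (hsub hx))
      have h2 : χ x = 1 := χ.one_of_mem_closedBall h1
      show 0 < χ x * ψ x
      rw [h2, one_mul]
      exact hx
  refine ⟨fun x => χ x * ψ x, χ.contDiff.mul hψ, χ.hasCompactSupport.mul_right, hset, fun x hx => ?_⟩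
  rw [hset] at hx
  have h1 : x ∈ Metric.ball (0 : E d) (R + 1) :=
    Metric.closedBall_subset_ball (by linarith)
      (closure_minimal (hsub.trans Metric.ball_subset_closedBall) Metric.isClosed_closedBall
        (frontier_subset_closure hx))
  have h2 : (fun x => χ x * ψ x) =ᶠ[nhds x] ψ := by
    filter_upwards [χ.eventuallyEq_one_of_mem_ball h1] with y hy
    rw [hy, Pi.one_apply, one_mul]
  rw [h2.fderiv_eq]
  exact hD x hx

/-- Near the boundary, move a distance at most `8φ(x)` in a direction with slope at most `-1/2`: the
linear drop `4φ(x)` beats `φ(x)` plus the quadratic error, so the domain is left. Elsewhere `φ` is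
bounded below and the distance is bounded. -/
theorem exists_rho_le {φ : E d → ℝ} {P ε : ℝ} (hd : 1 ≤ d) (hP : 1 ≤ P) (hφ : Differentiable ℝ φ)
    (h2 : ∀ x y, ‖fderiv ℝ φ x - fderiv ℝ φ y‖ ≤ P * ‖x - y‖)
    (hb : Bornology.IsBounded {x | 0 < φ x}) (hε : 0 < ε)
    (hεD : ∀ x, 0 < φ x → φ x < ε → 1 / 2 < ‖fderiv ℝ φ x‖) :
    ∃ C : ℝ, 0 ≤ C ∧ ∀ x, 0 < φ x → rho {x | 0 < φ x} x ≤ C * φ x := by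
  obtain ⟨p, hp⟩ := exists_notMem_of_isBounded hd hb
  obtain ⟨R, hR, hsub⟩ := hb.subset_ball_lt 0 p
  have hP0 : 0 < P := by linarith
  set ε' := min ε (1 / (64 * P)) with hε'
  have hε'0 : 0 < ε' := lt_min hε (by positivity)
  refine ⟨8 + R / ε', by positivity, fun x hx => ?_⟩
  have hRε : 0 ≤ R / ε' * φ x := by positivity
  by_cases hc : φ x < ε'
  · obtain ⟨ν, hν, hTν⟩ := (fderiv ℝ φ x).exists_lt_apply_of_lt_opNorm
      (hεD x hx (hc.trans_le (min_le_left _ _)))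
    obtain ⟨η, hη, hTη⟩ : ∃ η : E d, ‖η‖ ≤ 1 ∧ fderiv ℝ φ x η ≤ -(1 / 2) := by
      rw [Real.norm_eq_abs] at hTν
      rcases le_total 0 (fderiv ℝ φ x ν) with h0 | h0
      · rw [abs_of_nonneg h0] at hTν
        exact ⟨-ν, by rw [norm_neg]; exact hν.le, by rw [map_neg]; linarith⟩
      · rw [abs_of_nonpos h0] at hTν
        exact ⟨ν, hν.le, by linarith⟩
    have h3 := (abs_le.1 (abs_taylor_le hφ h2 hP0.le x ((8 * φ x) • η))).2
    rw [map_smul, smul_eq_mul, norm_smul, Real.norm_of_nonneg (by positivity)] at h3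
    have h4 : (8 * φ x * ‖η‖) ^ 2 ≤ (8 * φ x) ^ 2 :=
      pow_le_pow_left₀ (by positivity) (mul_le_of_le_one_right (by positivity) hη) 2
    have h5 : P * φ x ≤ 1 / 64 := by
      have := (hc.trans_le (min_le_right _ _)).le
      rw [le_div_iff₀ (by positivity)] at this
      linarith
    have h6 : φ (x + (8 * φ x) • η) ≤ 0 := by
      have h7 := mul_le_mul_of_nonneg_left h4 hP0.le
      have h8 : P * (8 * φ x) ^ 2 = 64 * (P * φ x) * φ x := by ring
      have h9 : 64 * (P * φ x) * φ x ≤ 1 * φ x := mul_le_mul_of_nonneg_right (by linarith) hx.le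
      have h10 := mul_le_mul_of_nonneg_left hTη (by positivity : 0 ≤ 8 * φ x)
      linarith
    have h7 : rho {x | 0 < φ x} x ≤ dist x (x + (8 * φ x) • η) :=
      Metric.infDist_le_dist_of_mem (show x + (8 * φ x) • η ∈ {x | 0 < φ x}ᶜ from not_lt.2 h6)
    rw [dist_eq_norm, sub_add_cancel_left, norm_neg, norm_smul,
      Real.norm_of_nonneg (by positivity)] at h7
    have h8 : 8 * φ x * ‖η‖ ≤ 8 * φ x := mul_le_of_le_one_right (by positivity) hη
    linarith
  · have h1 : rho {x | 0 < φ x} x ≤ dist x p :=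
      Metric.infDist_le_dist_of_mem (show p ∈ {x | 0 < φ x}ᶜ from hp)
    have h2 : dist x p < R := hsub (show x ∈ {x | 0 < φ x} from hx)
    have h3 : R ≤ R / ε' * φ x := by
      rw [div_mul_eq_mul_div, le_div_iff₀ hε'0]
      exact mul_le_mul_of_nonneg_left (not_lt.1 hc) hR.le
    linarith

theorem max_le_mul_rho {φ : E d → ℝ} {P : ℝ} (hφ : C11Bounds φ P) (hP : 0 < P)
    (hne : ∃ p, p ∉ {x | 0 < φ x}) (x : E d) : max (φ x) 0 ≤ P * rho {x | 0 < φ x} x := by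
  refine max_le ?_ (mul_nonneg hP.le Metric.infDist_nonneg)
  rw [← div_le_iff₀' hP]
  refine (Metric.le_infDist hne).2 fun y hy => ?_
  have h1 : φ y ≤ 0 := not_lt.1 hy
  have h2 := (abs_le.1 (hφ.abs_sub_le x y)).2
  rw [div_le_iff₀' hP, dist_eq_norm]
  linarith

/-- As the directions span, `∑ (Dφ l_k)²` controls `|Dφ|²`, which exceeds `1/4` near the boundary.
Replacing derivatives by differences costs `O(h)` in each term, so half of this lower bound survives
up to a factor for small `h`. -/
theorem exists_defining (hd : 1 ≤ d) {l : ℤ → E d} (hl : ∀ k ∈ signedIdx d₁, ‖l k‖ ≤ 1)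
    (hspan : Submodule.span ℝ (dirSet l d₁) = ⊤) {ψ : E d → ℝ} (hψ : ContDiff ℝ 2 ψ)
    (hb : Bornology.IsBounded {x | 0 < ψ x})
    (hD : ∀ x ∈ frontier {x | 0 < ψ x}, 1 ≤ ‖fderiv ℝ ψ x‖) :
    ∃ (φ : E d → ℝ) (P ε₀ κ₀ h₁ C : ℝ), {x | 0 < φ x} = {x | 0 < ψ x} ∧
      Defining d₁ l φ P ε₀ κ₀ h₁ ∧ 0 ≤ C ∧ (∀ x, 0 < φ x → rho {x | 0 < φ x} x ≤ C * φ x) ∧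
      ∀ x, max (φ x) 0 ≤ P * rho {x | 0 < φ x} x := by
  obtain ⟨φ, hφ, hφs, hset, hφD⟩ := exists_truncation hψ hb hD
  rw [← hset] at hb
  obtain ⟨P, hP1, hP0, hPd, hPl⟩ := exists_fderiv_bounds hφ hφs
  obtain ⟨ε, hε, hεD⟩ := exists_half_lt_norm_fderiv hφ hb hφD
  obtain ⟨C, hC, hCT⟩ := exists_norm_sq_le_sum hspan
  have hφd : Differentiable ℝ φ := hφ.differentiable two_ne_zero
  obtain ⟨C', hC', hrho⟩ := exists_rho_le hd hP1 hφd hPl hb hε hεD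
  have hreg := C11Bounds.of_fderiv hφd hP0 hPd hPl
  have hPpos : 0 < P := by linarith
  set n : ℝ := ((signedIdx d₁).card : ℝ) with hn
  have hn0 : 0 ≤ n := by positivity
  refine ⟨φ, P, ε, 1 / (16 * C ^ 2), 1 / (4 * C * P * (n + 1)), C', hset,
    ⟨hreg, hP1, hε, by positivity, by positivity, fun h hh hh1 x hx hxε => ?_⟩, hC', hrho,
    max_le_mul_rho hreg hPpos (exists_notMem_of_isBounded hd hb)⟩
  set T := fderiv ℝ φ x with hT
  have h1 : ∀ k ∈ signedIdx d₁, T (l k) ^ 2 / 2 - (P * h) ^ 2 ≤ fdiff h (l k) φ x ^ 2 := by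
    intro k hk
    have h2 : |fdiff h (l k) φ x - T (l k)| ≤ P * h := by
      have h3 := abs_taylor_le hφd hPl hPpos.le x (h • l k)
      rw [map_smul, smul_eq_mul, norm_smul, Real.norm_of_nonneg hh.le, ← hT] at h3
      have h4 : (h * ‖l k‖) ^ 2 ≤ h ^ 2 :=
        pow_le_pow_left₀ (by positivity) (mul_le_of_le_one_right hh.le (hl k hk)) 2
      have e : fdiff h (l k) φ x - T (l k) = (φ (x + h • l k) - φ x - h * T (l k)) / h := by
        unfold fdiff; field_simp
      rw [e, abs_div, abs_of_pos hh, div_le_iff₀ hh]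
      refine h3.trans ((mul_le_mul_of_nonneg_left h4 hPpos.le).trans_eq (by ring))
    have h5 : (fdiff h (l k) φ x - T (l k)) ^ 2 ≤ (P * h) ^ 2 := by
      rw [← sq_abs]
      exact pow_le_pow_left₀ (abs_nonneg _) h2 2
    nlinarith [sq_nonneg (2 * fdiff h (l k) φ x - T (l k))]
  have h2 := Finset.sum_le_sum h1
  rw [Finset.sum_sub_distrib, Finset.sum_const, nsmul_eq_mul, ← Finset.sum_div, ← hn] at h2
  refine le_trans ?_ h2
  have h3 := hCT T
  have h4 : 1 / 2 < ‖T‖ := hεD x hx hxε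
  have h5 : 1 / (4 * C ^ 2) ≤ ∑ k ∈ signedIdx d₁, T (l k) ^ 2 := by
    rw [div_le_iff₀ (by positivity)]
    nlinarith
  have h6 : n * (P * h) ^ 2 ≤ 1 / (16 * C ^ 2) := by
    have h7 : P * h ≤ 1 / (4 * C * (n + 1)) := by
      refine (mul_le_mul_of_nonneg_left hh1 hPpos.le).trans_eq ?_
      field_simp
    have h8 : (P * h) ^ 2 ≤ (1 / (4 * C * (n + 1))) ^ 2 := pow_le_pow_left₀ (by positivity) h7 2
    have h9 : n * (1 / (4 * C * (n + 1))) ^ 2 = 1 / (16 * C ^ 2) * (n / (n + 1) ^ 2) := by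
      field_simp; ring
    have h10 : n / (n + 1) ^ 2 ≤ 1 := by
      rw [div_le_one (by positivity)]
      nlinarith
    calc n * (P * h) ^ 2 ≤ n * (1 / (4 * C * (n + 1))) ^ 2 := mul_le_mul_of_nonneg_left h8 hn0
      _ = 1 / (16 * C ^ 2) * (n / (n + 1) ^ 2) := h9
      _ ≤ 1 / (16 * C ^ 2) * 1 := mul_le_mul_of_nonneg_left h10 (by positivity)
      _ = _ := mul_one _
  have h7 : 1 / (4 * C ^ 2) / 2 - 1 / (16 * C ^ 2) = 1 / (16 * C ^ 2) := by
    field_simp; ring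
  linarith

end Geometry

/-! ### Passage to the distance function. -/

section Final

theorem SumClosed.of_dirSet {l : ℤ → E d} {d₀ : ℕ} (hle : d₀ ≤ d₁)
    (hsub : dirSet l d₁ ⊆ dirSet l d₀ + dirSet l d₀)
    (hadd : {z | ∃ l' ∈ dirSet l d₀, ∃ l'' ∈ dirSet l d₀, l' ≠ l'' ∧ z = l' + l''} ⊆ dirSet l d₁) :
    SumClosed d₁ d₀ l where
  le := hle
  decompose k hk := by
    obtain ⟨_, ⟨i, hi, rfl⟩, _, ⟨j, hj, rfl⟩, h⟩ := Set.mem_add.1 (hsub ⟨k, hk, rfl⟩)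
    exact ⟨i, hi, j, hj, h.symm⟩
  add_mem i hi j hj hij := hadd ⟨l i, ⟨i, hi, rfl⟩, l j, ⟨j, hj, rfl⟩, hij, rfl⟩

theorem abs_fdiff_fdiff_le_of_abs_fdiff_le {v : E d → ℝ} {h N : ℝ} (hh : 0 < h) {ξ η : E d}
    (hv : ∀ x, |fdiff h η v x| ≤ N) (x : E d) : |fdiff h ξ (fdiff h η v) x| ≤ 2 * N / h := by
  rw [fdiff, abs_div, abs_of_pos hh]
  refine div_le_div_of_nonneg_right ?_ hh.le
  linarith [abs_sub (fdiff h η v (x + h • ξ)) (fdiff h η v x), hv (x + h • ξ), hv x]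

/-- The estimate of mixed second differences in terms of the distance to the boundary, from the
weighted estimate of pure second differences. -/
theorem Defining.rho_mul_abs_fdiff_fdiff_le {l : ℤ → E d} {φ v : E d → ℝ}
    {P ε₀ κ₀ h₁ C N N₂ h : ℝ} {d₀ : ℕ} (hφ : Defining d₁ l φ P ε₀ κ₀ h₁) (hC : 0 ≤ C)
    (hrho : ∀ x, 0 < φ x → rho {x | 0 < φ x} x ≤ C * φ x) (hΛ : SumClosed d₁ d₀ l)
    (hl : ∀ k ∈ signedIdx d₁, ‖l k‖ ≤ 1) (hh : 0 < h) (hN : 0 ≤ N) (hN₂ : 0 ≤ N₂)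
    (hv : ∀ k ∈ signedIdx d₁, ∀ x, |fdiff h (l k) v x| ≤ N)
    (hv₂ : ∀ k ∈ signedIdx d₁, ∀ x, 0 < φ x → φ x * |sdiff h (l k) v x| ≤ N₂)
    {i j : ℤ} (hi : i ∈ signedIdx d₁) (hj : j ∈ signedIdx d₁) (x : E d) :
    (rho {x | 0 < φ x} x - 6 * h) * |fdiff h (l i) (fdiff h (l j) v) x|
      ≤ 20 * C * P * N + 20 * C * N₂ := by
  have hP : 0 < P := one_pos.trans_le hφ.one_le
  set D := |fdiff h (l i) (fdiff h (l j) v) x| with hD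
  have hD0 : 0 ≤ D := abs_nonneg _
  have hle : (rho {x | 0 < φ x} x - 6 * h) * D ≤ rho {x | 0 < φ x} x * D :=
    mul_le_mul_of_nonneg_right (by linarith) hD0
  refine hle.trans ?_
  rcases le_or_gt (φ x) 0 with h0 | h0
  · have h1 : rho {x | 0 < φ x} x = 0 := Metric.infDist_zero_of_mem (not_lt.2 h0)
    rw [h1, zero_mul]
    positivity
  have h1 := hrho x h0
  refine (mul_le_mul_of_nonneg_right h1 hD0).trans ?_
  -- Near the boundary the crude bound `2N/h` is compensated by `φ = O(h)`. Farther in, `φ` at least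
  -- halves nowhere within `4h`, in the sense `φ(y) ≥ φ(x)/2`, so polarization applies.
  rcases le_or_gt (φ x) (10 * P * h) with h2 | h2
  · have h3 : D ≤ 2 * N / h := abs_fdiff_fdiff_le_of_abs_fdiff_le hh (hv j hj) x
    calc C * φ x * D ≤ C * (10 * P * h) * (2 * N / h) := by gcongr
      _ = 20 * C * P * N := by field_simp; ring
      _ ≤ _ := le_add_of_nonneg_right (by positivity)
  · have h3 : D ≤ 10 * (2 * N₂ / φ x) := by
      refine hΛ.abs_fdiff_fdiff_le hh hl (fun k hk y hy => ?_) hi hj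
      have h4 := abs_le.1 (hφ.reg.abs_sub_le y x)
      have h5 : P * ‖y - x‖ ≤ P * (4 * h) := mul_le_mul_of_nonneg_left hy hP.le
      have h6 : φ x / 2 ≤ φ y := by linarith [h4.1]
      rw [le_div_iff₀ h0]
      have h7 := hv₂ k hk y (by linarith)
      have h8 := mul_le_mul_of_nonneg_right h6 (abs_nonneg (sdiff h (l k) v y))
      linarith
    calc C * φ x * D ≤ C * φ x * (10 * (2 * N₂ / φ x)) := by gcongr
      _ = 20 * C * N₂ := by field_simp; ring
      _ ≤ _ := le_add_of_nonneg_left (by positivity)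

end Final

end BellmanFD

end

/-! ### Assembly of the estimates. -/

theorem theorem7p22p1 {A : Type*} [Nonempty A] (d d₁ : ℕ) (hd : 1 ≤ d)
    (l : ℤ → BellmanFD.E d) (a b : A → ℤ → BellmanFD.E d → ℝ)
    (c f : A → BellmanFD.E d → ℝ) (g : BellmanFD.E d → ℝ)
    (δ K : ℝ) (hδ : 0 < δ) (hK : 0 < K)
    (hl_ball : ∀ k ∈ BellmanFD.signedIdx d₁, ‖l k‖ ≤ 1)
    -- nondegeneracy and regularity of the coefficients and of the boundary data
    (ha_lower : ∀ α, ∀ k ∈ BellmanFD.signedIdx d₁, ∀ x, δ ≤ a α k x)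
    (hc_lower : ∀ α x, δ ≤ c α x)
    (ha : ∀ α, ∀ k ∈ BellmanFD.signedIdx d₁, BellmanFD.C11Le (a α k) K)
    (hb : ∀ α, ∀ k ∈ BellmanFD.signedIdx d₁, BellmanFD.C11Le (b α k) K)
    (hc : ∀ α, BellmanFD.C11Le (c α) K)
    (hf : ∀ α, BellmanFD.C11Le (f α) K)
    (hg : BellmanFD.C11Le g K)
    -- symmetry
    (hl_symm : ∀ k ∈ BellmanFD.signedIdx d₁, l k = -l (-k))
    (ha_symm : ∀ α, ∀ k ∈ BellmanFD.signedIdx d₁, ∀ x, a α k x = a α (-k) x)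
    -- structure of the set of directions
    (hΛ : ∃ d₀ : ℕ, 1 ≤ d₀ ∧ d₀ ≤ d₁ ∧
      (0 : BellmanFD.E d) ∈ BellmanFD.dirSet l d₀ ∧
      BellmanFD.dirSet l d₁ ⊆ BellmanFD.dirSet l d₀ + BellmanFD.dirSet l d₀ ∧
      {z | ∃ l' ∈ BellmanFD.dirSet l d₀, ∃ l'' ∈ BellmanFD.dirSet l d₀,
        l' ≠ l'' ∧ z = l' + l''} ⊆ BellmanFD.dirSet l d₁)
    (hl_rat : ∀ k ∈ BellmanFD.signedIdx d₁, ∀ i : Fin d, ∃ q : ℚ, l k i = (q : ℝ))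
    (hl_span : Submodule.span ℝ (BellmanFD.dirSet l d₁) = ⊤)
    -- the domain
    (ψ : BellmanFD.E d → ℝ) (hψ : ContDiff ℝ 2 ψ)
    (Ω : Set (BellmanFD.E d)) (hΩ : Ω = {x | 0 < ψ x})
    (hΩ_bdd : Bornology.IsBounded Ω) (hΩ_conn : IsConnected Ω)
    (hψ_bdry : ∀ x ∈ frontier Ω, 1 ≤ ‖fderiv ℝ ψ x‖) :
    ∃ N : ℝ, 0 ≤ N ∧ ∃ h₀ : ℝ, 0 < h₀ ∧ ∀ h : ℝ, 0 < h → h ≤ h₀ →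
      (∃! v : BellmanFD.E d → ℝ, BellmanFD.IsBddBorelSolution d₁ l a b c f g Ω h v) ∧
      ∀ v : BellmanFD.E d → ℝ, BellmanFD.IsBddBorelSolution d₁ l a b c f g Ω h v →
        (∀ x, |v x - g x| ≤ N * BellmanFD.rho Ω x) ∧
        (∀ i ∈ BellmanFD.signedIdx d₁, ∀ x, |BellmanFD.fdiff h (l i) v x| ≤ N) ∧
        (∀ i ∈ BellmanFD.signedIdx d₁, ∀ j ∈ BellmanFD.signedIdx d₁, ∀ x,
          (BellmanFD.rho Ω x - 6 * h) *
            |BellmanFD.fdiff h (l i) (BellmanFD.fdiff h (l j) v) x| ≤ N) ∧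
        (∀ x y, |v x - v y| ≤ N * (‖x - y‖ + h)) := by
  have hδK : δ ≤ K := by
    obtain ⟨α⟩ := ‹Nonempty A›
    exact (hc_lower α 0).trans ((le_abs_self _).trans (((hc α).bounds hK.le).abs_le 0))
  have H : BellmanFD.Admissible d₁ l a b c f g δ K :=
    { pos := hδ
      le := hδK
      norm_le := hl_ball
      neg := fun k hk => by rw [hl_symm k hk, neg_neg]
      a_neg := fun α k hk x => (ha_symm α k hk x).symm
      a_lower := ha_lower
      c_lower := hc_lower
      a_reg := fun α k hk => (ha α k hk).bounds hK.le
      b_reg := fun α k hk => (hb α k hk).bounds hK.le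
      c_reg := fun α => (hc α).bounds hK.le
      f_reg := fun α => (hf α).bounds hK.le
      g_reg := hg.bounds hK.le }
  subst hΩ
  obtain ⟨d₀, -, hle, -, hsub, hadd⟩ := hΛ
  have hS := BellmanFD.SumClosed.of_dirSet hle hsub hadd
  have hopen : IsOpen {x | 0 < ψ x} := isOpen_lt continuous_const hψ.continuous
  obtain ⟨φ, P, ε₀, κ₀, h₁, C, hset, hφ, hC, hrho, hmax⟩ :=
    BellmanFD.exists_defining hd hl_ball hl_span hψ hΩ_bdd hψ_bdry
  -- From here the domain is described by the truncated function, which has global `C^{1,1}` bounds.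
  rw [← hset] at hopen ⊢
  obtain ⟨B, hB, h₀, hh₀, hbd⟩ := H.exists_boundary_bound hφ
  obtain ⟨N₁, hN₁, hgr⟩ := H.exists_gradient_bound hφ.reg hB hbd
  obtain ⟨N₂, hN₂, htr⟩ := H.exists_translation_bound hφ.reg hB hN₁ hbd hgr
  obtain ⟨N₃, hN₃, hhess⟩ := H.exists_hessian_bound hφ.reg hφ.one_le hS hN₁ hgr
  have hP : 0 < P := one_pos.trans_le hφ.one_le
  have hBP : 0 ≤ B * P := by positivity
  have hCN : 0 ≤ 20 * C * P * N₁ + 20 * C * N₃ := by positivity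
  refine ⟨B * P + N₁ + N₂ + (20 * C * P * N₁ + 20 * C * N₃), by linarith,
    min h₀ (min 1 (δ / (2 * K))), lt_min hh₀ (lt_min one_pos (by positivity)), fun h hh hle => ?_⟩
  have hle₀ : h ≤ h₀ := hle.trans (min_le_left _ _)
  have hs : BellmanFD.SmallStep δ K h :=
    ⟨hh, hle.trans ((min_le_right _ _).trans (min_le_left _ _)), by
      have h3 := hle.trans ((min_le_right _ _).trans (min_le_right _ _))
      rw [le_div_iff₀ (by positivity)] at h3
      linarith⟩
  refine ⟨?_, fun v hv => ⟨fun x => ?_, fun i hi x => ?_, fun i hi j hj x => ?_, fun x y => ?_⟩⟩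
  · obtain ⟨v, hv⟩ := H.exists_solution hs hopen
    exact ⟨v, hv, fun w hw => funext fun x =>
      le_antisymm (hw.le_of_isBddBorelSolution H hs hv x) (hv.le_of_isBddBorelSolution H hs hw x)⟩
  · have h3 := (hbd h hs hle₀ v hv x).trans (mul_le_mul_of_nonneg_left (hmax x) hB)
    rw [← mul_assoc] at h3
    exact h3.trans (mul_le_mul_of_nonneg_right (by linarith) Metric.infDist_nonneg)
  · exact (hgr h hs hle₀ v hv i hi x).trans (by linarith)
  · exact (hφ.rho_mul_abs_fdiff_fdiff_le hC hrho hS hl_ball hh hN₁ hN₃ (hgr h hs hle₀ v hv)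
      (hhess h hs hle₀ v hv) hi hj x).trans (by linarith)
  · exact (BellmanFD.abs_sub_le_of_abs_fdiff_le hh hN₂ (htr h hs hle₀ v hv) x y).trans
      (mul_le_mul_of_nonneg_right (by linarith) (by positivity))
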